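/- **Setting.** Let $d\in\mathbb N$, let $\ell\in\mathbb N$ be even, and let $\mathcal A(\xi)=\sum_{|\alpha|=\ell}b_\alpha\xi^\alpha$ ($b_\alpha\in\mathbb C$) be strongly elliptic: $\operatorname{Re}\mathcal A(\xi)\ge c|\xi|^\ell$ for all $\xi\in\mathbb R^d$ and some $c>0$. Put $\mathcal D_j=-i\partial/\partial y_j$. For $\varepsilon>0$ let $\mathbb R^d_\varepsilon=(\varepsilon\mathbb Z)^d$, let $\delta_{\varepsilon,k\pm}u(y)=u(y\pm\varepsilon e_k)-u(y)$, and let $$\mathbf A_\varepsilon=\varepsilon^{-\ell}\sum_{\ell\le|\nu|\le\hat\ell}a_\nu\,\delta_{\varepsilon,1-}^{\nu_1}\delta_{\varepsilon,1+}^{\nu_2}\cdots\delta_{\varepsilon,d-}^{\nu_{2d-1}}\delta_{\varepsilon,d+}^{\nu_{2d}},\qquad a_\nu\in\mathbb C,$$ with symbol $A(\theta)$ obtained from $\varepsilon^{\ell}\mathbf A_\varepsilon$ by replacing each $\delta_{\varepsilon,k\pm}$ by $e^{\pm i\theta_k}-1$. Assume that, for some integer $M\ge1$, $\mathbf A_\varepsilon$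 is an $M$th order approximation of $\mathcal A(\mathcal D)$: for every $u:\mathbb R^d\to\mathbb C$ that is continuous and bounded with all its derivatives there is $C(u)>0$ with $\sup_{y\in\mathbb R^d}|\mathbf A_\varepsilon u(y)-\mathcal A(\mathcal D)u(y)|\le C(u)\varepsilon^M$ for all $\varepsilon>0$. Assume also $\operatorname{Re}A(\theta)>0$ for all $\theta\in R_\pi\setminus\{0\}$, $R_\pi=[-\pi,\pi]^d$. A second discrete Green function is a function $\mathbf v^\varepsilon(x,t)$, $x\in\mathbb R^d_\varepsilon$, $t\ge0$, such that $\mathbf v^\varepsilon(\cdot,t)$ decays faster than any negative power of $|x|$ for each $t\ge0$, $\mathbf v^\varepsilon(x,\cdot)\in C^1[0,\infty)$ for each $x$, $\dot{\mathbf v}^\varepsilon+\mathbf A_\varepsilon\mathbf v^\varepsilon=\boldsymbol\delta^\varepsilon$ for $t>0$, and $\mathbf v^\varepsilon(x,0)=0$; here $\boldsymbol\delta^\varepsilon(0)=\varepsilon^{-d}$ and $\boldsymbol\delta^\varepsilon(x)=0$ for $x\ne0$. Let $\mathcal A_m(\theta)$ be the homogeneous part of degree $m$ of the Taylor expansion of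 $A(\theta)$ at $\theta=0$. Let $\mathcal P_k(\xi)$ be the coefficient of $s^k$ in the formal power series $\exp\bigl(-\sum_{j\ge1}s^j\mathcal A_{j+\ell}(\xi)\bigr)$, so that $\mathcal P_0=1$. Put $$H(y)=\frac1{(2\pi)^d}\int_{\mathbb R^d}e^{-\mathcal A(\xi)}e^{iy\xi}\,d\xi,\qquad H_k=\mathcal P_k(\mathcal D)H\quad(k\ge0),$$ and, for $k>\ell-d$ and $r=|y|$, $$F_k(y)=-\frac{\ell}{r^{d+k-\ell}}\int_0^r\rho^{d+k-\ell-1}H_k(\rho y/|y|)\,d\rho\quad(y\ne0),\qquad F_k(0)=-\frac{\ell}{d+k-\ell}H_k(0).$$ **Theorem.** Let $\ell-d\le-1$. Then the integral $$\Omega(y)=\frac1{(2\pi)^d}\int_{R_\pi}\frac{e^{iy\theta}}{A(\theta)}\,d\theta$$ converges absolutely for every $y\in\mathbb R^d$; the integral defining $H$ converges absolutely and $H\in C^\infty(\mathbb R^d)$; and for every $\varepsilon>0$ a second discrete Green function exists. Moreover, for all $t_0>0$ and integers $K\ge M$ there is $R\ge0$ such that, for all $\varepsilon>0$, every second discrete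 Green function $\mathbf v^\varepsilon$, all $x\in\mathbb R^d_\varepsilon$ and all $t\ge t_0\varepsilon^\ell$, $$\mathbf v^\varepsilon(x,t)=\varepsilon^{\ell-d}\,\Omega\!\left(\frac x\varepsilon\right)+t^{1-d/\ell}F_0\!\left(\frac x{t^{1/\ell}}\right)+\sum_{k=M}^K\varepsilon^k\,t^{1-(k+d)/\ell}F_k\!\left(\frac x{t^{1/\ell}}\right)+\mathbf r^\varepsilon_{\mathbf v}(K;x,t),$$ $$|\mathbf r^\varepsilon_{\mathbf v}(K;x,t)|\le\varepsilon^{K+1}R\,t^{1-(K+d+1)/\ell}.$$ -/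

import Mathlib

open MeasureTheory

noncomputable section

namespace LatticeGreen

/-- The space `ℝ^d` with its Euclidean norm. -/
abbrev Space (d : ℕ) := EuclideanSpace ℝ (Fin d)

/-! ### Differential operators -/

/-- The operator `𝒟_j = -i ∂/∂y_j`. -/
def partialD {d : ℕ} (j : Fin d) (u : Space d → ℂ) : Space d → ℂ :=
  fun y => -Complex.I * lineDeriv ℝ u y (EuclideanSpace.single j 1)

/-- `𝒟^α = 𝒟_1^{α_1} ⋯ 𝒟_d^{α_d}`. -/
def partialDPow {d : ℕ} (α : Fin d →₀ ℕ) (u : Space d → ℂ) : Space d → ℂ :=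
  (List.finRange d).foldr (fun j g => (partialD j)^[α j] g) u

/-- The differential operator `p(𝒟) = ∑_α p_α 𝒟^α` of a polynomial `p(ξ) = ∑_α p_α ξ^α`. -/
def polyD {d : ℕ} (p : MvPolynomial (Fin d) ℂ) (u : Space d → ℂ) : Space d → ℂ :=
  fun y => ∑ α ∈ p.support, p.coeff α * partialDPow α u y

/-- The value `p(ξ)` of a polynomial at a real point `ξ`. -/
def evalAt {d : ℕ} (p : MvPolynomial (Fin d) ℂ) (ξ : Space d) : ℂ :=
  MvPolynomial.eval (fun j => (ξ j : ℂ)) p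

/-- Strong ellipticity: `Re p(ξ) ≥ c |ξ|^ℓ` for some `c > 0`. -/
def StronglyElliptic {d : ℕ} (p : MvPolynomial (Fin d) ℂ) (ℓ : ℕ) : Prop :=
  ∃ c : ℝ, 0 < c ∧ ∀ ξ : Space d, c * ‖ξ‖ ^ ℓ ≤ (evalAt p ξ).re

/-- Functions that are bounded and continuous together with all their derivatives. -/
def SmoothBounded {d : ℕ} (u : Space d → ℂ) : Prop :=
  ContDiff ℝ (⊤ : ℕ∞) u ∧ ∀ n : ℕ, ∃ C : ℝ, ∀ y, ‖iteratedFDeriv ℝ n u y‖ ≤ C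

/-! ### Difference operators

The coefficients `a_ν` of a difference operator are stored as a polynomial in `2d` variables:
the variable `Sum.inl k` stands for the backward difference `δ_{ε,k-}` and `Sum.inr k` for the
forward difference `δ_{ε,k+}`. -/

/-- `δ_{1-}^{ν_1} δ_{1+}^{ν_2} ⋯ δ_{d-}^{ν_{2d-1}} δ_{d+}^{ν_{2d}} u` on an additive group, where
`δ_{k±} u (x) = u (x ± h_k) - u x`. -/
def diffPow {d : ℕ} {G : Type*} [AddCommGroup G] (h : Fin d → G) (ν : Fin d ⊕ Fin d →₀ ℕ)
    (u : G → ℂ) : G → ℂ :=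
  (List.finRange d).foldr
    (fun k g => (fwdDiff (-h k))^[ν (Sum.inl k)] ((fwdDiff (h k))^[ν (Sum.inr k)] g)) u

/-- The difference operator `𝐀_ε = ε^{-ℓ} ∑_ν a_ν δ^ν`, with steps `h_k`. -/
def diffOp {d : ℕ} {G : Type*} [AddCommGroup G] (a : MvPolynomial (Fin d ⊕ Fin d) ℂ) (ℓ : ℕ)
    (ε : ℝ) (h : Fin d → G) (u : G → ℂ) : G → ℂ :=
  fun x => ((ε : ℂ) ^ ℓ)⁻¹ * ∑ ν ∈ a.support, a.coeff ν * diffPow h ν u x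

/-- `𝐀_ε` is an `M`th order approximation of `𝒜(𝒟)`. -/
def IsApproximation {d : ℕ} (a : MvPolynomial (Fin d ⊕ Fin d) ℂ) (ℓ M : ℕ)
    (p : MvPolynomial (Fin d) ℂ) : Prop :=
  ∀ u : Space d → ℂ, SmoothBounded u → ∃ C : ℝ, 0 < C ∧ ∀ ε : ℝ, 0 < ε → ∀ y : Space d,
    ‖diffOp a ℓ ε (fun k => EuclideanSpace.single k ε) u y - polyD p u y‖ ≤ C * ε ^ M

/-- The symbol `A(θ)` of the difference operator: `δ_{k±}` is replaced by `e^{± i θ_k} - 1`. -/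
def symbol {d : ℕ} (a : MvPolynomial (Fin d ⊕ Fin d) ℂ) (θ : Space d) : ℂ :=
  MvPolynomial.eval
    (Sum.elim (fun k => Complex.exp (-Complex.I * (θ k : ℂ)) - 1)
      (fun k => Complex.exp (Complex.I * (θ k : ℂ)) - 1)) a

/-- The cube `R_λ = {θ : |θ_k| ≤ λ for all k}`. -/
def cube (d : ℕ) (lam : ℝ) : Set (Space d) := {θ | ∀ k, |θ k| ≤ lam}

/-- `Re A(θ) > 0` on `R_π \ {0}`. -/
def DiscretelyElliptic {d : ℕ} (a : MvPolynomial (Fin d ⊕ Fin d) ℂ) : Prop :=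
  ∀ θ ∈ cube d Real.pi, θ ≠ 0 → 0 < (symbol a θ).re

/-! ### The grid and the second discrete Green function -/

/-- The grid `ℝ_ε^d = (ε ℤ)^d`. -/
def grid (d : ℕ) (ε : ℝ) : AddSubgroup (Space d) where
  carrier := {x | ∀ k, ∃ s : ℤ, x k = s * ε}
  zero_mem' := fun k => ⟨0, by simp⟩
  add_mem' := by
    intro x y hx hy k
    obtain ⟨s, hs⟩ := hx k
    obtain ⟨r, hr⟩ := hy k
    exact ⟨s + r, by simp [hs, hr, add_mul]⟩
  neg_mem' := by
    intro x hx k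
    obtain ⟨s, hs⟩ := hx k
    exact ⟨-s, by simp [hs]⟩

/-- The grid vector `ε e_k`. -/
def gridStep (d : ℕ) (ε : ℝ) (k : Fin d) : grid d ε :=
  ⟨EuclideanSpace.single k ε, fun j => by
    by_cases hjk : j = k
    · exact ⟨1, by simp [hjk]⟩
    · exact ⟨0, by simp [hjk]⟩⟩

/-- Grid functions that decay faster than any negative power of `|x|`. -/
def RapidlyDecreasing {d : ℕ} {ε : ℝ} (u : grid d ε → ℂ) : Prop :=
  ∀ n : ℕ, ∃ C : ℝ, ∀ x : grid d ε, ‖(x : Space d)‖ ^ n * ‖u x‖ ≤ C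

open Classical in
/-- The grid delta-function. -/
def gridDelta (d : ℕ) (ε : ℝ) (x : grid d ε) : ℂ :=
  if x = 0 then ((ε : ℂ) ^ d)⁻¹ else 0

/-- `v(x,t)`, `t ≥ 0`, is a second discrete Green function: `v(·,t)` is rapidly decreasing,
`v(x,·) ∈ C¹[0,∞)`, `∂v/∂t + 𝐀_ε v = 𝛅^ε` for `t > 0`, and `v(·,0) = 0`.
(Values at `t < 0` are irrelevant.) -/
structure IsSecondGreen {d : ℕ} (a : MvPolynomial (Fin d ⊕ Fin d) ℂ) (ℓ : ℕ) (ε : ℝ)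
    (v : grid d ε → ℝ → ℂ) : Prop where
  rapid : ∀ t : ℝ, 0 ≤ t → RapidlyDecreasing (fun x => v x t)
  contDiff : ∀ x, ContDiffOn ℝ 1 (v x) (Set.Ici 0)
  eqn : ∀ x, ∀ t : ℝ, 0 < t →
    deriv (v x) t + diffOp a ℓ ε (gridStep d ε) (fun z => v z t) x = gridDelta d ε x
  init : ∀ x, v x 0 = 0

/-! ### The coefficients of the expansion -/

/-- The formal power series in `s` of `A(sθ)`, with coefficients polynomial in `θ`. -/
def symbolSeries {d : ℕ} (a : MvPolynomial (Fin d ⊕ Fin d) ℂ) :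
    PowerSeries (MvPolynomial (Fin d) ℂ) :=
  MvPolynomial.eval₂ ((PowerSeries.C).comp MvPolynomial.C)
    (Sum.elim
      (fun k => PowerSeries.rescale (MvPolynomial.C (-Complex.I) * MvPolynomial.X k)
        (PowerSeries.exp (MvPolynomial (Fin d) ℂ)) - 1)
      (fun k => PowerSeries.rescale (MvPolynomial.C Complex.I * MvPolynomial.X k)
        (PowerSeries.exp (MvPolynomial (Fin d) ℂ)) - 1)) a

/-- `𝒜_m(θ)`, the homogeneous part of degree `m` of the Taylor expansion of `A(θ)` at `0`. -/
def taylorPart {d : ℕ} (a : MvPolynomial (Fin d ⊕ Fin d) ℂ) (m : ℕ) : MvPolynomial (Fin d) ℂ :=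
  PowerSeries.coeff m (symbolSeries a)

/-- The coefficient polynomial of `s^k` in `exp (- ∑_{j ≥ 1} s^j 𝒜_{j+ℓ}(ξ))`
(the `m`th power in the exponential series contributes to `s^k` only if `m ≤ k`). -/
def corrPoly {d : ℕ} (a : MvPolynomial (Fin d ⊕ Fin d) ℂ) (ℓ k : ℕ) : MvPolynomial (Fin d) ℂ :=
  ∑ m ∈ Finset.range (k + 1), MvPolynomial.C ((-1 : ℂ) ^ m / (m.factorial : ℂ)) *
    PowerSeries.coeff k
      ((PowerSeries.mk fun j => if j = 0 then 0 else taylorPart a (j + ℓ)) ^ m)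

/-- `H(y) = (2π)^{-d} ∫_{ℝ^d} e^{-𝒜(ξ)} e^{i y ξ} dξ`, the profile of the continuous Green
function. -/
def profileH {d : ℕ} (p : MvPolynomial (Fin d) ℂ) (y : Space d) : ℂ :=
  ((2 * (Real.pi : ℂ)) ^ d)⁻¹ *
    ∫ ξ : Space d, Complex.exp (-evalAt p ξ) * Complex.exp (Complex.I * (inner ℝ y ξ : ℂ))

/-- `H_k = 𝒫_k(𝒟) H`, where `𝒫_k` is the coefficient polynomial `corrPoly`; `H_0 = H`. -/
def profileHk {d : ℕ} (p : MvPolynomial (Fin d) ℂ) (a : MvPolynomial (Fin d ⊕ Fin d) ℂ)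
    (ℓ k : ℕ) : Space d → ℂ :=
  polyD (corrPoly a ℓ k) (profileH p)

open Classical in
/-- `F_k(y) = -ℓ r^{-(d+k-ℓ)} ∫_0^r ρ^{d+k-ℓ-1} H_k(ρ y/|y|) dρ` with `r = |y|` for `y ≠ 0`, and
`F_k(0) = -ℓ/(d+k-ℓ) H_k(0)`. Used only for `ℓ < d + k`, so the subtractions of natural numbers
do not truncate. -/
def profileFk {d : ℕ} (p : MvPolynomial (Fin d) ℂ) (a : MvPolynomial (Fin d ⊕ Fin d) ℂ)
    (ℓ k : ℕ) (y : Space d) : ℂ :=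
  if y = 0 then -((ℓ : ℂ) / ((d + k - ℓ : ℕ) : ℂ)) * profileHk p a ℓ k 0
  else -((ℓ : ℂ) / (‖y‖ : ℂ) ^ (d + k - ℓ)) *
    ∫ ρ in (0 : ℝ)..‖y‖, (ρ : ℂ) ^ (d + k - ℓ - 1) * profileHk p a ℓ k ((ρ / ‖y‖) • y)

/-- `Ω(y) = (2π)^{-d} ∫_{R_π} e^{i y θ} / A(θ) dθ`. -/
def Omega {d : ℕ} (a : MvPolynomial (Fin d ⊕ Fin d) ℂ) (y : Space d) : ℂ :=
  ((2 * (Real.pi : ℂ)) ^ d)⁻¹ *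
    ∫ θ in cube d Real.pi, Complex.exp (Complex.I * (inner ℝ y θ : ℂ)) / symbol a θ

end LatticeGreen

end

open MeasureTheory LatticeGreen

namespace LatticeGreen

noncomputable section

variable {d : ℕ}

/-! ### Fourier integrals -/

/-! On the lattice the problem is solved by Fourier series. With `τ = t/ε^ℓ`, the second Green
function is `ε^{ℓ-d} (2π)^{-d} ∫_{R_π} (1 - e^{-τA(θ)})/A(θ) · e^{ixθ/ε} dθ`
(`isSecondGreen_fourierGreen`, `IsSecondGreen.unique`). Near the origin `|A(θ)|` is at least a
multiple of `|θ|^ℓ`, and `ℓ < d`, so `1/A` is integrable. The integral therefore splits into the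
stationary part `Ω` and the part with `e^{-τA}/A` (`fourierGreen_eq`).

Put `Λ = τ^{-1/ℓ} = ε t^{-1/ℓ}`; the condition `t ≥ t₀ ε^ℓ` says that `Λ ≤ t₀^{-1/ℓ}`. Since
`e^{-Λ^{-ℓ}A}/A = ∫_0^Λ ℓ s^{-ℓ-1} e^{-s^{-ℓ}A} ds`, the second part is an integral over `s` of the
first Green function, the Fourier integral of `e^{-s^{-ℓ}A}` (`integral_discreteExp`). There the
substitution `θ = sξ` gives `s^{-ℓ}A(sξ) = 𝒜(ξ) + ∑_{j≥1} s^j 𝒜_{j+ℓ}(ξ)`. Exponentiating yields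
`∑_k s^{d+k} H_k(sy)` with an error `O(s^{d+K})` uniform in `y` (`comparison`,
`discreteExp_expansion`). Integrating term by term in `s` turns `H_k` into `-Λ^{d+k-ℓ} F_k(Λy)`
(`integral_profileHk`), and `Λy = x/t^{1/ℓ}` for `y = x/ε`.

The order of approximation enters through plane waves, which are eigenfunctions of both operators:
it forces `𝒜_ℓ = 𝒜` and `𝒜_{ℓ+j} = 0` for `0 < j < M`, so `𝒫_k = 0` for `0 < k < M`.

Uniqueness is delicate because decay in `x` is assumed at each time separately, with no uniformity
in `t`. A Baire category argument (`boundedNear_of_bounded`) supplies bounds that are locally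
uniform in time, after which short-time estimates apply. -/

/-- The plane wave `e^{i y ξ}`. -/
def wave (y ξ : Space d) : ℂ := Complex.exp (Complex.I * (inner ℝ y ξ : ℂ))

/-- The Fourier integral `∫ φ(ξ) e^{i y ξ} dμ(ξ)`. -/
def fourierInt (μ : Measure (Space d)) (φ : Space d → ℂ) (y : Space d) : ℂ :=
  ∫ ξ, φ ξ * wave y ξ ∂μ

lemma norm_wave (y ξ : Space d) : ‖wave y ξ‖ = 1 := by
  rw [wave, mul_comm, Complex.norm_exp_ofReal_mul_I]

lemma wave_add (y z ξ : Space d) : wave (y + z) ξ = wave y ξ * wave z ξ := by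
  rw [wave, wave, wave, ← Complex.exp_add, inner_add_left]
  push_cast
  ring_nf

lemma wave_zero (ξ : Space d) : wave 0 ξ = 1 := by simp [wave]

lemma wave_smul (c : ℝ) (y ξ : Space d) : wave (c • y) ξ = wave y (c • ξ) := by
  rw [wave, wave, real_inner_smul_left, real_inner_smul_right]

lemma continuous_wave (y : Space d) : Continuous (wave y) := by
  unfold wave
  fun_prop

lemma integrable_mul_wave {μ : Measure (Space d)} {φ : Space d → ℂ} (hφ : Integrable φ μ)
    (y : Space d) : Integrable (fun ξ => φ ξ * wave y ξ) μ := by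
  refine hφ.mono (hφ.aestronglyMeasurable.mul (continuous_wave y).aestronglyMeasurable) ?_
  exact Filter.Eventually.of_forall fun ξ => by simp [norm_wave]

lemma norm_fourierInt_le (μ : Measure (Space d)) (φ : Space d → ℂ) (y : Space d) :
    ‖fourierInt μ φ y‖ ≤ ∫ ξ, ‖φ ξ‖ ∂μ := by
  refine (norm_integral_le_integral_norm _).trans (le_of_eq ?_)
  simp [norm_wave]

lemma fourierInt_dirac (ξ : Space d) (φ : Space d → ℂ) (y : Space d) :
    fourierInt (Measure.dirac ξ) φ y = φ ξ * wave y ξ := by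
  simp [fourierInt]

lemma fourierInt_zero (μ : Measure (Space d)) (y : Space d) :
    fourierInt μ (fun _ => 0) y = 0 := by
  simp [fourierInt]

lemma fourierInt_const_mul (μ : Measure (Space d)) (c : ℂ) (φ : Space d → ℂ) (y : Space d) :
    fourierInt μ (fun ξ => c * φ ξ) y = c * fourierInt μ φ y := by
  simp only [fourierInt, mul_assoc]
  exact integral_const_mul _ _

lemma fourierInt_sub {μ : Measure (Space d)} {φ ψ : Space d → ℂ} (hφ : Integrable φ μ)
    (hψ : Integrable ψ μ) (y : Space d) :
    fourierInt μ (fun ξ => φ ξ - ψ ξ) y = fourierInt μ φ y - fourierInt μ ψ y := by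
  simp only [fourierInt, sub_mul]
  exact integral_sub (integrable_mul_wave hφ y) (integrable_mul_wave hψ y)

lemma fourierInt_finset_sum {ι : Type*} {μ : Measure (Space d)} (s : Finset ι)
    {φ : ι → Space d → ℂ} (hφ : ∀ i ∈ s, Integrable (φ i) μ) (y : Space d) :
    fourierInt μ (fun ξ => ∑ i ∈ s, φ i ξ) y = ∑ i ∈ s, fourierInt μ (φ i) y := by
  simp only [fourierInt, Finset.sum_mul]
  exact integral_finsetSum _ fun i hi => integrable_mul_wave (hφ i hi) y

/-! ### Difference operators act as multiplication by the symbol -/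

section Difference

variable {G : Type*} [AddCommGroup G]

lemma integrable_wave_sub_one_mul {μ : Measure (Space d)} {φ : Space d → ℂ} (hφ : Integrable φ μ)
    (y : Space d) : Integrable (fun ξ => (wave y ξ - 1) * φ ξ) μ := by
  have := (integrable_mul_wave hφ y).sub hφ
  refine this.congr (Filter.Eventually.of_forall fun ξ => ?_)
  simp only [Pi.sub_apply]
  ring

lemma integrable_wave_sub_one_pow_mul {μ : Measure (Space d)} {φ : Space d → ℂ}
    (hφ : Integrable φ μ) (y : Space d) (n : ℕ) :
    Integrable (fun ξ => (wave y ξ - 1) ^ n * φ ξ) μ := by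
  induction n with
  | zero => simpa using hφ
  | succ n ih => simpa only [pow_succ', mul_assoc] using integrable_wave_sub_one_mul ih y

/-- The homomorphism `ι` lets one statement serve both for functions on `ℝ^d`, where the
approximation property is tested, and for functions on the grid. -/
lemma fwdDiff_fourierInt (ι : G →+ Space d) {μ : Measure (Space d)} {φ : Space d → ℂ}
    (hφ : Integrable φ μ) (h : G) :
    fwdDiff h (fun x => fourierInt μ φ (ι x)) =
      fun x => fourierInt μ (fun ξ => (wave (ι h) ξ - 1) * φ ξ) (ι x) := by
  funext x
  rw [fwdDiff]
  simp only [fourierInt]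
  rw [← integral_sub (integrable_mul_wave hφ _) (integrable_mul_wave hφ _)]
  congr 1
  funext ξ
  rw [map_add, wave_add]
  ring

lemma fwdDiff_iterate_fourierInt (ι : G →+ Space d) {μ : Measure (Space d)} {φ : Space d → ℂ}
    (hφ : Integrable φ μ) (h : G) (n : ℕ) :
    (fwdDiff h)^[n] (fun x => fourierInt μ φ (ι x)) =
      fun x => fourierInt μ (fun ξ => (wave (ι h) ξ - 1) ^ n * φ ξ) (ι x) := by
  induction n with
  | zero => simp
  | succ n ih =>
    rw [Function.iterate_succ_apply', ih,
      fwdDiff_fourierInt ι (integrable_wave_sub_one_pow_mul hφ _ n)]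
    simp only [pow_succ', mul_assoc]

/-- The multiplier of `δ_{k-}^{ν_{2k-1}} δ_{k+}^{ν_{2k}}`. -/
def stepFactor (ι : G →+ Space d) (h : Fin d → G) (ν : Fin d ⊕ Fin d →₀ ℕ) (k : Fin d)
    (ξ : Space d) : ℂ :=
  (wave (ι (-h k)) ξ - 1) ^ ν (Sum.inl k) * (wave (ι (h k)) ξ - 1) ^ ν (Sum.inr k)

lemma foldr_fwdDiff_fourierInt (ι : G →+ Space d) {μ : Measure (Space d)} {φ : Space d → ℂ}
    (hφ : Integrable φ μ) (h : Fin d → G) (ν : Fin d ⊕ Fin d →₀ ℕ) (l : List (Fin d)) :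
    Integrable (fun ξ => (l.map fun k => stepFactor ι h ν k ξ).prod * φ ξ) μ ∧
    l.foldr (fun k g => (fwdDiff (-h k))^[ν (Sum.inl k)] ((fwdDiff (h k))^[ν (Sum.inr k)] g))
      (fun x => fourierInt μ φ (ι x)) =
      fun x => fourierInt μ (fun ξ => (l.map fun k => stepFactor ι h ν k ξ).prod * φ ξ) (ι x) := by
  induction l with
  | nil => simpa using hφ
  | cons k l ih =>
    have h1 := integrable_wave_sub_one_pow_mul ih.1 (ι (h k)) (ν (Sum.inr k))
    have h2 := integrable_wave_sub_one_pow_mul h1 (ι (-h k)) (ν (Sum.inl k))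
    constructor
    · simpa only [List.map_cons, List.prod_cons, stepFactor, mul_assoc] using h2
    · rw [List.foldr_cons, ih.2, fwdDiff_iterate_fourierInt ι ih.1,
        fwdDiff_iterate_fourierInt ι h1]
      simp only [List.map_cons, List.prod_cons, stepFactor, mul_assoc]

lemma wave_single (k : Fin d) (c : ℝ) (ξ : Space d) :
    wave (EuclideanSpace.single k c) ξ = Complex.exp (Complex.I * ((c * ξ k : ℝ) : ℂ)) := by
  rw [wave, EuclideanSpace.inner_single_left]
  simp

lemma diffPow_fourierInt (ι : G →+ Space d) {μ : Measure (Space d)} {φ : Space d → ℂ}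
    (hφ : Integrable φ μ) (h : Fin d → G) (hι : ∀ k, ι (h k) = EuclideanSpace.single k 1)
    (ν : Fin d ⊕ Fin d →₀ ℕ) :
    Integrable (fun ξ => (∏ i, (Sum.elim (fun k => Complex.exp (-Complex.I * (ξ k : ℂ)) - 1)
      (fun k => Complex.exp (Complex.I * (ξ k : ℂ)) - 1)) i ^ ν i) * φ ξ) μ ∧
    diffPow h ν (fun x => fourierInt μ φ (ι x)) = fun x => fourierInt μ
      (fun ξ => (∏ i, (Sum.elim (fun k => Complex.exp (-Complex.I * (ξ k : ℂ)) - 1)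
        (fun k => Complex.exp (Complex.I * (ξ k : ℂ)) - 1)) i ^ ν i) * φ ξ) (ι x) := by
  have key : ∀ ξ : Space d, ((List.finRange d).map fun k => stepFactor ι h ν k ξ).prod =
      ∏ i, (Sum.elim (fun k => Complex.exp (-Complex.I * (ξ k : ℂ)) - 1)
        (fun k => Complex.exp (Complex.I * (ξ k : ℂ)) - 1)) i ^ ν i := by
    intro ξ
    rw [← Fin.prod_univ_def, Fintype.prod_sum_type, ← Finset.prod_mul_distrib]
    refine Finset.prod_congr rfl fun k _ => ?_
    have h1 : ι (-h k) = EuclideanSpace.single k (-1) := by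
      rw [map_neg, hι]
      ext j
      by_cases hj : j = k <;> simp [hj]
    rw [stepFactor, h1, hι, wave_single, wave_single]
    simp
  have := foldr_fwdDiff_fourierInt ι hφ h ν (List.finRange d)
  simp only [key] at this
  exact this

lemma symbol_eq_sum (a : MvPolynomial (Fin d ⊕ Fin d) ℂ) (ξ : Space d) :
    symbol a ξ = ∑ ν ∈ a.support, a.coeff ν *
      ∏ i, (Sum.elim (fun k => Complex.exp (-Complex.I * (ξ k : ℂ)) - 1)
        (fun k => Complex.exp (Complex.I * (ξ k : ℂ)) - 1)) i ^ ν i := by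
  rw [symbol, MvPolynomial.eval_eq']

/-- Since `ι` rescales the steps to unit vectors, the multiplier is the symbol itself and `ε`
survives only in the prefactor. -/
lemma diffOp_fourierInt (ι : G →+ Space d) {μ : Measure (Space d)} {φ : Space d → ℂ}
    (hφ : Integrable φ μ) (h : Fin d → G) (hι : ∀ k, ι (h k) = EuclideanSpace.single k 1)
    (a : MvPolynomial (Fin d ⊕ Fin d) ℂ) (ℓ : ℕ) (ε : ℝ) (x : G) :
    diffOp a ℓ ε h (fun x => fourierInt μ φ (ι x)) x =
      ((ε : ℂ) ^ ℓ)⁻¹ * fourierInt μ (fun ξ => symbol a ξ * φ ξ) (ι x) := by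
  rw [diffOp]
  congr 1
  simp only [symbol_eq_sum, Finset.sum_mul, mul_assoc]
  rw [fourierInt_finset_sum]
  · refine Finset.sum_congr rfl fun ν _ => ?_
    rw [(diffPow_fourierInt ι hφ h hι ν).2, fourierInt_const_mul]
  · intro ν _
    exact (diffPow_fourierInt ι hφ h hι ν).1.const_mul _

end Difference

/-! ### Differential operators act as multiplication by the polynomial -/

/-- All moments of `φ` are finite. -/
def AllMoments (μ : Measure (Space d)) (φ : Space d → ℂ) : Prop :=
  AEStronglyMeasurable φ μ ∧ ∀ n : ℕ, Integrable (fun ξ => ‖ξ‖ ^ n * ‖φ ξ‖) μ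

lemma AllMoments.integrable {μ : Measure (Space d)} {φ : Space d → ℂ} (h : AllMoments μ φ) :
    Integrable φ μ := by
  have := h.2 0
  simp only [pow_zero, one_mul] at this
  exact (integrable_norm_iff h.1).1 this

lemma AllMoments.coord_mul {μ : Measure (Space d)} {φ : Space d → ℂ} (h : AllMoments μ φ)
    (j : Fin d) : AllMoments μ (fun ξ => (ξ j : ℂ) * φ ξ) := by
  have hm : AEStronglyMeasurable (fun ξ : Space d => (ξ j : ℂ) * φ ξ) μ := by
    refine AEStronglyMeasurable.mul ?_ h.1
    have : Continuous fun ξ : Space d => (ξ j : ℂ) := by fun_prop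
    exact this.aestronglyMeasurable
  refine ⟨hm, fun n => (h.2 (n + 1)).mono ?_ ?_⟩
  · exact (continuous_norm.pow n).aestronglyMeasurable.mul hm.norm
  · refine Filter.Eventually.of_forall fun ξ => ?_
    have : ‖ξ j‖ ≤ ‖ξ‖ := PiLp.norm_apply_le ξ j
    simp only [norm_mul, norm_pow, norm_norm, Complex.norm_real, pow_succ]
    nlinarith [mul_nonneg (pow_nonneg (norm_nonneg ξ) n) (norm_nonneg (φ ξ)),
      mul_le_mul_of_nonneg_left this (mul_nonneg (pow_nonneg (norm_nonneg ξ) n)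
        (norm_nonneg (φ ξ)))]

/-- Differentiation under the integral sign; the derivative of the integrand is dominated by `|ξ_j
φ(ξ)|` uniformly in the point. -/
lemma partialD_fourierInt {μ : Measure (Space d)} {φ : Space d → ℂ} (h : AllMoments μ φ)
    (j : Fin d) :
    partialD j (fourierInt μ φ) = fourierInt μ (fun ξ => (ξ j : ℂ) * φ ξ) := by
  funext y
  have hd : HasDerivAt (fun t : ℝ => fourierInt μ φ (y + t • EuclideanSpace.single j (1 : ℝ)))
      (∫ ξ, Complex.I * ((ξ j : ℂ) * φ ξ) * wave y ξ ∂μ) 0 := by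
    have hw : ∀ (t : ℝ) (ξ : Space d), φ ξ * wave (y + t • EuclideanSpace.single j (1 : ℝ)) ξ =
        φ ξ * wave y ξ * Complex.exp (Complex.I * ((t : ℂ) * (ξ j : ℂ))) := by
      intro t ξ
      rw [wave_add, wave_smul, wave_single]
      simp [mul_assoc]
    have key := hasDerivAt_integral_of_dominated_loc_of_deriv_le (μ := μ) (𝕜 := ℝ)
      (F := fun t ξ => φ ξ * wave (y + t • EuclideanSpace.single j (1 : ℝ)) ξ) (x₀ := 0)
      (s := Set.univ)
      (F' := fun t ξ => Complex.I * ((ξ j : ℂ) * φ ξ) *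
        wave (y + t • EuclideanSpace.single j (1 : ℝ)) ξ)
      (bound := fun ξ => ‖(ξ j : ℂ) * φ ξ‖) Filter.univ_mem
      (Filter.Eventually.of_forall fun t => (integrable_mul_wave h.integrable _).1)
      (integrable_mul_wave h.integrable _)
      ((integrable_mul_wave ((h.coord_mul j).integrable.const_mul Complex.I) _).1)
      (Filter.Eventually.of_forall fun ξ t _ => by simp [norm_wave])
      (h.coord_mul j).integrable.norm
      (Filter.Eventually.of_forall fun ξ t _ => by
        have h1 : HasDerivAt (fun t : ℝ => Complex.I * ((t : ℂ) * (ξ j : ℂ)))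
            (Complex.I * (1 * (ξ j : ℂ))) t :=
          ((Complex.ofRealCLM.hasDerivAt (x := t)).mul_const _).const_mul _
        have h2 := (h1.cexp).const_mul (φ ξ * wave y ξ)
        simp only [hw]
        refine h2.congr_deriv ?_
        rw [wave_add, wave_smul, wave_single, PiLp.smul_apply, smul_eq_mul]
        push_cast
        ring_nf)
    have h3 := key.2
    simp only [zero_smul, add_zero] at h3
    exact h3
  rw [partialD, lineDeriv, hd.deriv, fourierInt, ← integral_const_mul]
  congr 1
  funext ξ
  linear_combination (-(ξ j : ℂ) * φ ξ * wave y ξ) * Complex.I_mul_I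

lemma AllMoments.coord_pow_mul {μ : Measure (Space d)} {φ : Space d → ℂ} (h : AllMoments μ φ)
    (j : Fin d) (n : ℕ) : AllMoments μ (fun ξ => (ξ j : ℂ) ^ n * φ ξ) := by
  induction n with
  | zero => simpa using h
  | succ n ih => simpa only [pow_succ', mul_assoc] using ih.coord_mul j

lemma partialD_iterate_fourierInt {μ : Measure (Space d)} {φ : Space d → ℂ} (h : AllMoments μ φ)
    (j : Fin d) (n : ℕ) :
    (partialD j)^[n] (fourierInt μ φ) = fourierInt μ (fun ξ => (ξ j : ℂ) ^ n * φ ξ) := by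
  induction n with
  | zero => simp
  | succ n ih =>
    rw [Function.iterate_succ_apply', ih, partialD_fourierInt (h.coord_pow_mul j n)]
    simp only [pow_succ', mul_assoc]

lemma foldr_partialD_fourierInt {μ : Measure (Space d)} {φ : Space d → ℂ} (h : AllMoments μ φ)
    (α : Fin d →₀ ℕ) (l : List (Fin d)) :
    AllMoments μ (fun ξ => (l.map fun j => (ξ j : ℂ) ^ α j).prod * φ ξ) ∧
    l.foldr (fun j g => (partialD j)^[α j] g) (fourierInt μ φ) =
      fourierInt μ (fun ξ => (l.map fun j => (ξ j : ℂ) ^ α j).prod * φ ξ) := by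
  induction l with
  | nil => simpa using h
  | cons k l ih =>
    constructor
    · simpa only [List.map_cons, List.prod_cons, mul_assoc] using ih.1.coord_pow_mul k (α k)
    · rw [List.foldr_cons, ih.2, partialD_iterate_fourierInt ih.1]
      simp only [List.map_cons, List.prod_cons, mul_assoc]

/-- The measure is arbitrary because two cases are needed: a Dirac measure gives the action on a
plane wave, Lebesgue measure gives `H_k`. -/
lemma polyD_fourierInt {μ : Measure (Space d)} {φ : Space d → ℂ} (h : AllMoments μ φ)
    (q : MvPolynomial (Fin d) ℂ) :
    polyD q (fourierInt μ φ) = fourierInt μ (fun ξ => evalAt q ξ * φ ξ) := by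
  funext y
  have hα : ∀ α : Fin d →₀ ℕ, AllMoments μ (fun ξ => (∏ j, (ξ j : ℂ) ^ α j) * φ ξ) ∧
      partialDPow α (fourierInt μ φ) = fourierInt μ (fun ξ => (∏ j, (ξ j : ℂ) ^ α j) * φ ξ) := by
    intro α
    have := foldr_partialD_fourierInt h α (List.finRange d)
    simp only [← Fin.prod_univ_def] at this
    exact this
  simp only [polyD, evalAt, MvPolynomial.eval_eq', Finset.sum_mul, mul_assoc]
  rw [fourierInt_finset_sum]
  · refine Finset.sum_congr rfl fun α _ => ?_
    rw [(hα α).2, fourierInt_const_mul]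
  · exact fun α _ => (hα α).1.integrable.const_mul _

/-- Up to the dilation `y ↦ -y/(2π)` this is the standard Fourier transform, which is smooth when
all moments are finite. -/
lemma AllMoments.contDiff_fourierInt {φ : Space d → ℂ}
    (h : AllMoments volume φ) : ContDiff ℝ (⊤ : ℕ∞) (fourierInt volume φ) := by
  have h1 : ContDiff ℝ (⊤ : ℕ∞) (FourierTransform.fourier φ) :=
    Real.contDiff_fourier (N := ⊤) fun n _ => h.2 n
  have h2 : fourierInt volume φ =
      fun y => (FourierTransform.fourier φ) ((-(2 * Real.pi)⁻¹ : ℝ) • y) := by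
    funext y
    rw [Real.fourier_eq', fourierInt]
    congr 1
    funext ξ
    rw [smul_eq_mul, mul_comm, wave, real_inner_smul_right, real_inner_comm]
    congr 2
    push_cast
    have : (Real.pi : ℂ) ≠ 0 := by exact_mod_cast Real.pi_ne_zero
    field_simp
  rw [h2]
  exact h1.comp (contDiff_const_smul _)

/-! ### Plane waves are test functions -/

/-- The wave is `s ↦ e^{is}`, all of whose derivatives have modulus 1, composed with the linear form
`y ↦ ⟨ξ, y⟩`. -/
lemma smoothBounded_wave (ξ : Space d) : SmoothBounded (fun y => wave y ξ) := by
  have he : (fun y => wave y ξ) =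
      (fun s : ℝ => Complex.exp (Complex.I * s)) ∘ (innerSL ℝ ξ : Space d →L[ℝ] ℝ) := by
    funext y
    simp [wave, real_inner_comm]
  have hs : ContDiff ℝ (⊤ : ℕ∞) (fun s : ℝ => Complex.exp (Complex.I * s)) :=
    (contDiff_const.mul Complex.ofRealCLM.contDiff).cexp
  rw [SmoothBounded, he]
  refine ⟨hs.comp (innerSL ℝ ξ : Space d →L[ℝ] ℝ).contDiff, fun n => ?_⟩
  refine ⟨∏ _i : Fin n, ‖(innerSL ℝ ξ : Space d →L[ℝ] ℝ)‖, fun y => ?_⟩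
  rw [ContinuousLinearMap.iteratedFDeriv_comp_right _ hs y (by exact_mod_cast le_top)]
  refine (ContinuousMultilinearMap.norm_compContinuousLinearMap_le _ _).trans ?_
  rw [norm_iteratedFDeriv_eq_norm_iteratedDeriv]
  have : iteratedDeriv n (fun s : ℝ => Complex.exp (Complex.I * s)) =
      fun s : ℝ => Complex.I ^ n * Complex.exp (Complex.I * s) := by
    clear hs he
    induction n with
    | zero => simp
    | succ n ih =>
      rw [iteratedDeriv_succ, ih]
      funext s
      have h1 : HasDerivAt (fun s : ℝ => Complex.I * (s : ℂ)) (Complex.I * 1) s :=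
        (Complex.ofRealCLM.hasDerivAt (x := s)).const_mul _
      rw [(h1.cexp.const_mul (Complex.I ^ n)).deriv]
      ring
  rw [this]
  simp only [norm_mul, norm_pow, Complex.norm_I, one_pow, one_mul]
  rw [mul_comm Complex.I, Complex.norm_exp_ofReal_mul_I, one_mul]

/-- The approximation property is applied to the plane wave of frequency `ξ` and read off at `y =
0`; the constant depends on `ξ`. -/
lemma IsApproximation.symbol_sub_le {a : MvPolynomial (Fin d ⊕ Fin d) ℂ} {ℓ M : ℕ}
    {p : MvPolynomial (Fin d) ℂ} (h : IsApproximation a ℓ M p) (ξ : Space d) :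
    ∃ C : ℝ, ∀ ε : ℝ, 0 < ε →
      ‖((ε : ℂ) ^ ℓ)⁻¹ * symbol a (ε • ξ) - evalAt p ξ‖ ≤ C * ε ^ M := by
  obtain ⟨C, -, hC⟩ := h _ (smoothBounded_wave ξ)
  refine ⟨C, fun ε hε => ?_⟩
  have h1 : (fun y => wave y ξ) = fourierInt (Measure.dirac ξ) (fun _ => 1) := by
    funext y
    simp [fourierInt_dirac]
  have hm : AllMoments (Measure.dirac ξ) (fun _ : Space d => (1 : ℂ)) := by
    refine ⟨aestronglyMeasurable_const, fun n => ?_⟩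
    exact integrable_dirac (by simp)
  -- The same wave has two representations: frequency `ξ` in the variable `y` for the differential
  -- operator, and frequency `εξ` in the variable `y/ε`, where the steps are unit vectors, for the
  -- difference operator.
  let ι : Space d →+ Space d := DistribSMul.toAddMonoidHom (Space d) (ε⁻¹)
  have hι : ∀ y, ι y = ε⁻¹ • y := fun y => rfl
  have h2 : (fun y => wave y ξ) =
      fun y => fourierInt (Measure.dirac (ε • ξ)) (fun _ => 1) (ι y) := by
    funext y
    rw [fourierInt_dirac, hι, wave_smul, smul_smul, inv_mul_cancel₀ hε.ne', one_smul, one_mul]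
  have h3 := hC ε hε 0
  rw [h1, polyD_fourierInt hm, ← h1, h2, diffOp_fourierInt ι (integrable_const _)] at h3
  · simpa [fourierInt_dirac, wave_zero] using h3
  · intro k
    rw [hι]
    ext j
    by_cases hj : j = k <;> simp [hj, hε.ne']

/-! ### Infinite systems of differential equations with bounded coefficients -/

section System

variable {X : Type*} {w : X → ℝ → ℂ} {L D : ℝ}

/-- On an interval with `L(b-a) ≤ 1/2` any bound `S` improves to `N + (b-a)D + S/2`. Iterating leads
to the fixed point `2(N + (b-a)D)`, so the a priori bound `S₀` must exist but leaves no trace in the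
result. -/
lemma norm_le_of_short_interval {a b c S₀ N : ℝ} (hab : a ≤ b) (hL : 0 ≤ L)
    (hD : 0 ≤ D) (hLab : L * (b - a) ≤ 1 / 2)
    (hcont : ∀ x, ContinuousOn (w x) (Set.Icc a b))
    (hdiff : ∀ x, ∀ t ∈ Set.Ioo a b, DifferentiableAt ℝ (w x) t)
    (hderiv : ∀ t ∈ Set.Ioo a b, ∀ S, (∀ x, ‖w x t‖ ≤ S) → ∀ x, ‖deriv (w x) t‖ ≤ L * S + D)
    (hS₀ : ∀ x, ∀ t ∈ Set.Icc a b, ‖w x t‖ ≤ S₀) (hc : c ∈ Set.Icc a b)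
    (hN : ∀ x, ‖w x c‖ ≤ N) : ∀ x, ∀ t ∈ Set.Icc a b, ‖w x t‖ ≤ 2 * (N + (b - a) * D) := by
  rcases hab.eq_or_lt with rfl | hlt
  · intro x t ht
    have : t = c := le_antisymm (ht.2.trans hc.1) (hc.2.trans ht.1)
    subst this
    have h0 := (norm_nonneg _).trans (hN x)
    linarith [hN x]
  have step : ∀ S, (∀ x, ∀ t ∈ Set.Icc a b, ‖w x t‖ ≤ S) →
      ∀ x, ∀ t ∈ Set.Icc a b, ‖w x t‖ ≤ N + (b - a) * D + S / 2 := by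
    intro S hS x t ht
    have hS0 : 0 ≤ S := (norm_nonneg _).trans (hS x t ht)
    -- Derivatives are controlled only in the open interval; continuity extends the Lipschitz bound
    -- to the endpoints.
    have hlip : LipschitzOnWith (L * S + D).toNNReal (w x) (Set.Icc a b) := by
      rw [← closure_Ioo hlt.ne]
      refine LipschitzOnWith.closure (by rw [closure_Ioo hlt.ne]; exact hcont x) ?_
      refine Convex.lipschitzOnWith_of_nnnorm_deriv_le (hdiff x) ?_ (convex_Ioo a b)
      intro s hs
      rw [← NNReal.coe_le_coe, coe_nnnorm, Real.coe_toNNReal _ (by positivity)]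
      exact hderiv s hs S (fun y => hS y s (Set.Ioo_subset_Icc_self hs)) x
    have h1 := hlip.dist_le_mul t ht c hc
    rw [Real.coe_toNNReal _ (by positivity), dist_eq_norm, Real.dist_eq] at h1
    have h2 : |t - c| ≤ b - a := by
      rw [abs_le]
      constructor <;> linarith [ht.1, ht.2, hc.1, hc.2]
    have h3 : ‖w x t‖ ≤ ‖w x c‖ + ‖w x t - w x c‖ := by
      simpa using norm_add_le (w x c) (w x t - w x c)
    have h4 : (L * S + D) * |t - c| ≤ (L * S + D) * (b - a) :=
      mul_le_mul_of_nonneg_left h2 (by positivity)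
    nlinarith [hN x, mul_le_mul_of_nonneg_right hLab hS0]
  have iter : ∀ n : ℕ, ∀ x, ∀ t ∈ Set.Icc a b,
      ‖w x t‖ ≤ 2 * (N + (b - a) * D) + (1 / 2) ^ n * (S₀ - 2 * (N + (b - a) * D)) := by
    intro n
    induction n with
    | zero => simpa using hS₀
    | succ n ih =>
      intro x t ht
      refine (step _ ih x t ht).trans (le_of_eq ?_)
      ring
  intro x t ht
  have hlim : Filter.Tendsto (fun n : ℕ => 2 * (N + (b - a) * D) +
      (1 / 2 : ℝ) ^ n * (S₀ - 2 * (N + (b - a) * D))) Filter.atTop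
      (nhds (2 * (N + (b - a) * D) + 0 * (S₀ - 2 * (N + (b - a) * D)))) :=
    ((tendsto_pow_atTop_nhds_zero_of_lt_one (by norm_num) (by norm_num)).mul_const _).const_add _
  rw [zero_mul, add_zero] at hlim
  exact ge_of_tendsto' hlim fun n => iter n x t ht

/-- The family `w` is bounded near the time `t`, uniformly over the index. -/
def BoundedNear (w : X → ℝ → ℂ) (t : ℝ) : Prop :=
  ∃ δ : ℝ, 0 < δ ∧ ∃ S : ℝ, ∀ s, 0 ≤ s → |s - t| < δ → ∀ x, ‖w x s‖ ≤ S

lemma exists_bound_of_boundedNear {a b : ℝ} (ha : 0 ≤ a)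
    (h : ∀ t ∈ Set.Icc a b, BoundedNear w t) :
    ∃ S, ∀ x, ∀ t ∈ Set.Icc a b, ‖w x t‖ ≤ S := by
  have key : ∃ S, ∀ t ∈ Set.Icc a b, 0 ≤ t → ∀ x, ‖w x t‖ ≤ S := by
    refine (isCompact_Icc (a := a) (b := b)).induction_on
      (p := fun s => ∃ S, ∀ t ∈ s, 0 ≤ t → ∀ x, ‖w x t‖ ≤ S) ?_ ?_ ?_ ?_
    · exact ⟨0, by simp⟩
    · rintro s s' hss ⟨S, hS⟩
      exact ⟨S, fun t ht => hS t (hss ht)⟩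
    · rintro s s' ⟨S, hS⟩ ⟨S', hS'⟩
      refine ⟨max S S', ?_⟩
      rintro t (ht | ht) h0 x
      · exact (hS t ht h0 x).trans (le_max_left _ _)
      · exact (hS' t ht h0 x).trans (le_max_right _ _)
    · intro t ht
      obtain ⟨δ, hδ, S, hS⟩ := h t ht
      refine ⟨Metric.ball t δ, mem_nhdsWithin_of_mem_nhds (Metric.ball_mem_nhds t hδ), S, ?_⟩
      intro s hs h0
      exact hS s h0 (by simpa [Real.dist_eq] using hs)
  obtain ⟨S, hS⟩ := key
  exact ⟨S, fun x t ht => hS t ht (ha.trans ht.1) x⟩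

/-- If the family is bounded near every point of the segment from `o` to `c` other than `c`,
then the values at `o` are controlled by those at `c`. -/
lemma norm_le_of_gap {o c N : ℝ} (hL : 0 ≤ L) (hD : 0 ≤ D) (ho : 0 ≤ o) (hc : 0 ≤ c)
    (hLoc : L * |c - o| ≤ 1 / 2)
    (hcont : ∀ x, ContinuousOn (w x) (Set.Ici 0))
    (hdiff : ∀ x, ∀ t, 0 < t → DifferentiableAt ℝ (w x) t)
    (hderiv : ∀ t, 0 < t → ∀ S, (∀ x, ‖w x t‖ ≤ S) → ∀ x, ‖deriv (w x) t‖ ≤ L * S + D)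
    (hbdd : ∀ t, 0 ≤ t → ∃ S, ∀ x, ‖w x t‖ ≤ S)
    (hnear : ∀ t ∈ Set.uIcc o c, t ≠ c → BoundedNear w t) (hN : ∀ x, ‖w x c‖ ≤ N) :
    ∀ x, ‖w x o‖ ≤ 2 * (N + |c - o| * D) := by
  have short : ∀ (r q S₀ N : ℝ), 0 ≤ q → L * |q - o| ≤ 1 / 2 → r ∈ Set.uIcc o q →
      (∀ x, ∀ t ∈ Set.uIcc o q, ‖w x t‖ ≤ S₀) → (∀ x, ‖w x r‖ ≤ N) →
      ∀ x, ∀ t ∈ Set.uIcc o q, ‖w x t‖ ≤ 2 * (N + |q - o| * D) := by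
    intro r q S₀ N hq hLq hr hS₀ hN
    have hle : o ⊓ q ≤ o ⊔ q := inf_le_sup
    have hnn : 0 ≤ o ⊓ q := le_inf ho hq
    have habs : o ⊔ q - o ⊓ q = |q - o| := max_sub_min_eq_abs o q
    have := norm_le_of_short_interval (w := w) (L := L) (D := D) (c := r) (N := N) hle hL hD
      (by rw [habs]; exact hLq)
      (fun x => (hcont x).mono fun t ht => hnn.trans ht.1)
      (fun x t ht => hdiff x t (hnn.trans_lt ht.1)) (fun t ht => hderiv t (hnn.trans_lt ht.1))
      hS₀ hr hN
    rwa [habs] at this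
  -- The estimate is used twice. Started at `o`, with the unspecified bound `No`, it bounds the
  -- family on the whole segment up to `c`. That a priori bound then permits starting at `c`, with
  -- the explicit bound `N`.
  obtain ⟨No, hNo⟩ := hbdd o ho
  have hbound : ∀ x, ∀ t ∈ Set.uIcc o c, ‖w x t‖ ≤ max (2 * (No + |c - o| * D)) N := by
    intro x t ht
    by_cases htc : t = c
    · subst htc
      exact (hN x).trans (le_max_right _ _)
    refine le_trans ?_ (le_max_left _ _)
    have ht0 : 0 ≤ t := (le_inf ho hc).trans ht.1
    have hsub : Set.uIcc o t ⊆ Set.uIcc o c := Set.uIcc_subset_uIcc_left ht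
    have hnot : ∀ s ∈ Set.uIcc o t, s ≠ c := by
      rintro s hs rfl
      rcases le_total o s with h | h
      · rw [Set.uIcc_of_le h] at ht
        rw [Set.uIcc_of_le ht.1] at hs
        exact htc (le_antisymm ht.2 hs.2)
      · rw [Set.uIcc_of_ge h] at ht
        rw [Set.uIcc_of_ge ht.2] at hs
        exact htc (le_antisymm hs.1 ht.1)
    obtain ⟨S, hS⟩ := exists_bound_of_boundedNear (w := w) (le_inf ho ht0)
      (fun s hs => hnear s (hsub hs) (hnot s hs))
    have habs : |t - o| ≤ |c - o| := Set.abs_sub_left_of_mem_uIcc ht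
    refine (short o t S No ht0 ((mul_le_mul_of_nonneg_left habs hL).trans hLoc)
      Set.left_mem_uIcc hS hNo x t Set.right_mem_uIcc).trans ?_
    have := mul_le_mul_of_nonneg_right habs hD
    linarith
  exact fun x => short c c _ N hc hLoc Set.right_mem_uIcc hbound hN x o Set.left_mem_uIcc

/-- A solution that is bounded at every time is bounded locally uniformly in time. -/
lemma boundedNear_of_bounded (hL : 0 ≤ L) (hD : 0 ≤ D)
    (hcont : ∀ x, ContinuousOn (w x) (Set.Ici 0))
    (hdiff : ∀ x, ∀ t, 0 < t → DifferentiableAt ℝ (w x) t)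
    (hderiv : ∀ t, 0 < t → ∀ S, (∀ x, ‖w x t‖ ≤ S) → ∀ x, ‖deriv (w x) t‖ ≤ L * S + D)
    (hbdd : ∀ t, 0 ≤ t → ∃ S, ∀ x, ‖w x t‖ ≤ S) (t : ℝ) (ht : 0 ≤ t) : BoundedNear w t := by
  by_contra hcon
  set F : Set ℝ := {s | 0 ≤ s ∧ ¬ BoundedNear w s} with hF
  have hFclosed : IsClosed F := by
    have : F = Set.Ici 0 ∩ {s | BoundedNear w s}ᶜ := rfl
    rw [this]
    refine isClosed_Ici.inter (IsOpen.isClosed_compl ?_)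
    rw [Metric.isOpen_iff]
    rintro s ⟨δ, hδ, S, hS⟩
    refine ⟨δ / 2, half_pos hδ, fun r hr => ⟨δ / 2, half_pos hδ, S, fun q hq hqr => ?_⟩⟩
    refine hS q hq ?_
    have h1 : |r - s| < δ / 2 := by simpa [Real.dist_eq] using hr
    calc |q - s| = |(q - r) + (r - s)| := by ring_nf
      _ ≤ |q - r| + |r - s| := abs_add_le _ _
      _ < δ := by linarith
  have : Nonempty F := ⟨⟨t, ht, hcon⟩⟩
  have : CompleteSpace F := hFclosed.completeSpace_coe
  -- Baire category on the closed set `F` of bad times: `F` is the union over `n` of the closed sets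
  -- of times where the family is bounded by `n`, so one `n` works on all of `F` near some `t₀ ∈ F`.
  -- The aim is to show that `t₀` is not bad after all.
  obtain ⟨n, t₀, ht₀⟩ := nonempty_interior_of_iUnion_of_closed
    (f := fun n : ℕ => {s : F | ∀ x, ‖w x s‖ ≤ n})
    (fun n => by
      simp only [Set.ofPred_forall]
      refine isClosed_iInter fun x => isClosed_le ?_ continuous_const
      have : Continuous fun s : F => w x s :=
        (hcont x).comp_continuous continuous_subtype_val fun s => s.2.1
      exact this.norm)
    (by
      ext s
      simp only [Set.mem_iUnion, Set.mem_univ, iff_true]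
      obtain ⟨S, hS⟩ := hbdd s s.2.1
      obtain ⟨n, hn⟩ := exists_nat_ge S
      exact ⟨n, fun x => (hS x).trans hn⟩)
  rw [mem_interior_iff_mem_nhds, Metric.mem_nhds_iff] at ht₀
  obtain ⟨η₀, hη₀, hball⟩ := ht₀
  have hFn : ∀ s ∈ F, |s - t₀| < η₀ → ∀ x, ‖w x s‖ ≤ n := by
    intro s hs hst
    exact hball (show (⟨s, hs⟩ : F) ∈ Metric.ball t₀ η₀ by
      rw [Metric.mem_ball, Subtype.dist_eq, Real.dist_eq]; exact hst)
  set η := min η₀ (1 / (2 * (L + 1))) with hη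
  have hηpos : 0 < η := lt_min hη₀ (by positivity)
  have hηL : L * η ≤ 1 / 2 := by
    calc L * η ≤ (L + 1) * (1 / (2 * (L + 1))) :=
          mul_le_mul (by linarith) (min_le_right _ _) hηpos.le (by linarith)
      _ = 1 / 2 := by field_simp
  refine t₀.2.2 ⟨η, hηpos, 2 * (n + η * D), fun s hs0 hst x => ?_⟩
  have hn0 : (0 : ℝ) ≤ n := Nat.cast_nonneg n
  have hηD : 0 ≤ η * D := by positivity
  -- Let `c` be the bad time nearest to `s` between `s` and `t₀`. The family is bounded by `n` at
  -- `c`, and no bad time lies strictly between `s` and `c`, so the bound crosses this gap.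
  have hK : IsCompact (F ∩ Set.uIcc s t₀) := (isCompact_uIcc).inter_left hFclosed
  obtain ⟨c, hcK, hcmin⟩ := hK.exists_isMinOn ⟨t₀, t₀.2, Set.right_mem_uIcc⟩
    (f := fun r => |r - s|) (by fun_prop)
  have hcs : |c - s| ≤ |(t₀ : ℝ) - s| := Set.abs_sub_left_of_mem_uIcc hcK.2
  have hct : |c - t₀| ≤ |s - (t₀ : ℝ)| := by
    rw [abs_sub_comm c, abs_sub_comm s]
    exact Set.abs_sub_right_of_mem_uIcc hcK.2
  rw [abs_sub_comm (t₀ : ℝ) s] at hcs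
  have hN : ∀ y, ‖w y c‖ ≤ n := hFn c hcK.1 ((hct.trans_lt hst).trans_le (min_le_left _ _))
  have hcη : |c - s| ≤ η := hcs.trans hst.le
  refine (norm_le_of_gap hL hD hs0 hcK.1.1 ((mul_le_mul_of_nonneg_left hcη hL).trans hηL)
    hcont hdiff hderiv hbdd ?_ hN x).trans ?_
  · intro r hr hrc
    by_contra hcon'
    have hrF : r ∈ F := ⟨(le_inf hs0 hcK.1.1).trans hr.1, hcon'⟩
    have hr2 : r ∈ Set.uIcc s (t₀ : ℝ) := Set.uIcc_subset_uIcc_left hcK.2 hr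
    have h1 : |c - s| ≤ |r - s| := hcmin ⟨hrF, hr2⟩
    rcases le_total s c with h | h
    · rw [Set.uIcc_of_le h] at hr
      rw [abs_of_nonneg (by linarith), abs_of_nonneg (by linarith [hr.1])] at h1
      exact hrc (le_antisymm hr.2 (by linarith))
    · rw [Set.uIcc_of_ge h] at hr
      rw [abs_of_nonpos (by linarith), abs_of_nonpos (by linarith [hr.2])] at h1
      exact hrc (le_antisymm (by linarith) hr.1)
  · have := mul_le_mul_of_nonneg_right hcη hD
    linarith

/-- A substitute for Gronwall's inequality that assumes finiteness at each time only. Each step of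
length `h` costs at most a factor 4, because `2(4^n(N + hD) + hD) ≤ 4^{n+1}(N + hD)`. -/
lemma norm_le_of_bounded {h N : ℝ} (hL : 0 ≤ L) (hD : 0 ≤ D) (hh : 0 ≤ h)
    (hLh : L * h ≤ 1 / 2)
    (hcont : ∀ x, ContinuousOn (w x) (Set.Ici 0))
    (hdiff : ∀ x, ∀ t, 0 < t → DifferentiableAt ℝ (w x) t)
    (hderiv : ∀ t, 0 < t → ∀ S, (∀ x, ‖w x t‖ ≤ S) → ∀ x, ‖deriv (w x) t‖ ≤ L * S + D)
    (hbdd : ∀ t, 0 ≤ t → ∃ S, ∀ x, ‖w x t‖ ≤ S) (hN0 : 0 ≤ N) (hN : ∀ x, ‖w x 0‖ ≤ N) (n : ℕ) :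
    ∀ x, ∀ t ∈ Set.Icc 0 (n * h), ‖w x t‖ ≤ 4 ^ n * (N + h * D) := by
  have hhD : 0 ≤ h * D := by positivity
  induction n with
  | zero =>
    intro x t ht
    have : t = 0 := le_antisymm (by simpa using ht.2) ht.1
    subst this
    simpa using (hN x).trans (by linarith)
  | succ n ih =>
    intro x t ht
    have h4 : (1 : ℝ) ≤ 4 ^ n := one_le_pow₀ (by norm_num)
    by_cases htn : t ≤ n * h
    · refine (ih x t ⟨ht.1, htn⟩).trans ?_
      rw [pow_succ]
      nlinarith
    have hnh : 0 ≤ (n : ℝ) * h := by positivity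
    push_cast at ht
    obtain ⟨S, hS⟩ := exists_bound_of_boundedNear (w := w) (a := n * h) (b := (n + 1) * h) hnh
      (fun s hs => boundedNear_of_bounded hL hD hcont hdiff hderiv hbdd s (hnh.trans hs.1))
    have hsub : ((n : ℝ) + 1) * h - n * h = h := by ring
    have := norm_le_of_short_interval (w := w) (L := L) (D := D) (c := n * h)
      (a := n * h) (b := (n + 1) * h) (by linarith) hL hD (by rwa [hsub])
      (fun x => (hcont x).mono fun t ht => hnh.trans ht.1)
      (fun x t ht => hdiff x t (hnh.trans_lt ht.1)) (fun t ht => hderiv t (hnh.trans_lt ht.1))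
      hS (Set.left_mem_Icc.2 (by linarith)) (fun x => ih x (n * h) ⟨hnh, le_rfl⟩) x t
      ⟨(not_le.1 htn).le, ht.2⟩
    refine this.trans ?_
    rw [hsub, pow_succ]
    nlinarith

end System

/-! ### Difference operators are bounded on weighted spaces -/

section Weighted

variable {G : Type*} [AddCommGroup G]

lemma weighted_fwdDiff_le {ω : G → ℝ} (hω : ∀ x, 0 ≤ ω x) {κ S : ℝ} {h : G} {u : G → ℂ}
    (hκ : ∀ x, ω x ≤ κ * ω (x + h)) (hκ0 : 0 ≤ κ) (hu : ∀ x, ω x * ‖u x‖ ≤ S) (x : G) :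
    ω x * ‖fwdDiff h u x‖ ≤ (κ + 1) * S := by
  have h1 : ‖fwdDiff h u x‖ ≤ ‖u (x + h)‖ + ‖u x‖ := norm_sub_le _ _
  have h2 : ω x * ‖u (x + h)‖ ≤ κ * S := by
    calc ω x * ‖u (x + h)‖ ≤ κ * ω (x + h) * ‖u (x + h)‖ :=
          mul_le_mul_of_nonneg_right (hκ x) (norm_nonneg _)
      _ = κ * (ω (x + h) * ‖u (x + h)‖) := by ring
      _ ≤ κ * S := mul_le_mul_of_nonneg_left (hu _) hκ0
  nlinarith [mul_le_mul_of_nonneg_left h1 (hω x), hu x]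

lemma weighted_fwdDiff_iterate_le {ω : G → ℝ} (hω : ∀ x, 0 ≤ ω x) {κ S : ℝ} {h : G} {u : G → ℂ}
    (hκ : ∀ x, ω x ≤ κ * ω (x + h)) (hκ0 : 0 ≤ κ) (hu : ∀ x, ω x * ‖u x‖ ≤ S) (n : ℕ) (x : G) :
    ω x * ‖(fwdDiff h)^[n] u x‖ ≤ (κ + 1) ^ n * S := by
  induction n generalizing x with
  | zero => simpa using hu x
  | succ n ih =>
    rw [Function.iterate_succ_apply', pow_succ', mul_assoc]
    exact weighted_fwdDiff_le hω hκ hκ0 ih x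

lemma weighted_diffPow_le {κ : ℝ} (hκ0 : 0 ≤ κ) (h : Fin d → G) (ν : Fin d ⊕ Fin d →₀ ℕ) :
    ∃ B : ℝ, 0 ≤ B ∧ ∀ (ω : G → ℝ), (∀ x, 0 ≤ ω x) → (∀ k x, ω x ≤ κ * ω (x + h k)) →
      (∀ k x, ω x ≤ κ * ω (x + -h k)) → ∀ (u : G → ℂ) (S : ℝ), (∀ x, ω x * ‖u x‖ ≤ S) →
      ∀ x, ω x * ‖diffPow h ν u x‖ ≤ B * S := by
  simp only [diffPow]
  induction List.finRange d with
  | nil => exact ⟨1, zero_le_one, fun ω _ _ _ u S hu x => by simpa using hu x⟩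
  | cons k l ih =>
    obtain ⟨B, hB0, hB⟩ := ih
    refine ⟨(κ + 1) ^ ν (Sum.inl k) * ((κ + 1) ^ ν (Sum.inr k) * B), by positivity, ?_⟩
    intro ω hω hp hm u S hu x
    rw [List.foldr_cons, mul_assoc, mul_assoc]
    exact weighted_fwdDiff_iterate_le hω (hm k) hκ0
      (weighted_fwdDiff_iterate_le hω (hp k) hκ0 (hB ω hω hp hm u S hu) _) _ x

/-- The constant `B` is chosen before the weight and depends on it only through `κ`. This allows a
whole family of truncated weights to be treated with one constant. -/
lemma weighted_diffOp_le {κ : ℝ} (hκ0 : 0 ≤ κ) (h : Fin d → G)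
    (a : MvPolynomial (Fin d ⊕ Fin d) ℂ) (ℓ : ℕ) (ε : ℝ) :
    ∃ B : ℝ, 0 ≤ B ∧ ∀ (ω : G → ℝ), (∀ x, 0 ≤ ω x) → (∀ k x, ω x ≤ κ * ω (x + h k)) →
      (∀ k x, ω x ≤ κ * ω (x + -h k)) → ∀ (u : G → ℂ) (S : ℝ), (∀ x, ω x * ‖u x‖ ≤ S) →
      ∀ x, ω x * ‖diffOp a ℓ ε h u x‖ ≤ B * S := by
  choose B hB0 hB using fun ν => weighted_diffPow_le hκ0 h ν
  refine ⟨‖((ε : ℂ) ^ ℓ)⁻¹‖ * ∑ ν ∈ a.support, ‖a.coeff ν‖ * B ν,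
    mul_nonneg (norm_nonneg _) (Finset.sum_nonneg fun ν _ =>
      mul_nonneg (norm_nonneg _) (hB0 ν)), ?_⟩
  intro ω hω hp hm u S hu x
  rw [diffOp, norm_mul, mul_left_comm, mul_assoc]
  refine mul_le_mul_of_nonneg_left ?_ (norm_nonneg _)
  rw [Finset.sum_mul]
  refine (mul_le_mul_of_nonneg_left (norm_sum_le _ _) (hω x)).trans ?_
  rw [Finset.mul_sum]
  refine Finset.sum_le_sum fun ν _ => ?_
  rw [norm_mul, mul_left_comm, mul_assoc]
  exact mul_le_mul_of_nonneg_left (hB ν ω hω hp hm u S hu x) (norm_nonneg _)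

lemma fwdDiff_iterate_sub (h : G) (u v : G → ℂ) (n : ℕ) :
    (fwdDiff h)^[n] (fun x => u x - v x) =
      fun x => (fwdDiff h)^[n] u x - (fwdDiff h)^[n] v x := by
  induction n with
  | zero => rfl
  | succ n ih =>
    rw [Function.iterate_succ_apply', ih]
    funext x
    simp only [Function.iterate_succ_apply', fwdDiff]
    ring

lemma diffPow_sub (h : Fin d → G) (ν : Fin d ⊕ Fin d →₀ ℕ) (u v : G → ℂ) :
    diffPow h ν (fun x => u x - v x) = fun x => diffPow h ν u x - diffPow h ν v x := by
  simp only [diffPow]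
  induction List.finRange d with
  | nil => rfl
  | cons k l ih => simp only [List.foldr_cons, ih, fwdDiff_iterate_sub]

lemma diffOp_sub (h : Fin d → G) (a : MvPolynomial (Fin d ⊕ Fin d) ℂ) (ℓ : ℕ) (ε : ℝ)
    (u v : G → ℂ) (x : G) :
    diffOp a ℓ ε h (fun x => u x - v x) x = diffOp a ℓ ε h u x - diffOp a ℓ ε h v x := by
  simp only [diffOp, diffPow_sub, mul_sub, Finset.sum_sub_distrib]

end Weighted

/-! ### Uniqueness and decay of the second discrete Green function -/

section Green

variable {a : MvPolynomial (Fin d ⊕ Fin d) ℂ} {ℓ : ℕ} {ε : ℝ}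

lemma exists_step_size {L : ℝ} (hL : 0 ≤ L) : ∃ h : ℝ, 0 < h ∧ L * h ≤ 1 / 2 := by
  refine ⟨1 / (2 * (L + 1)), by positivity, ?_⟩
  calc L * (1 / (2 * (L + 1))) ≤ (L + 1) * (1 / (2 * (L + 1))) :=
        mul_le_mul_of_nonneg_right (by linarith) (by positivity)
    _ = 1 / 2 := by field_simp

lemma differentiableAt_of_contDiffOn {f : ℝ → ℂ} (hf : ContDiffOn ℝ 1 f (Set.Ici 0)) {t : ℝ}
    (ht : 0 < t) : DifferentiableAt ℝ f t :=
  (hf.differentiableOn one_ne_zero).differentiableAt (Ici_mem_nhds ht)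

lemma RapidlyDecreasing.bounded {u : grid d ε → ℂ} (hu : RapidlyDecreasing u) :
    ∃ C, ∀ x, ‖u x‖ ≤ C := by
  obtain ⟨C, hC⟩ := hu 0
  exact ⟨C, fun x => by simpa using hC x⟩

/-- The difference of two solutions solves the homogeneous system with zero initial values, so the
growth estimate with `N = D = 0` makes it vanish. -/
lemma IsSecondGreen.unique {v v' : grid d ε → ℝ → ℂ} (hv : IsSecondGreen a ℓ ε v)
    (hv' : IsSecondGreen a ℓ ε v') (x : grid d ε) {t : ℝ} (ht : 0 ≤ t) : v x t = v' x t := by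
  obtain ⟨L, hL0, hL⟩ := weighted_diffOp_le zero_le_one (gridStep d ε) a ℓ ε
  obtain ⟨h, hh, hLh⟩ := exists_step_size hL0
  have hd : ∀ y, ∀ t, 0 < t → DifferentiableAt ℝ (v y) t := fun y t ht =>
    differentiableAt_of_contDiffOn (hv.contDiff y) ht
  have hd' : ∀ y, ∀ t, 0 < t → DifferentiableAt ℝ (v' y) t := fun y t ht =>
    differentiableAt_of_contDiffOn (hv'.contDiff y) ht
  have key := norm_le_of_bounded (w := fun y s => v y s - v' y s) (L := L) (D := 0) (N := 0)
    hL0 le_rfl hh.le hLh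
    (fun y => (hv.contDiff y).continuousOn.sub (hv'.contDiff y).continuousOn)
    (fun y t ht => (hd y t ht).sub (hd' y t ht))
    (fun s hs S hS y => by
      have h1 : deriv (fun s => v y s - v' y s) s = -diffOp a ℓ ε (gridStep d ε)
          (fun z => v z s - v' z s) y := by
        rw [deriv_fun_sub (hd y s hs) (hd' y s hs), diffOp_sub]
        linear_combination hv.eqn y s hs - hv'.eqn y s hs
      rw [h1, norm_neg, add_zero]
      simpa using hL (fun _ => 1) (by simp) (by simp) (by simp) _ S (by simpa using hS) y)
    (fun s hs => by
      obtain ⟨C, hC⟩ := (hv.rapid s hs).bounded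
      obtain ⟨C', hC'⟩ := (hv'.rapid s hs).bounded
      exact ⟨C + C', fun y => (norm_sub_le _ _).trans (add_le_add (hC y) (hC' y))⟩)
    le_rfl (fun y => by simp [hv.init, hv'.init])
  obtain ⟨n, hn⟩ := exists_nat_ge (t / h)
  have := key n x t ⟨ht, (div_le_iff₀ hh).1 hn⟩
  simpa [sub_eq_zero] using this

lemma norm_gridStep (hε : 0 < ε) (k : Fin d) : ‖((gridStep d ε k : grid d ε) : Space d)‖ = ε := by
  simp [gridStep, abs_of_pos hε]

/-- The solution is multiplied by the weight `min(e^{|x|}, R)`. The truncation keeps the weighted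
solution bounded at each time, and one lattice step changes the weight by at most the factor `e^ε`,
whatever `R` is. The resulting bound is independent of `R`. -/
lemma rapidlyDecreasing_of_bounded (hε : 0 < ε) {v : grid d ε → ℝ → ℂ}
    (hC1 : ∀ x, ContDiffOn ℝ 1 (v x) (Set.Ici 0))
    (heqn : ∀ x, ∀ t : ℝ, 0 < t →
      deriv (v x) t + diffOp a ℓ ε (gridStep d ε) (fun z => v z t) x = gridDelta d ε x)
    (hinit : ∀ x, v x 0 = 0) (hbdd : ∀ t, 0 ≤ t → ∃ S, ∀ x, ‖v x t‖ ≤ S) {t : ℝ} (ht : 0 ≤ t) :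
    RapidlyDecreasing (fun x => v x t) := by
  obtain ⟨L, hL0, hL⟩ := weighted_diffOp_le (Real.exp_pos ε).le (gridStep d ε) a ℓ ε
  obtain ⟨h, hh, hLh⟩ := exists_step_size hL0
  obtain ⟨m, hm⟩ := exists_nat_ge (t / h)
  set D : ℝ := ‖((ε : ℂ) ^ d)⁻¹‖ with hD
  have hd : ∀ y, ∀ t, 0 < t → DifferentiableAt ℝ (v y) t := fun y t ht =>
    differentiableAt_of_contDiffOn (hC1 y) ht
  have key : ∀ R : ℝ, 0 ≤ R → ∀ x : grid d ε,
      min (Real.exp ‖(x : Space d)‖) R * ‖v x t‖ ≤ 4 ^ m * (0 + h * D) := by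
    intro R hR x
    set ω : grid d ε → ℝ := fun x => min (Real.exp ‖(x : Space d)‖) R with hω
    have hω0 : ∀ x, 0 ≤ ω x := fun x => le_min (Real.exp_pos _).le hR
    have hωshift : ∀ x z : grid d ε, ‖(z : Space d)‖ ≤ ε → ω x ≤ Real.exp ε * ω (x + z) := by
      intro x z hz
      simp only [hω]
      rw [mul_min_of_nonneg _ _ (Real.exp_pos ε).le]
      refine min_le_min ?_ ?_
      · rw [← Real.exp_add, Real.exp_le_exp]
        have : ‖(x : Space d)‖ ≤ ‖(x : Space d) + z‖ + ‖(z : Space d)‖ := by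
          simpa using norm_sub_le ((x : Space d) + z) z
        push_cast
        linarith
      · exact le_mul_of_one_le_left hR (Real.one_le_exp hε.le)
    have hδ : ∀ x, ω x * ‖gridDelta d ε x‖ ≤ D := by
      intro x
      by_cases hx : x = 0
      · subst hx
        rw [gridDelta, if_pos rfl]
        refine mul_le_of_le_one_left (norm_nonneg _) ?_
        simp [hω]
      · simp [gridDelta, hx, hD]
    have hnorm : ∀ x s, ‖(ω x : ℂ) * v x s‖ = ω x * ‖v x s‖ := by
      intro x s
      rw [norm_mul, Complex.norm_real, Real.norm_of_nonneg (hω0 x)]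
    have := norm_le_of_bounded (w := fun y s => (ω y : ℂ) * v y s) (L := L) (D := D) (N := 0)
      hL0 (norm_nonneg _) hh.le hLh
      (fun y => continuousOn_const.mul (hC1 y).continuousOn)
      (fun y s hs => (hd y s hs).const_mul _)
      (fun s hs S hS y => by
        have h1 : deriv (fun s => (ω y : ℂ) * v y s) s = (ω y : ℂ) * (gridDelta d ε y -
            diffOp a ℓ ε (gridStep d ε) (fun z => v z s) y) := by
          rw [deriv_const_mul _ (hd y s hs)]
          congr 1
          linear_combination heqn y s hs
        rw [h1, norm_mul, Complex.norm_real, Real.norm_of_nonneg (hω0 y)]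
        have h2 := hL ω hω0
          (fun k x => hωshift x _ (norm_gridStep hε k).le)
          (fun k x => hωshift x _ (by
            have h3 := norm_gridStep hε k
            push_cast
            rw [norm_neg]
            exact h3.le))
          (fun z => v z s) S (fun z => (hnorm z s).symm.le.trans (hS z)) y
        calc _ ≤ ω y * (‖gridDelta d ε y‖ +
              ‖diffOp a ℓ ε (gridStep d ε) (fun z => v z s) y‖) :=
              mul_le_mul_of_nonneg_left (norm_sub_le _ _) (hω0 y)
          _ ≤ L * S + D := by linarith [hδ y])
      (fun s hs => by
        obtain ⟨S, hS⟩ := hbdd s hs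
        refine ⟨R * S, fun y => ?_⟩
        rw [hnorm]
        exact mul_le_mul (min_le_right _ _) (hS y) (norm_nonneg _) hR)
      le_rfl (fun y => by simp [hinit]) m x t ⟨ht, (div_le_iff₀ hh).1 hm⟩
    rwa [hnorm] at this
  intro n
  refine ⟨n.factorial * (4 ^ m * (0 + h * D)), fun x => ?_⟩
  -- `R` may depend on `x`; with `R = e^{|x|}` the truncation is inactive at `x`, and exponential
  -- decay follows.
  have h1 := key (Real.exp ‖(x : Space d)‖) (Real.exp_pos _).le x
  rw [min_self] at h1
  have h2 : ‖(x : Space d)‖ ^ n ≤ n.factorial * Real.exp ‖(x : Space d)‖ := by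
    have := Real.pow_div_factorial_le_exp _ (norm_nonneg (x : Space d)) n
    rwa [div_le_iff₀ (by positivity), mul_comm] at this
  calc ‖(x : Space d)‖ ^ n * ‖v x t‖
      ≤ n.factorial * Real.exp ‖(x : Space d)‖ * ‖v x t‖ :=
        mul_le_mul_of_nonneg_right h2 (norm_nonneg _)
    _ = n.factorial * (Real.exp ‖(x : Space d)‖ * ‖v x t‖) := by ring
    _ ≤ _ := mul_le_mul_of_nonneg_left h1 (by positivity)

end Green

/-! ### Evaluation of polynomials -/

lemma evalAt_add (q q' : MvPolynomial (Fin d) ℂ) (ξ : Space d) :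
    evalAt (q + q') ξ = evalAt q ξ + evalAt q' ξ := by simp [evalAt]

lemma evalAt_mul (q q' : MvPolynomial (Fin d) ℂ) (ξ : Space d) :
    evalAt (q * q') ξ = evalAt q ξ * evalAt q' ξ := by simp [evalAt]

lemma evalAt_C (c : ℂ) (ξ : Space d) : evalAt (MvPolynomial.C c) ξ = c := by simp [evalAt]

lemma evalAt_X (j : Fin d) (ξ : Space d) : evalAt (MvPolynomial.X j) ξ = ξ j := by simp [evalAt]

lemma evalAt_zero (ξ : Space d) : evalAt 0 ξ = 0 := by simp [evalAt]

lemma evalAt_sum {ι : Type*} (s : Finset ι) (q : ι → MvPolynomial (Fin d) ℂ) (ξ : Space d) :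
    evalAt (∑ i ∈ s, q i) ξ = ∑ i ∈ s, evalAt (q i) ξ := by simp [evalAt]

lemma evalAt_pow (q : MvPolynomial (Fin d) ℂ) (n : ℕ) (ξ : Space d) :
    evalAt (q ^ n) ξ = evalAt q ξ ^ n := by simp [evalAt]

lemma continuous_evalAt (q : MvPolynomial (Fin d) ℂ) : Continuous (evalAt q) := by
  have : evalAt q = fun ξ : Space d => ∑ α ∈ q.support, q.coeff α * ∏ j, (ξ j : ℂ) ^ α j := by
    funext ξ
    rw [evalAt, MvPolynomial.eval_eq']
  rw [this]
  fun_prop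

lemma continuous_symbol (a : MvPolynomial (Fin d ⊕ Fin d) ℂ) : Continuous (symbol a) := by
  have : symbol a = fun ξ => ∑ ν ∈ a.support, a.coeff ν *
      ((∏ k, (Complex.exp (-Complex.I * (ξ k : ℂ)) - 1) ^ ν (Sum.inl k)) *
        ∏ k, (Complex.exp (Complex.I * (ξ k : ℂ)) - 1) ^ ν (Sum.inr k)) := by
    funext ξ
    simp only [symbol_eq_sum, Fintype.prod_sum_type, Sum.elim_inl, Sum.elim_inr]
  rw [this]
  fun_prop

lemma norm_evalAt_le (q : MvPolynomial (Fin d) ℂ) :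
    ∃ (C : ℝ) (N : ℕ), 0 ≤ C ∧ ∀ ξ, ‖evalAt q ξ‖ ≤ C * (1 + ‖ξ‖) ^ N := by
  induction q using MvPolynomial.induction_on with
  | C c => exact ⟨‖c‖, 0, norm_nonneg _, fun ξ => by simp [evalAt_C]⟩
  | add q q' h h' =>
    obtain ⟨C, N, hC, hq⟩ := h
    obtain ⟨C', N', hC', hq'⟩ := h'
    refine ⟨C + C', max N N', by positivity, fun ξ => ?_⟩
    have h1 : 1 ≤ 1 + ‖ξ‖ := by linarith [norm_nonneg ξ]
    rw [evalAt_add, add_mul]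
    exact (norm_add_le _ _).trans (add_le_add
      ((hq ξ).trans (mul_le_mul_of_nonneg_left (pow_le_pow_right₀ h1 (le_max_left _ _)) hC))
      ((hq' ξ).trans (mul_le_mul_of_nonneg_left (pow_le_pow_right₀ h1 (le_max_right _ _)) hC')))
  | mul_X q j h =>
    obtain ⟨C, N, hC, hq⟩ := h
    refine ⟨C, N + 1, hC, fun ξ => ?_⟩
    have h1 : ‖ξ j‖ ≤ ‖ξ‖ := PiLp.norm_apply_le ξ j
    rw [evalAt_mul, evalAt_X, norm_mul, Complex.norm_real, pow_succ, ← mul_assoc]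
    exact mul_le_mul (hq ξ) (by linarith) (norm_nonneg _) (by positivity)

lemma evalAt_smul_of_isHomogeneous {p : MvPolynomial (Fin d) ℂ} {ℓ : ℕ} (hp : p.IsHomogeneous ℓ)
    (s : ℝ) (ξ : Space d) : evalAt p (s • ξ) = (s : ℂ) ^ ℓ * evalAt p ξ := by
  simp only [evalAt, MvPolynomial.eval_eq', Finset.mul_sum]
  refine Finset.sum_congr rfl fun α hα => ?_
  have h1 : α.degree = ℓ := by
    have := hp (MvPolynomial.mem_support_iff.1 hα)
    rwa [Finsupp.degree_eq_weight_one]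
  simp only [PiLp.smul_apply, smul_eq_mul, Complex.ofReal_mul, mul_pow, Finset.prod_mul_distrib]
  rw [Finset.prod_pow_eq_pow_sum, ← Finsupp.degree_eq_sum, h1]
  ring

/-! ### Remainders of order `s^K` with polynomial growth in `ξ` -/

/-- `e(s,ξ) = O(s^K)` with polynomial growth in `ξ`, on the region `0 < s ≤ Λ`, `Q(s,ξ)`. -/
def IsRemainder (Λ : ℝ) (Q : ℝ → Space d → Prop) (K : ℕ) (e : ℝ → Space d → ℂ) : Prop :=
  ∃ (C : ℝ) (N : ℕ), 0 ≤ C ∧ ∀ s ξ, 0 < s → s ≤ Λ → Q s ξ → ‖e s ξ‖ ≤ C * s ^ K * (1 + ‖ξ‖) ^ N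

section Remainder

variable {Λ : ℝ} {Q : ℝ → Space d → Prop} {K K' : ℕ} {e e' : ℝ → Space d → ℂ}

lemma IsRemainder.congr (h : IsRemainder Λ Q K e)
    (hee : ∀ s ξ, 0 < s → e' s ξ = e s ξ) : IsRemainder Λ Q K e' := by
  obtain ⟨C, N, hC, h⟩ := h
  refine ⟨C, N, hC, fun s ξ hs hs' hQ => ?_⟩
  rw [hee s ξ hs]
  exact h s ξ hs hs' hQ

lemma IsRemainder.add (h : IsRemainder Λ Q K e) (h' : IsRemainder Λ Q K e') :
    IsRemainder Λ Q K (fun s ξ => e s ξ + e' s ξ) := by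
  obtain ⟨C, N, hC, h⟩ := h
  obtain ⟨C', N', hC', h'⟩ := h'
  refine ⟨C + C', max N N', by positivity, fun s ξ hs hs' hQ => ?_⟩
  have h1 : 1 ≤ 1 + ‖ξ‖ := by linarith [norm_nonneg ξ]
  rw [add_mul, add_mul]
  exact (norm_add_le _ _).trans (add_le_add
    ((h s ξ hs hs' hQ).trans (mul_le_mul_of_nonneg_left
      (pow_le_pow_right₀ h1 (le_max_left _ _)) (by positivity)))
    ((h' s ξ hs hs' hQ).trans (mul_le_mul_of_nonneg_left
      (pow_le_pow_right₀ h1 (le_max_right _ _)) (by positivity))))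

lemma IsRemainder.zero : IsRemainder Λ Q K (fun _ _ => 0) :=
  ⟨0, 0, le_rfl, fun s ξ hs _ _ => by simp⟩

lemma IsRemainder.sum {ι : Type*} (t : Finset ι) {e : ι → ℝ → Space d → ℂ}
    (h : ∀ i ∈ t, IsRemainder Λ Q K (e i)) :
    IsRemainder Λ Q K (fun s ξ => ∑ i ∈ t, e i s ξ) := by
  classical
  induction t using Finset.induction_on with
  | empty => simpa using IsRemainder.zero
  | insert i t hi ih =>
    simp only [Finset.sum_insert hi]
    exact (h i (Finset.mem_insert_self _ _)).add
      (ih fun j hj => h j (Finset.mem_insert_of_mem hj))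

lemma IsRemainder.mul (h : IsRemainder Λ Q K e) (h' : IsRemainder Λ Q K' e') :
    IsRemainder Λ Q (K + K') (fun s ξ => e s ξ * e' s ξ) := by
  obtain ⟨C, N, hC, h⟩ := h
  obtain ⟨C', N', hC', h'⟩ := h'
  refine ⟨C * C', N + N', by positivity, fun s ξ hs hs' hQ => ?_⟩
  rw [norm_mul]
  calc ‖e s ξ‖ * ‖e' s ξ‖ ≤ (C * s ^ K * (1 + ‖ξ‖) ^ N) * (C' * s ^ K' * (1 + ‖ξ‖) ^ N') :=
        mul_le_mul (h s ξ hs hs' hQ) (h' s ξ hs hs' hQ) (norm_nonneg _) (by positivity)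
    _ = C * C' * s ^ (K + K') * (1 + ‖ξ‖) ^ (N + N') := by ring

lemma IsRemainder.mono (h : IsRemainder Λ Q K e) (hK : K' ≤ K) : IsRemainder Λ Q K' e := by
  obtain ⟨C, N, hC, h⟩ := h
  refine ⟨C * |Λ| ^ (K - K'), N, by positivity, fun s ξ hs hs' hQ => (h s ξ hs hs' hQ).trans ?_⟩
  refine mul_le_mul_of_nonneg_right ?_ (by positivity)
  rw [mul_assoc]
  refine mul_le_mul_of_nonneg_left ?_ hC
  calc s ^ K = s ^ (K - K') * s ^ K' := by rw [← pow_add, Nat.sub_add_cancel hK]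
    _ ≤ |Λ| ^ (K - K') * s ^ K' := by
        refine mul_le_mul_of_nonneg_right ?_ (by positivity)
        exact pow_le_pow_left₀ hs.le (hs'.trans (le_abs_self Λ)) _

lemma IsRemainder.pow_mul_evalAt (i : ℕ) (q : MvPolynomial (Fin d) ℂ) :
    IsRemainder Λ Q i (fun s ξ => (s : ℂ) ^ i * evalAt q ξ) := by
  obtain ⟨C, N, hC, hq⟩ := norm_evalAt_le q
  refine ⟨C, N, hC, fun s ξ hs _ _ => ?_⟩
  rw [norm_mul, norm_pow, Complex.norm_real, Real.norm_of_nonneg hs.le, mul_comm C, mul_assoc]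
  exact mul_le_mul_of_nonneg_left (hq ξ) (by positivity)

/-! ### Asymptotic expansions in powers of `s` with polynomial coefficients -/

/-- The partial sum `∑_{j < K} s^j F_j(ξ)`. -/
def partialSum (F : PowerSeries (MvPolynomial (Fin d) ℂ)) (K : ℕ) (s : ℝ) (ξ : Space d) : ℂ :=
  ∑ j ∈ Finset.range K, (s : ℂ) ^ j * evalAt (PowerSeries.coeff j F) ξ

/-- `f(s,ξ)` has the asymptotic expansion `∑_j s^j F_j(ξ)` as `s → 0`. -/
def HasExpansion (Λ : ℝ) (Q : ℝ → Space d → Prop) (f : ℝ → Space d → ℂ)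
    (F : PowerSeries (MvPolynomial (Fin d) ℂ)) : Prop :=
  ∀ K, IsRemainder Λ Q K (fun s ξ => f s ξ - partialSum F K s ξ)

variable {f g : ℝ → Space d → ℂ} {F G : PowerSeries (MvPolynomial (Fin d) ℂ)}

lemma HasExpansion.isRemainder_zero (h : HasExpansion Λ Q f F) : IsRemainder Λ Q 0 f :=
  (h 0).congr fun s ξ _ => by simp [LatticeGreen.partialSum]

lemma HasExpansion.add (h : HasExpansion Λ Q f F) (h' : HasExpansion Λ Q g G) :
    HasExpansion Λ Q (fun s ξ => f s ξ + g s ξ) (F + G) := fun K =>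
  ((h K).add (h' K)).congr fun s ξ _ => by
    simp only [partialSum, map_add, evalAt_add, mul_add, Finset.sum_add_distrib]
    ring

/-- The remainder of a product is `(f - F_{<K}) g + ∑_{i<K} s^i F_i (g - G_{<K-i})`, in which every
term has order `K`. -/
lemma HasExpansion.mul (h : HasExpansion Λ Q f F) (h' : HasExpansion Λ Q g G) :
    HasExpansion Λ Q (fun s ξ => f s ξ * g s ξ) (F * G) := by
  intro K
  have h1 : IsRemainder Λ Q K (fun s ξ => (f s ξ - partialSum F K s ξ) * g s ξ) :=
    (h K).mul h'.isRemainder_zero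
  have h2 : IsRemainder Λ Q K (fun s ξ => ∑ i ∈ Finset.range K,
      ((s : ℂ) ^ i * evalAt (PowerSeries.coeff i F) ξ) * (g s ξ - partialSum G (K - i) s ξ)) := by
    refine IsRemainder.sum _ fun i hi => ?_
    have := (IsRemainder.pow_mul_evalAt (Λ := Λ) (Q := Q) i (PowerSeries.coeff i F)).mul
      (h' (K - i))
    rwa [Nat.add_sub_cancel' (Finset.mem_range.1 hi).le] at this
  refine (h1.add h2).congr fun s ξ _ => ?_
  have h3 : partialSum (F * G) K s ξ = ∑ i ∈ Finset.range K,
      ((s : ℂ) ^ i * evalAt (PowerSeries.coeff i F) ξ) * partialSum G (K - i) s ξ := by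
    simp only [partialSum, Finset.mul_sum]
    rw [← Finset.sum_range_diag_flip K (fun i j => (s : ℂ) ^ i * evalAt (PowerSeries.coeff i F) ξ *
      ((s : ℂ) ^ j * evalAt (PowerSeries.coeff j G) ξ))]
    refine Finset.sum_congr rfl fun n _ => ?_
    rw [PowerSeries.coeff_mul, Finset.Nat.sum_antidiagonal_eq_sum_range_succ_mk, evalAt_sum,
      Finset.mul_sum]
    refine Finset.sum_congr rfl fun i hi => ?_
    rw [evalAt_mul]
    have : (s : ℂ) ^ n = (s : ℂ) ^ i * (s : ℂ) ^ (n - i) := by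
      rw [← pow_add, Nat.add_sub_cancel' (Nat.lt_succ_iff.1 (Finset.mem_range.1 hi))]
    rw [this]
    ring
  rw [h3]
  simp only [mul_sub, Finset.sum_sub_distrib, ← Finset.sum_mul]
  rw [← partialSum]
  ring

lemma HasExpansion.const (c : ℂ) :
    HasExpansion Λ Q (fun _ _ => c) (PowerSeries.C (MvPolynomial.C c)) := by
  intro K
  cases K with
  | zero =>
    refine ⟨‖c‖, 0, norm_nonneg _, fun s ξ _ _ _ => ?_⟩
    simp [partialSum]
  | succ K =>
    refine IsRemainder.zero.congr fun s ξ _ => ?_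
    rw [partialSum, Finset.sum_range_succ', Finset.sum_eq_zero]
    · simp [evalAt_C]
    · intro j _
      simp [evalAt_zero]

lemma HasExpansion.pow (h : HasExpansion Λ Q f F) (n : ℕ) :
    HasExpansion Λ Q (fun s ξ => f s ξ ^ n) (F ^ n) := by
  induction n with
  | zero => simpa using HasExpansion.const (Λ := Λ) (Q := Q) 1
  | succ n ih =>
    simp only [pow_succ]
    exact ih.mul h

lemma HasExpansion.sum {ι : Type*} (t : Finset ι) {f : ι → ℝ → Space d → ℂ}
    {F : ι → PowerSeries (MvPolynomial (Fin d) ℂ)} (h : ∀ i ∈ t, HasExpansion Λ Q (f i) (F i)) :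
    HasExpansion Λ Q (fun s ξ => ∑ i ∈ t, f i s ξ) (∑ i ∈ t, F i) := by
  classical
  induction t using Finset.induction_on with
  | empty => simpa using HasExpansion.const (Λ := Λ) (Q := Q) 0
  | insert i t hi ih =>
    simp only [Finset.sum_insert hi]
    exact (h i (Finset.mem_insert_self _ _)).add
      (ih fun j hj => h j (Finset.mem_insert_of_mem hj))

/-- Division by `s^ℓ` when the coefficients of order less than `ℓ` vanish. -/
lemma HasExpansion.div_pow (h : HasExpansion Λ Q f F) (ℓ : ℕ)
    (hF : ∀ j < ℓ, PowerSeries.coeff j F = 0) :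
    HasExpansion Λ Q (fun s ξ => ((s : ℂ) ^ ℓ)⁻¹ * f s ξ)
      (PowerSeries.mk fun j => PowerSeries.coeff (j + ℓ) F) := by
  intro K
  -- Division by `s^ℓ` costs `ℓ` orders, so the expansion is taken `ℓ` orders further.
  obtain ⟨C, N, hC, h⟩ := h (ℓ + K)
  refine ⟨C, N, hC, fun s ξ hs hs' hQ => ?_⟩
  have hs0 : (s : ℂ) ≠ 0 := by exact_mod_cast hs.ne'
  have h1 : partialSum F (ℓ + K) s ξ = (s : ℂ) ^ ℓ *
      partialSum (PowerSeries.mk fun j => PowerSeries.coeff (j + ℓ) F) K s ξ := by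
    simp only [partialSum, Finset.sum_range_add, PowerSeries.coeff_mk, Finset.mul_sum]
    rw [Finset.sum_eq_zero, zero_add]
    · refine Finset.sum_congr rfl fun j _ => ?_
      rw [add_comm ℓ j]
      ring
    · intro j hj
      rw [hF j (Finset.mem_range.1 hj), evalAt_zero, mul_zero]
  have h2 : ((s : ℂ) ^ ℓ)⁻¹ * f s ξ -
      partialSum (PowerSeries.mk fun j => PowerSeries.coeff (j + ℓ) F) K s ξ =
      ((s : ℂ) ^ ℓ)⁻¹ * (f s ξ - partialSum F (ℓ + K) s ξ) := by
    rw [h1]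
    field_simp
  beta_reduce
  rw [h2, norm_mul, norm_inv, norm_pow, Complex.norm_real, Real.norm_of_nonneg hs.le]
  calc (s ^ ℓ)⁻¹ * ‖f s ξ - partialSum F (ℓ + K) s ξ‖
      ≤ (s ^ ℓ)⁻¹ * (C * s ^ (ℓ + K) * (1 + ‖ξ‖) ^ N) :=
        mul_le_mul_of_nonneg_left (h s ξ hs hs' hQ) (by positivity)
    _ = C * s ^ K * (1 + ‖ξ‖) ^ N := by
        rw [pow_add]
        field_simp

end Remainder

/-! ### Expansion of the symbol -/

section Symbol

variable {Λ r : ℝ}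

/-- The Taylor remainder of the exponential carries a factor `e^{s|ξ|}`; restricting to `s|ξ| ≤ r`
keeps it bounded, so that only polynomial growth in `ξ` remains. -/
lemma hasExpansion_step {c : ℂ} (hc : ‖c‖ = 1) (k : Fin d) :
    HasExpansion Λ (fun s ξ => s * ‖ξ‖ ≤ r)
      (fun s ξ => Complex.exp (c * ((s • ξ) k : ℝ)) - 1)
      (PowerSeries.rescale (MvPolynomial.C c * MvPolynomial.X k)
        (PowerSeries.exp (MvPolynomial (Fin d) ℂ)) - 1) := by
  have key : HasExpansion Λ (fun s ξ => s * ‖ξ‖ ≤ r)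
      (fun s ξ : _ => Complex.exp (c * ((s • ξ) k : ℝ)))
      (PowerSeries.rescale (MvPolynomial.C c * MvPolynomial.X k)
        (PowerSeries.exp (MvPolynomial (Fin d) ℂ))) := by
    intro K
    refine ⟨Real.exp r, K, (Real.exp_pos _).le, fun s ξ hs _ hr => ?_⟩
    have h1 : partialSum (PowerSeries.rescale (MvPolynomial.C c * MvPolynomial.X k)
        (PowerSeries.exp (MvPolynomial (Fin d) ℂ))) K s ξ =
        ∑ m ∈ Finset.range K, (c * ((s • ξ) k : ℝ)) ^ m / (m.factorial : ℂ) := by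
      refine Finset.sum_congr rfl fun m _ => ?_
      have h2 : evalAt (algebraMap ℚ (MvPolynomial (Fin d) ℂ) (1 / (m.factorial : ℚ))) ξ =
          1 / (m.factorial : ℂ) := by
        have := eq_ratCast ((MvPolynomial.eval fun j => (ξ j : ℂ)).comp
          (algebraMap ℚ (MvPolynomial (Fin d) ℂ))) (1 / (m.factorial : ℚ))
        rw [evalAt]
        refine this.trans ?_
        push_cast
        rfl
      rw [PowerSeries.coeff_rescale, PowerSeries.coeff_exp, evalAt_mul, evalAt_pow, evalAt_mul,
        evalAt_C, evalAt_X, h2, PiLp.smul_apply, smul_eq_mul]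
      push_cast
      ring
    have h3 : ‖c * ((s • ξ) k : ℝ)‖ ≤ s * ‖ξ‖ := by
      rw [norm_mul, hc, one_mul, Complex.norm_real]
      refine (PiLp.norm_apply_le (s • ξ) k).trans ?_
      rw [norm_smul, Real.norm_of_nonneg hs.le]
    beta_reduce at hr ⊢
    rw [h1]
    refine (Complex.norm_exp_sub_sum_le_norm_mul_exp _ K).trans ?_
    calc _ ≤ (s * ‖ξ‖) ^ K * Real.exp r :=
          mul_le_mul (pow_le_pow_left₀ (norm_nonneg _) h3 K) (Real.exp_le_exp.2 (h3.trans hr))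
            (Real.exp_pos _).le (by positivity)
      _ = Real.exp r * s ^ K * ‖ξ‖ ^ K := by ring
      _ ≤ Real.exp r * s ^ K * (1 + ‖ξ‖) ^ K := by
          refine mul_le_mul_of_nonneg_left ?_ (by positivity)
          exact pow_le_pow_left₀ (norm_nonneg _) (by linarith) K
  have := key.add (HasExpansion.const (-1))
  simp only [map_neg, map_one] at this
  simpa only [sub_eq_add_neg] using this

lemma hasExpansion_symbol (a : MvPolynomial (Fin d ⊕ Fin d) ℂ) :
    HasExpansion Λ (fun s ξ => s * ‖ξ‖ ≤ r) (fun s ξ => symbol a (s • ξ)) (symbolSeries a) := by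
  induction a using MvPolynomial.induction_on with
  | C c =>
    simp only [symbol, symbolSeries, MvPolynomial.eval_C, MvPolynomial.eval₂_C]
    exact HasExpansion.const c
  | add a b ha hb =>
    simp only [symbol, symbolSeries, map_add, MvPolynomial.eval₂_add] at ha hb ⊢
    exact ha.add hb
  | mul_X a i ha =>
    simp only [symbol, symbolSeries, map_mul, MvPolynomial.eval₂_mul, MvPolynomial.eval_X,
      MvPolynomial.eval₂_X] at ha ⊢
    refine ha.mul ?_
    cases i with
    | inl k => exact hasExpansion_step (by simp) k
    | inr k => exact hasExpansion_step (by simp) k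

lemma constantCoeff_rescale_exp_sub_one (c : MvPolynomial (Fin d) ℂ) :
    PowerSeries.constantCoeff
      (PowerSeries.rescale c (PowerSeries.exp (MvPolynomial (Fin d) ℂ)) - 1) = 0 := by
  rw [map_sub, ← PowerSeries.coeff_zero_eq_constantCoeff_apply, PowerSeries.coeff_rescale]
  simp

/-- Each factor `e^{±isθ_k} - 1` is divisible by `s`, and each monomial of the operator has at least
`ℓ` such factors. -/
lemma taylorPart_eq_zero {a : MvPolynomial (Fin d ⊕ Fin d) ℂ} {ℓ : ℕ}
    (ha : ∀ ν ∈ a.support, ℓ ≤ ν.degree) {m : ℕ} (hm : m < ℓ) : taylorPart a m = 0 := by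
  have key : (PowerSeries.X : PowerSeries (MvPolynomial (Fin d) ℂ)) ^ ℓ ∣ symbolSeries a := by
    rw [symbolSeries, MvPolynomial.eval₂_eq']
    refine Finset.dvd_sum fun ν hν => Dvd.dvd.mul_left ?_ _
    refine (pow_dvd_pow _ (ha ν hν)).trans ?_
    rw [Finsupp.degree_eq_sum, ← Finset.prod_pow_eq_pow_sum]
    refine Finset.prod_dvd_prod_of_dvd _ _ fun i _ => pow_dvd_pow_of_dvd ?_ _
    rw [PowerSeries.X_dvd_iff]
    cases i with
    | inl k => exact constantCoeff_rescale_exp_sub_one _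
    | inr k => exact constantCoeff_rescale_exp_sub_one _
  exact PowerSeries.X_pow_dvd_iff.1 key m hm

/-- The power series of `s^{-ℓ} A(s ξ)`. -/
def scaledSeries (a : MvPolynomial (Fin d ⊕ Fin d) ℂ) (ℓ : ℕ) :
    PowerSeries (MvPolynomial (Fin d) ℂ) :=
  PowerSeries.mk fun j => taylorPart a (j + ℓ)

lemma hasExpansion_scaled {a : MvPolynomial (Fin d ⊕ Fin d) ℂ} {ℓ : ℕ}
    (ha : ∀ ν ∈ a.support, ℓ ≤ ν.degree) :
    HasExpansion Λ (fun s ξ => s * ‖ξ‖ ≤ r)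
      (fun s ξ => ((s : ℂ) ^ ℓ)⁻¹ * symbol a (s • ξ)) (scaledSeries a ℓ) :=
  (hasExpansion_symbol a).div_pow ℓ fun _ hj => taylorPart_eq_zero ha hj

/-- Letting `s → 0` removes the lowest coefficient; dividing by `s` reduces `M` by one. -/
lemma coeff_eq_zero_of_sum_le {M : ℕ} {c : ℕ → ℂ} {C : ℝ}
    (h : ∀ s : ℝ, 0 < s → s ≤ 1 → ‖∑ j ∈ Finset.range M, (s : ℂ) ^ j * c j‖ ≤ C * s ^ M) :
    ∀ j < M, c j = 0 := by
  induction M generalizing c with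
  | zero => simp
  | succ M ih =>
    have hsum : ∀ s : ℝ, ∑ j ∈ Finset.range (M + 1), (s : ℂ) ^ j * c j =
        s * (∑ j ∈ Finset.range M, (s : ℂ) ^ j * c (j + 1)) + c 0 := by
      intro s
      rw [Finset.sum_range_succ', Finset.mul_sum]
      simp only [pow_succ', pow_zero, one_mul, mul_assoc]
    have h0 : c 0 = 0 := by
      have hcont : Continuous fun s : ℝ => C * s ^ (M + 1) -
          ‖∑ j ∈ Finset.range (M + 1), (s : ℂ) ^ j * c j‖ := by fun_prop
      have hlim : Filter.Tendsto (fun s : ℝ => C * s ^ (M + 1) -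
          ‖∑ j ∈ Finset.range (M + 1), (s : ℂ) ^ j * c j‖) (nhdsWithin 0 (Set.Ioi 0))
          (nhds (C * 0 ^ (M + 1) - ‖∑ j ∈ Finset.range (M + 1), ((0 : ℝ) : ℂ) ^ j * c j‖)) :=
        (hcont.tendsto 0).mono_left nhdsWithin_le_nhds
      have h1 := ge_of_tendsto hlim (b := 0) (by
        filter_upwards [Ioc_mem_nhdsGT (zero_lt_one' ℝ)] with s hs
        exact sub_nonneg.2 (h s hs.1 hs.2))
      rw [hsum] at h1
      simpa using h1
    have h1 : ∀ j < M, c (j + 1) = 0 := by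
      refine ih fun s hs hs1 => ?_
      have h2 := h s hs hs1
      rw [hsum, h0, add_zero, norm_mul, Complex.norm_real, Real.norm_of_nonneg hs.le,
        pow_succ'] at h2
      exact le_of_mul_le_mul_left (h2.trans (le_of_eq (by ring))) hs
    intro j hj
    cases j with
    | zero => exact h0
    | succ j => exact h1 j (by omega)

lemma eq_of_evalAt_eq {q q' : MvPolynomial (Fin d) ℂ} (h : ∀ ξ, evalAt q ξ = evalAt q' ξ) :
    q = q' := by
  refine MvPolynomial.funext_set (fun _ => Set.range ((↑) : ℝ → ℂ))
    (fun _ => Set.infinite_range_of_injective Complex.ofReal_injective) fun x hx => ?_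
  choose ξ hξ using fun j => hx j (Set.mem_univ j)
  have := h (WithLp.toLp 2 ξ)
  simp only [evalAt, hξ] at this
  exact this

variable {a : MvPolynomial (Fin d ⊕ Fin d) ℂ} {ℓ M : ℕ} {p : MvPolynomial (Fin d) ℂ}

/-- An approximation of order `M` has no Taylor terms of the orders `ℓ + 1, …, ℓ + M - 1`, and
its leading term is the symbol of the differential operator. -/
lemma IsApproximation.coeff_scaledSeries (happ : IsApproximation a ℓ M p)
    (ha : ∀ ν ∈ a.support, ℓ ≤ ν.degree) {j : ℕ} (hj : j < M) :
    PowerSeries.coeff j (scaledSeries a ℓ) = if j = 0 then p else 0 := by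
  refine eq_of_evalAt_eq fun ξ => ?_
  obtain ⟨C, hC⟩ := happ.symbol_sub_le ξ
  obtain ⟨C', N, hC', h⟩ := hasExpansion_scaled (Λ := 1) (r := ‖ξ‖) ha M
  have hM : M ≠ 0 := by omega
  have hsum : ∀ s : ℝ, ∑ i ∈ Finset.range M, (s : ℂ) ^ i *
      (evalAt (PowerSeries.coeff i (scaledSeries a ℓ)) ξ - evalAt (if i = 0 then p else 0) ξ) =
      partialSum (scaledSeries a ℓ) M s ξ - evalAt p ξ := by
    intro s
    simp only [mul_sub, Finset.sum_sub_distrib]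
    rw [← partialSum]
    congr 1
    rw [Finset.sum_eq_single 0]
    · simp
    · intro i _ hi
      simp [hi, evalAt_zero]
    · intro h0
      exact absurd (Finset.mem_range.2 (Nat.pos_of_ne_zero hM)) h0
  -- At fixed `ξ`, both `𝒜(ξ)` and the Taylor sum agree with `s^{-ℓ}A(sξ)` up to `O(s^M)`. Their
  -- difference is a polynomial in `s` of degree below `M`, hence zero.
  have key := coeff_eq_zero_of_sum_le (M := M) (C := C + C' * (1 + ‖ξ‖) ^ N) (c := fun i =>
    evalAt (PowerSeries.coeff i (scaledSeries a ℓ)) ξ - evalAt (if i = 0 then p else 0) ξ)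
    (fun s hs hs1 => by
      rw [hsum]
      have h1 := hC s hs
      have h2 := h s ξ hs hs1 (mul_le_of_le_one_left (norm_nonneg ξ) hs1)
      calc ‖partialSum (scaledSeries a ℓ) M s ξ - evalAt p ξ‖
          = ‖(((s : ℂ) ^ ℓ)⁻¹ * symbol a (s • ξ) - evalAt p ξ) -
            (((s : ℂ) ^ ℓ)⁻¹ * symbol a (s • ξ) - partialSum (scaledSeries a ℓ) M s ξ)‖ := by
            congr 1
            ring
        _ ≤ C * s ^ M + C' * s ^ M * (1 + ‖ξ‖) ^ N :=
            (norm_sub_le _ _).trans (add_le_add h1 h2)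
        _ = (C + C' * (1 + ‖ξ‖) ^ N) * s ^ M := by ring) j hj
  exact sub_eq_zero.1 key

/-! ### Lower bound for the symbol -/

lemma symbol_zero (hℓ : 0 < ℓ) (ha : ∀ ν ∈ a.support, ℓ ≤ ν.degree) : symbol a 0 = 0 := by
  rw [symbol_eq_sum]
  refine Finset.sum_eq_zero fun ν hν => ?_
  have h1 : ν ≠ 0 := by
    rintro rfl
    have := ha 0 hν
    simp at this
    omega
  obtain ⟨i, hi⟩ := Finsupp.ne_iff.1 h1
  rw [Finset.prod_eq_zero (Finset.mem_univ i), mul_zero]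
  rw [pow_eq_zero_iff (by simpa using hi)]
  cases i <;> simp

/-- In polar form `θ = |θ|ξ`, the expansion is used with `s = |θ|` and a unit vector `ξ`, so the
polynomial growth in `ξ` becomes the constant `2^N`. -/
lemma norm_symbol_sub_le (hℓ : 0 < ℓ) (hM : 1 ≤ M) (hp : p.IsHomogeneous ℓ)
    (happ : IsApproximation a ℓ M p)
    (ha : ∀ ν ∈ a.support, ℓ ≤ ν.degree) (Λ : ℝ) :
    ∃ C : ℝ, 0 ≤ C ∧ ∀ θ : Space d, ‖θ‖ ≤ Λ → ‖symbol a θ - evalAt p θ‖ ≤ C * ‖θ‖ ^ (ℓ + 1) := by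
  obtain ⟨C, N, hC, h⟩ := hasExpansion_scaled (Λ := Λ) (r := Λ) ha 1
  refine ⟨C * 2 ^ N, by positivity, fun θ hθ => ?_⟩
  by_cases h0 : θ = 0
  · subst h0
    have h1 := evalAt_smul_of_isHomogeneous hp 0 0
    rw [smul_zero, Complex.ofReal_zero, zero_pow hℓ.ne', zero_mul] at h1
    rw [symbol_zero hℓ ha, h1]
    simp
  have hpos : 0 < ‖θ‖ := norm_pos_iff.2 h0
  set ξ : Space d := ‖θ‖⁻¹ • θ with hξ
  have hnξ : ‖ξ‖ = 1 := by
    rw [hξ, norm_smul, norm_inv, norm_norm, inv_mul_cancel₀ hpos.ne']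
  have hθξ : ‖θ‖ • ξ = θ := by
    rw [hξ, smul_smul, mul_inv_cancel₀ hpos.ne', one_smul]
  have h1 := h ‖θ‖ ξ hpos hθ (by beta_reduce; rwa [hnξ, mul_one])
  have h2 : partialSum (scaledSeries a ℓ) 1 ‖θ‖ ξ = evalAt p ξ := by
    simp [partialSum, happ.coeff_scaledSeries ha (show 0 < M by omega)]
  have hc : ((‖θ‖ : ℝ) : ℂ) ^ ℓ ≠ 0 := pow_ne_zero _ (by exact_mod_cast hpos.ne')
  have h3 : symbol a θ - evalAt p θ = ((‖θ‖ : ℝ) : ℂ) ^ ℓ *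
      ((((‖θ‖ : ℝ) : ℂ) ^ ℓ)⁻¹ * symbol a θ - evalAt p ξ) := by
    nth_rewrite 2 [← hθξ]
    rw [evalAt_smul_of_isHomogeneous hp, mul_sub, mul_inv_cancel_left₀ hc]
  beta_reduce at h1
  rw [hθξ, h2, hnξ] at h1
  rw [h3, norm_mul, norm_pow, Complex.norm_real, norm_norm]
  calc _ ≤ ‖θ‖ ^ ℓ * (C * ‖θ‖ ^ 1 * (1 + 1) ^ N) :=
        mul_le_mul_of_nonneg_left h1 (by positivity)
    _ = _ := by ring

lemma isCompact_cube (d : ℕ) (lam : ℝ) : IsCompact (cube d lam) := by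
  have h1 : cube d lam = (EuclideanSpace.equiv (Fin d) ℝ).toHomeomorph ⁻¹'
      (Set.univ.pi fun _ => Set.Icc (-lam) lam) := by
    ext θ
    simp only [cube, Set.mem_ofPred_eq, Set.mem_preimage, Set.mem_pi, Set.mem_univ, true_imp_iff,
      Set.mem_Icc, abs_le]
    rfl
  rw [h1, Homeomorph.isCompact_preimage]
  exact isCompact_univ_pi fun _ => isCompact_Icc

/-- For `|θ| ≤ ρ` the error `C|θ|^{ℓ+1}` takes at most half of `c|θ|^ℓ`, which is how `ρ` is chosen.
On the rest of the cube `Re A` has a positive minimum by compactness. -/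
lemma symbol_re_lower_bound (hℓ : 0 < ℓ) (hM : 1 ≤ M) (hp : p.IsHomogeneous ℓ)
    (hpell : StronglyElliptic p ℓ)
    (ha : ∀ ν ∈ a.support, ℓ ≤ ν.degree) (happ : IsApproximation a ℓ M p)
    (haell : DiscretelyElliptic a) :
    ∃ c : ℝ, 0 < c ∧ ∀ θ ∈ cube d Real.pi, c * ‖θ‖ ^ ℓ ≤ (symbol a θ).re := by
  obtain ⟨c, hc, hpc⟩ := hpell
  obtain ⟨C, hC, hsub⟩ := norm_symbol_sub_le hℓ hM hp happ ha 1
  set ρ : ℝ := min 1 (c / (2 * (C + 1))) with hρ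
  have hρ0 : 0 < ρ := lt_min one_pos (by positivity)
  have hCρ : C * ρ ≤ c / 2 := by
    calc C * ρ ≤ (C + 1) * (c / (2 * (C + 1))) :=
          mul_le_mul (by linarith) (min_le_right _ _) hρ0.le (by linarith)
      _ = c / 2 := by field_simp
  have hnear : ∀ θ : Space d, ‖θ‖ ≤ ρ → c / 2 * ‖θ‖ ^ ℓ ≤ (symbol a θ).re := by
    intro θ hθ
    have h1 := hsub θ (hθ.trans (min_le_left _ _))
    have h2 := (Complex.abs_re_le_norm _).trans h1
    rw [Complex.sub_re] at h2
    have h3 := (abs_le.1 h2).1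
    have h4 : C * ‖θ‖ ^ (ℓ + 1) ≤ c / 2 * ‖θ‖ ^ ℓ := by
      rw [pow_succ', ← mul_assoc]
      exact mul_le_mul_of_nonneg_right ((mul_le_mul_of_nonneg_left hθ hC).trans hCρ)
        (by positivity)
    linarith [hpc θ]
  set Kc : Set (Space d) := cube d Real.pi ∩ {θ | ρ ≤ ‖θ‖} with hKc
  have hK : IsCompact Kc :=
    (isCompact_cube d _).inter_right (isClosed_le continuous_const continuous_norm)
  have hcontre : Continuous fun θ => (symbol a θ).re :=
    Complex.continuous_re.comp (continuous_symbol a)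
  obtain ⟨m, hm, hmK⟩ : ∃ m : ℝ, 0 < m ∧ ∀ θ ∈ Kc, m ≤ (symbol a θ).re := by
    rcases Kc.eq_empty_or_nonempty with he | hne
    · exact ⟨1, one_pos, by simp [he]⟩
    · obtain ⟨θ₀, hθ₀, hmin⟩ := hK.exists_isMinOn hne hcontre.continuousOn
      refine ⟨(symbol a θ₀).re, haell θ₀ hθ₀.1 ?_, fun θ hθ => hmin hθ⟩
      rintro rfl
      have : ρ ≤ ‖(0 : Space d)‖ := hθ₀.2
      rw [norm_zero] at this
      linarith
  obtain ⟨B, hB⟩ := (isCompact_cube d Real.pi).exists_bound_of_continuousOn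
    (f := fun θ : Space d => ‖θ‖ ^ ℓ) (by fun_prop)
  refine ⟨min (c / 2) (m / (|B| + 1)), lt_min (by positivity) (by positivity), fun θ hθ => ?_⟩
  by_cases hθρ : ‖θ‖ ≤ ρ
  · exact (mul_le_mul_of_nonneg_right (min_le_left _ _) (by positivity)).trans (hnear θ hθρ)
  · have h1 : ‖θ‖ ^ ℓ ≤ |B| + 1 := by
      have := hB θ hθ
      rw [norm_pow, norm_norm] at this
      linarith [le_abs_self B]
    calc _ ≤ m / (|B| + 1) * (|B| + 1) :=
          mul_le_mul (min_le_right _ _) h1 (by positivity) (by positivity)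
      _ = m := by field_simp
      _ ≤ _ := hmK θ ⟨hθ, (not_le.1 hθρ).le⟩

/-! ### The correction polynomials -/

/-- The power series `∑_{j ≥ 1} s^j 𝒜_{j+ℓ}`. -/
def tailSeries (a : MvPolynomial (Fin d ⊕ Fin d) ℂ) (ℓ : ℕ) :
    PowerSeries (MvPolynomial (Fin d) ℂ) :=
  PowerSeries.mk fun j => if j = 0 then 0 else taylorPart a (j + ℓ)

lemma hasExpansion_tail (hM : 1 ≤ M) (ha : ∀ ν ∈ a.support, ℓ ≤ ν.degree)
    (happ : IsApproximation a ℓ M p) :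
    HasExpansion Λ (fun s ξ => s * ‖ξ‖ ≤ r)
      (fun s ξ => ((s : ℂ) ^ ℓ)⁻¹ * symbol a (s • ξ) - evalAt p ξ) (tailSeries a ℓ) := by
  intro K
  cases K with
  | zero =>
    have h1 := (hasExpansion_scaled (Λ := Λ) (r := r) ha).isRemainder_zero
    have h2 : IsRemainder Λ (fun s (ξ : Space d) => s * ‖ξ‖ ≤ r) 0
        (fun s ξ => (s : ℂ) ^ 0 * evalAt (MvPolynomial.C (-1) * p) ξ) :=
      IsRemainder.pow_mul_evalAt 0 _
    refine (h1.add h2).congr fun s ξ _ => ?_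
    simp only [partialSum, Finset.range_zero, Finset.sum_empty, evalAt_mul, evalAt_C]
    ring
  | succ K =>
    refine (hasExpansion_scaled (Λ := Λ) (r := r) ha (K + 1)).congr fun s ξ _ => ?_
    have h0 : evalAt (PowerSeries.coeff 0 (scaledSeries a ℓ)) ξ = evalAt p ξ := by
      rw [happ.coeff_scaledSeries ha (show 0 < M by omega), if_pos rfl]
    simp only [partialSum, Finset.sum_range_succ', h0]
    simp only [tailSeries, scaledSeries, PowerSeries.coeff_mk, Nat.add_one_ne_zero, if_false,
      if_true, evalAt_zero]
    ring

/-- The tail series is divisible by `s`, so its `m`th power does not contribute to `s^k` when `m >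
k`. A single truncation of the exponential thus serves all `k < K`. -/
lemma corrPoly_eq (a : MvPolynomial (Fin d ⊕ Fin d) ℂ) (ℓ : ℕ) {k K : ℕ} (hk : k < K) :
    corrPoly a ℓ k = PowerSeries.coeff k (∑ m ∈ Finset.range K,
      PowerSeries.C (MvPolynomial.C ((-1 : ℂ) ^ m / (m.factorial : ℂ))) * tailSeries a ℓ ^ m) := by
  rw [map_sum, corrPoly, ← tailSeries]
  simp only [PowerSeries.coeff_C_mul]
  refine Finset.sum_subset (Finset.range_subset_range.2 hk) fun m _ hm => ?_
  have h1 : (PowerSeries.X : PowerSeries (MvPolynomial (Fin d) ℂ)) ∣ tailSeries a ℓ := by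
    rw [PowerSeries.X_dvd_iff, ← PowerSeries.coeff_zero_eq_constantCoeff_apply]
    simp [tailSeries]
  rw [PowerSeries.X_pow_dvd_iff.1 (pow_dvd_pow_of_dvd h1 m) k
    (by simpa using hm), mul_zero]

/-- The tail series is divisible even by `s^M`; this is why the correction terms start at `k = M`.
-/
lemma corrPoly_eq_zero (ha : ∀ ν ∈ a.support, ℓ ≤ ν.degree)
    (happ : IsApproximation a ℓ M p) {k : ℕ} (hk : 0 < k) (hkM : k < M) : corrPoly a ℓ k = 0 := by
  rw [corrPoly, ← tailSeries]
  refine Finset.sum_eq_zero fun m _ => ?_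
  cases m with
  | zero => simp [PowerSeries.coeff_one, hk.ne']
  | succ m =>
    have h1 : (PowerSeries.X : PowerSeries (MvPolynomial (Fin d) ℂ)) ^ M ∣ tailSeries a ℓ := by
      refine PowerSeries.X_pow_dvd_iff.2 fun j hj => ?_
      rw [tailSeries, PowerSeries.coeff_mk]
      split_ifs with h0
      · rfl
      · have := happ.coeff_scaledSeries ha hj
        rwa [if_neg h0, scaledSeries, PowerSeries.coeff_mk] at this
    rw [PowerSeries.X_pow_dvd_iff.1 (h1.trans (dvd_pow_self _ m.succ_ne_zero)) k hkM, mul_zero]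

lemma isRemainder_sum_corrPoly (hM : 1 ≤ M) (ha : ∀ ν ∈ a.support, ℓ ≤ ν.degree)
    (happ : IsApproximation a ℓ M p) (K : ℕ) :
    IsRemainder Λ (fun s ξ => s * ‖ξ‖ ≤ r) K (fun s ξ =>
      (∑ m ∈ Finset.range K,
        (-(((s : ℂ) ^ ℓ)⁻¹ * symbol a (s • ξ) - evalAt p ξ)) ^ m / (m.factorial : ℂ)) -
      ∑ k ∈ Finset.range K, (s : ℂ) ^ k * evalAt (corrPoly a ℓ k) ξ) := by
  have h1 := HasExpansion.sum (Finset.range K) (fun m _ =>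
    (HasExpansion.const ((-1 : ℂ) ^ m / (m.factorial : ℂ))).mul
      ((hasExpansion_tail (Λ := Λ) (r := r) hM ha happ).pow m)) K
  refine h1.congr fun s ξ _ => ?_
  congr 1
  · refine Finset.sum_congr rfl fun m _ => ?_
    rw [neg_pow]
    ring
  · refine Finset.sum_congr rfl fun k hk => ?_
    rw [corrPoly_eq a ℓ (Finset.mem_range.1 hk)]

end Symbol

/-! ### Integrability of exponentially decaying functions -/

/-- From `x^ℓ ≥ x - 1` the decay is at least that of `e^{-c(x-1)}`, while `(c(1+x))^m/m! ≤
e^{c(1+x)}`; the product of the exponentials is `e^{2c}`. -/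
lemma pow_mul_exp_le {c : ℝ} (hc : 0 < c) (m : ℕ) {ℓ : ℕ} (hℓ : 0 < ℓ) {x : ℝ} (hx : 0 ≤ x) :
    (1 + x) ^ m * Real.exp (-c * x ^ ℓ) ≤ m.factorial / c ^ m * Real.exp (2 * c) := by
  have h1 : x - 1 ≤ x ^ ℓ := by
    rcases le_total x 1 with h | h
    · linarith [pow_nonneg hx ℓ]
    · linarith [le_self_pow₀ h hℓ.ne']
  have h2 : (1 + x) ^ m ≤ m.factorial / c ^ m * Real.exp (c * (1 + x)) := by
    have := Real.pow_div_factorial_le_exp (c * (1 + x)) (by positivity) m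
    rw [div_le_iff₀ (by positivity), mul_pow] at this
    rw [div_mul_eq_mul_div, le_div_iff₀ (by positivity)]
    linarith
  have h3 : Real.exp (-c * x ^ ℓ) ≤ Real.exp (-c * (x - 1)) := by
    rw [Real.exp_le_exp]
    nlinarith
  calc _ ≤ (m.factorial / c ^ m * Real.exp (c * (1 + x))) * Real.exp (-c * (x - 1)) :=
        mul_le_mul h2 h3 (Real.exp_pos _).le (by positivity)
    _ = _ := by
        rw [mul_assoc, ← Real.exp_add]
        congr 2
        ring

/-- Applying the pointwise bound with the power `N + d + 1` leaves the integrable majorant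
`(1+|ξ|)^{-(d+1)}`. -/
lemma integrable_pow_mul_exp {c : ℝ} (hc : 0 < c) (N : ℕ) {ℓ : ℕ} (hℓ : 0 < ℓ) :
    Integrable (fun ξ : Space d => (1 + ‖ξ‖) ^ N * Real.exp (-c * ‖ξ‖ ^ ℓ)) := by
  have h1 : Integrable (fun ξ : Space d => (1 + ‖ξ‖) ^ (-((d : ℝ) + 1))) :=
    integrable_one_add_norm (by rw [finrank_euclideanSpace_fin]; linarith)
  refine (h1.const_mul ((N + (d + 1)).factorial / c ^ (N + (d + 1)) * Real.exp (2 * c))).mono'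
    (by fun_prop) (Filter.Eventually.of_forall fun ξ => ?_)
  have h0 : 0 < 1 + ‖ξ‖ := by positivity
  rw [Real.norm_of_nonneg (by positivity), Real.rpow_neg h0.le, ← div_eq_mul_inv,
    le_div_iff₀ (by positivity)]
  have h2 : (1 + ‖ξ‖) ^ ((d : ℝ) + 1) = (1 + ‖ξ‖) ^ (d + 1) := by
    rw [← Real.rpow_natCast]
    push_cast
    rfl
  rw [h2]
  refine le_trans (le_of_eq ?_) (pow_mul_exp_le hc (N + (d + 1)) hℓ (norm_nonneg ξ))
  ring

lemma allMoments_of_le {φ : Space d → ℂ} (hφ : Continuous φ) {C c : ℝ} (hc : 0 < c)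
    {N ℓ : ℕ} (hℓ : 0 < ℓ)
    (h : ∀ ξ, ‖φ ξ‖ ≤ C * ((1 + ‖ξ‖) ^ N * Real.exp (-c * ‖ξ‖ ^ ℓ))) :
    AllMoments volume φ := by
  refine ⟨hφ.aestronglyMeasurable, fun n => ?_⟩
  refine ((integrable_pow_mul_exp (d := d) hc (n + N) hℓ).const_mul C).mono'
    (by fun_prop) (Filter.Eventually.of_forall fun ξ => ?_)
  rw [Real.norm_of_nonneg (by positivity)]
  calc ‖ξ‖ ^ n * ‖φ ξ‖
      ≤ (1 + ‖ξ‖) ^ n * (C * ((1 + ‖ξ‖) ^ N * Real.exp (-c * ‖ξ‖ ^ ℓ))) :=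
        mul_le_mul (pow_le_pow_left₀ (norm_nonneg _) (by linarith) n) (h ξ) (norm_nonneg _)
          (by positivity)
    _ = _ := by ring

section Profile

variable {p : MvPolynomial (Fin d) ℂ} {ℓ : ℕ}

lemma norm_exp_neg_evalAt (p : MvPolynomial (Fin d) ℂ) (ξ : Space d) :
    ‖Complex.exp (-evalAt p ξ)‖ = Real.exp (-(evalAt p ξ).re) := by
  rw [Complex.norm_exp, Complex.neg_re]

lemma allMoments_evalAt_mul_exp (hℓ : 0 < ℓ) (hpell : StronglyElliptic p ℓ)
    (q : MvPolynomial (Fin d) ℂ) :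
    AllMoments volume (fun ξ : Space d => evalAt q ξ * Complex.exp (-evalAt p ξ)) := by
  obtain ⟨c, hc, hpc⟩ := hpell
  obtain ⟨C, N, hC, hq⟩ := norm_evalAt_le q
  refine allMoments_of_le ((continuous_evalAt q).mul (continuous_evalAt p).neg.cexp)
    (C := C) hc (N := N) hℓ fun ξ => ?_
  rw [norm_mul, norm_exp_neg_evalAt, ← mul_assoc]
  refine mul_le_mul (hq ξ) (Real.exp_le_exp.2 ?_) (Real.exp_pos _).le (by positivity)
  linarith [hpc ξ]

lemma allMoments_exp (hℓ : 0 < ℓ) (hpell : StronglyElliptic p ℓ) :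
    AllMoments volume (fun ξ : Space d => Complex.exp (-evalAt p ξ)) := by
  have := allMoments_evalAt_mul_exp hℓ hpell 1
  simpa [evalAt] using this

/-- The normalizing constant `(2π)^{-d}`. -/
def normConst (d : ℕ) : ℂ := ((2 * (Real.pi : ℂ)) ^ d)⁻¹

lemma profileH_eq (p : MvPolynomial (Fin d) ℂ) :
    profileH p = fourierInt volume (fun ξ => normConst d * Complex.exp (-evalAt p ξ)) := by
  funext y
  rw [fourierInt_const_mul]
  rfl

lemma contDiff_profileH (hℓ : 0 < ℓ) (hpell : StronglyElliptic p ℓ) :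
    ContDiff ℝ (⊤ : ℕ∞) (profileH p) := by
  have h1 : profileH p = fun y =>
      normConst d * fourierInt volume (fun ξ => Complex.exp (-evalAt p ξ)) y := by
    funext y
    rw [profileH_eq, fourierInt_const_mul]
  rw [h1]
  exact contDiff_const.mul (allMoments_exp hℓ hpell).contDiff_fourierInt

lemma profileHk_eq (hℓ : 0 < ℓ) (hpell : StronglyElliptic p ℓ)
    (a : MvPolynomial (Fin d ⊕ Fin d) ℂ) (k : ℕ) (y : Space d) :
    profileHk p a ℓ k y = normConst d *
      fourierInt volume (fun ξ => evalAt (corrPoly a ℓ k) ξ * Complex.exp (-evalAt p ξ)) y := by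
  have h1 : AllMoments volume (fun ξ : Space d => normConst d * Complex.exp (-evalAt p ξ)) := by
    simpa only [evalAt_C] using allMoments_evalAt_mul_exp hℓ hpell
      (MvPolynomial.C (normConst d))
  rw [profileHk, profileH_eq, polyD_fourierInt h1, ← fourierInt_const_mul]
  congr 1
  funext ξ
  ring

lemma continuous_profileHk (hℓ : 0 < ℓ) (hpell : StronglyElliptic p ℓ)
    (a : MvPolynomial (Fin d ⊕ Fin d) ℂ) (k : ℕ) : Continuous (profileHk p a ℓ k) := by
  have h1 : profileHk p a ℓ k = fun y => normConst d *
      fourierInt volume (fun ξ => evalAt (corrPoly a ℓ k) ξ * Complex.exp (-evalAt p ξ)) y :=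
    funext (profileHk_eq hℓ hpell a k)
  rw [h1]
  exact continuous_const.mul
    (allMoments_evalAt_mul_exp hℓ hpell (corrPoly a ℓ k)).contDiff_fourierInt.continuous

end Profile

/-! ### Comparison of the discrete and the continuous exponentials -/

section Comparison

variable {a : MvPolynomial (Fin d ⊕ Fin d) ℂ} {ℓ M : ℕ} {p : MvPolynomial (Fin d) ℂ}

/-- The function `θ ↦ e^{-s^{-ℓ} A(θ)}`. -/
def discreteExp (a : MvPolynomial (Fin d ⊕ Fin d) ℂ) (ℓ : ℕ) (s : ℝ) (θ : Space d) : ℂ :=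
  Complex.exp (-(((s : ℂ) ^ ℓ)⁻¹ * symbol a θ))

lemma continuous_discreteExp (a : MvPolynomial (Fin d ⊕ Fin d) ℂ) (ℓ : ℕ) (s : ℝ) :
    Continuous (discreteExp a ℓ s) :=
  (continuous_const.mul (continuous_symbol a)).neg.cexp

lemma norm_discreteExp (a : MvPolynomial (Fin d ⊕ Fin d) ℂ) (ℓ : ℕ) (s : ℝ) (θ : Space d) :
    ‖discreteExp a ℓ s θ‖ = Real.exp (-((s ^ ℓ)⁻¹ * (symbol a θ).re)) := by
  rw [discreteExp, Complex.norm_exp, Complex.neg_re, ← Complex.ofReal_pow, ← Complex.ofReal_inv,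
    Complex.re_ofReal_mul]

lemma norm_discreteExp_smul_le {c : ℝ}
    (hc : ∀ θ ∈ cube d Real.pi, c * ‖θ‖ ^ ℓ ≤ (symbol a θ).re) {s : ℝ} (hs : 0 < s)
    {ξ : Space d} (hξ : s • ξ ∈ cube d Real.pi) :
    ‖discreteExp a ℓ s (s • ξ)‖ ≤ Real.exp (-c * ‖ξ‖ ^ ℓ) := by
  rw [norm_discreteExp, Real.exp_le_exp, neg_mul, neg_le_neg_iff]
  have h1 := hc _ hξ
  rw [norm_smul, Real.norm_of_nonneg hs.le, mul_pow] at h1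
  rw [inv_mul_eq_div, le_div_iff₀ (by positivity)]
  linarith

lemma norm_indicator_discreteExp_le {c : ℝ}
    (hc : ∀ θ ∈ cube d Real.pi, c * ‖θ‖ ^ ℓ ≤ (symbol a θ).re) {s : ℝ} (hs : 0 < s)
    (ξ : Space d) :
    ‖(cube d Real.pi).indicator (discreteExp a ℓ s) (s • ξ)‖ ≤ Real.exp (-c * ‖ξ‖ ^ ℓ) := by
  by_cases hξ : s • ξ ∈ cube d Real.pi
  · rw [Set.indicator_of_mem hξ]
    exact norm_discreteExp_smul_le hc hs hξ
  · rw [Set.indicator_of_notMem hξ, norm_zero]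
    exact (Real.exp_pos _).le

/-- Let `f = s^{-ℓ}A(sξ) - 𝒜(ξ)`. Then `|f| ≤ C₁ s|ξ|^{ℓ+1}`, and for `s|ξ| ≤ ρ` also `|f| ≤
(c/2)|ξ|^ℓ`. The first bound turns the Taylor remainder `|f|^K e^{|f|}` into order `s^K`; the second
lets half of the decay `e^{-c|ξ|^ℓ}` absorb `e^{|f|}`. -/
lemma comparison_near (hℓ : 0 < ℓ) (hM : 1 ≤ M) (hp : p.IsHomogeneous ℓ)
    {c : ℝ} (hc : 0 < c) (hpc : ∀ ξ : Space d, c * ‖ξ‖ ^ ℓ ≤ (evalAt p ξ).re)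
    (ha : ∀ ν ∈ a.support, ℓ ≤ ν.degree) (happ : IsApproximation a ℓ M p)
    (Λ : ℝ) (K : ℕ) :
    ∃ (ρ C : ℝ) (N : ℕ), 0 < ρ ∧ ρ ≤ Real.pi ∧ 0 ≤ C ∧
      ∀ (s : ℝ) (ξ : Space d), 0 < s → s ≤ Λ → s * ‖ξ‖ ≤ ρ →
      ‖discreteExp a ℓ s (s • ξ) - ∑ k ∈ Finset.range K, (s : ℂ) ^ k *
        (evalAt (corrPoly a ℓ k) ξ * Complex.exp (-evalAt p ξ))‖ ≤
      C * s ^ K * ((1 + ‖ξ‖) ^ N * Real.exp (-(c / 2) * ‖ξ‖ ^ ℓ)) := by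
  obtain ⟨C₁, hC₁, hsub⟩ := norm_symbol_sub_le hℓ hM hp happ ha 1
  set ρ : ℝ := min 1 (c / (2 * (C₁ + 1))) with hρ
  have hρ0 : 0 < ρ := lt_min one_pos (by positivity)
  have hCρ : C₁ * ρ ≤ c / 2 := by
    calc C₁ * ρ ≤ (C₁ + 1) * (c / (2 * (C₁ + 1))) :=
          mul_le_mul (by linarith) (min_le_right _ _) hρ0.le (by linarith)
      _ = c / 2 := by field_simp
  obtain ⟨C₂, N₂, hC₂, h₂⟩ := isRemainder_sum_corrPoly (Λ := Λ) (r := ρ) hM ha happ K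
  refine ⟨ρ, C₁ ^ K + C₂, max ((ℓ + 1) * K) N₂, hρ0,
    (min_le_left _ _).trans (by linarith [Real.pi_gt_three]), by positivity, ?_⟩
  intro s ξ hs hsΛ hsξ
  set f : ℂ := ((s : ℂ) ^ ℓ)⁻¹ * symbol a (s • ξ) - evalAt p ξ with hf
  have hs0 : (s : ℂ) ≠ 0 := by exact_mod_cast hs.ne'
  have hns : ‖s • ξ‖ = s * ‖ξ‖ := by rw [norm_smul, Real.norm_of_nonneg hs.le]
  have h1 : 1 ≤ 1 + ‖ξ‖ := by linarith [norm_nonneg ξ]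
  have hfn : ‖f‖ ≤ C₁ * (s * ‖ξ‖) * ‖ξ‖ ^ ℓ := by
    have h3 := hsub (s • ξ) (by rw [hns]; exact hsξ.trans (min_le_left _ _))
    have h4 : f = ((s : ℂ) ^ ℓ)⁻¹ * (symbol a (s • ξ) - evalAt p (s • ξ)) := by
      rw [evalAt_smul_of_isHomogeneous hp, mul_sub, inv_mul_cancel_left₀ (pow_ne_zero _ hs0)]
    rw [h4, norm_mul, norm_inv, norm_pow, Complex.norm_real, Real.norm_of_nonneg hs.le]
    calc _ ≤ (s ^ ℓ)⁻¹ * (C₁ * ‖s • ξ‖ ^ (ℓ + 1)) :=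
          mul_le_mul_of_nonneg_left h3 (by positivity)
      _ = _ := by
          rw [hns, mul_pow]
          field_simp
          ring
  have hfc : ‖f‖ ≤ c / 2 * ‖ξ‖ ^ ℓ := by
    refine hfn.trans (mul_le_mul_of_nonneg_right ?_ (by positivity))
    exact (mul_le_mul_of_nonneg_left hsξ hC₁).trans hCρ
  have hexp : discreteExp a ℓ s (s • ξ) = Complex.exp (-f) * Complex.exp (-evalAt p ξ) := by
    rw [discreteExp, ← Complex.exp_add, hf]
    congr 1
    ring
  have hE : Real.exp (-(evalAt p ξ).re) ≤ Real.exp (-c * ‖ξ‖ ^ ℓ) := by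
    rw [Real.exp_le_exp]
    linarith [hpc ξ]
  -- Two errors: truncating the exponential series of `e^{-f}`, and replacing the truncated series
  -- by its expansion in `s`.
  have hsplit : discreteExp a ℓ s (s • ξ) - ∑ k ∈ Finset.range K, (s : ℂ) ^ k *
        (evalAt (corrPoly a ℓ k) ξ * Complex.exp (-evalAt p ξ)) =
      (Complex.exp (-f) - ∑ m ∈ Finset.range K, (-f) ^ m / (m.factorial : ℂ)) *
        Complex.exp (-evalAt p ξ) +
      ((∑ m ∈ Finset.range K, (-f) ^ m / (m.factorial : ℂ)) -
        ∑ k ∈ Finset.range K, (s : ℂ) ^ k * evalAt (corrPoly a ℓ k) ξ) *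
        Complex.exp (-evalAt p ξ) := by
    rw [hexp]
    simp only [← mul_assoc, ← Finset.sum_mul]
    ring
  have hpart1 : ‖(Complex.exp (-f) - ∑ m ∈ Finset.range K, (-f) ^ m / (m.factorial : ℂ)) *
      Complex.exp (-evalAt p ξ)‖ ≤ C₁ ^ K * s ^ K * ((1 + ‖ξ‖) ^ (max ((ℓ + 1) * K) N₂) *
        Real.exp (-(c / 2) * ‖ξ‖ ^ ℓ)) := by
    rw [norm_mul, norm_exp_neg_evalAt]
    have h5 := Complex.norm_exp_sub_sum_le_norm_mul_exp (-f) K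
    rw [norm_neg] at h5
    calc _ ≤ (‖f‖ ^ K * Real.exp ‖f‖) * Real.exp (-c * ‖ξ‖ ^ ℓ) :=
          mul_le_mul h5 hE (Real.exp_pos _).le (by positivity)
      _ = ‖f‖ ^ K * Real.exp (‖f‖ - c * ‖ξ‖ ^ ℓ) := by
          rw [mul_assoc, ← Real.exp_add]
          congr 2
          ring
      _ ≤ (C₁ * (s * ‖ξ‖) * ‖ξ‖ ^ ℓ) ^ K * Real.exp (-(c / 2) * ‖ξ‖ ^ ℓ) := by
          refine mul_le_mul (pow_le_pow_left₀ (norm_nonneg _) hfn K) (Real.exp_le_exp.2 ?_)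
            (Real.exp_pos _).le (by positivity)
          linarith
      _ = C₁ ^ K * s ^ K * (‖ξ‖ ^ ((ℓ + 1) * K) * Real.exp (-(c / 2) * ‖ξ‖ ^ ℓ)) := by
          rw [mul_pow, mul_pow, mul_pow, pow_mul, pow_succ, mul_pow]
          ring
      _ ≤ _ := by
          refine mul_le_mul_of_nonneg_left (mul_le_mul_of_nonneg_right ?_ (Real.exp_pos _).le)
            (by positivity)
          exact (pow_le_pow_left₀ (norm_nonneg _) (by linarith) _).trans
            (pow_le_pow_right₀ h1 (le_max_left _ _))
  have hpart2 : ‖((∑ m ∈ Finset.range K, (-f) ^ m / (m.factorial : ℂ)) -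
      ∑ k ∈ Finset.range K, (s : ℂ) ^ k * evalAt (corrPoly a ℓ k) ξ) *
      Complex.exp (-evalAt p ξ)‖ ≤ C₂ * s ^ K * ((1 + ‖ξ‖) ^ (max ((ℓ + 1) * K) N₂) *
        Real.exp (-(c / 2) * ‖ξ‖ ^ ℓ)) := by
    rw [norm_mul, norm_exp_neg_evalAt, ← mul_assoc]
    refine mul_le_mul ((h₂ s ξ hs hsΛ hsξ).trans ?_) (hE.trans (Real.exp_le_exp.2 ?_))
      (Real.exp_pos _).le (by positivity)
    · exact mul_le_mul_of_nonneg_left (pow_le_pow_right₀ h1 (le_max_right _ _)) (by positivity)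
    · have : 0 ≤ c * ‖ξ‖ ^ ℓ := by positivity
      linarith
  rw [hsplit, add_mul, add_mul]
  exact (norm_add_le _ _).trans (add_le_add hpart1 hpart2)

/-- For `s|ξ| > ρ` the two terms are not compared: each is exponentially small in `ξ`, and since `1
≤ (s(1+|ξ|)/ρ)^K` there, the factor `s^K` is bought with polynomial growth. -/
lemma comparison (hℓ : 0 < ℓ) (hM : 1 ≤ M) (hp : p.IsHomogeneous ℓ)
    (hpell : StronglyElliptic p ℓ)
    (ha : ∀ ν ∈ a.support, ℓ ≤ ν.degree) (happ : IsApproximation a ℓ M p)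
    (haell : DiscretelyElliptic a) (Λ : ℝ) (K : ℕ) :
    ∃ (C c : ℝ) (N : ℕ), 0 ≤ C ∧ 0 < c ∧ ∀ (s : ℝ) (ξ : Space d), 0 < s → s ≤ Λ →
      ‖(cube d Real.pi).indicator (discreteExp a ℓ s) (s • ξ) -
        ∑ k ∈ Finset.range K, (s : ℂ) ^ k *
          (evalAt (corrPoly a ℓ k) ξ * Complex.exp (-evalAt p ξ))‖ ≤
      C * s ^ K * ((1 + ‖ξ‖) ^ N * Real.exp (-c * ‖ξ‖ ^ ℓ)) := by
  obtain ⟨cA, hcA, hA⟩ := symbol_re_lower_bound hℓ hM hp hpell ha happ haell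
  obtain ⟨cp, hcp, hpc⟩ := hpell
  obtain ⟨ρ, C₁, N₁, hρ, hρπ, hC₁, hnear⟩ := comparison_near hℓ hM hp hcp hpc ha happ Λ K
  obtain ⟨C₂, N₂, hC₂, hsum⟩ : IsRemainder Λ (fun _ (_ : Space d) => True) 0
      (fun s ξ => ∑ k ∈ Finset.range K, (s : ℂ) ^ k * evalAt (corrPoly a ℓ k) ξ) :=
    IsRemainder.sum _ fun k _ => (IsRemainder.pow_mul_evalAt k _).mono (Nat.zero_le k)
  set c := min cA (cp / 2) with hcdef
  have hc : 0 < c := lt_min hcA (by positivity)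
  refine ⟨C₁ + (1 + C₂) / ρ ^ K, c, max N₁ (N₂ + K), by positivity, hc, fun s ξ hs hsΛ => ?_⟩
  have h1 : 1 ≤ 1 + ‖ξ‖ := by linarith [norm_nonneg ξ]
  have hexpc : ∀ c', c ≤ c' → Real.exp (-c' * ‖ξ‖ ^ ℓ) ≤ Real.exp (-c * ‖ξ‖ ^ ℓ) := by
    intro c' hcc
    rw [Real.exp_le_exp, neg_mul, neg_mul, neg_le_neg_iff]
    exact mul_le_mul_of_nonneg_right hcc (by positivity)
  by_cases hsξ : s * ‖ξ‖ ≤ ρ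
  · have hmem : s • ξ ∈ cube d Real.pi := by
      intro k
      have h3 := PiLp.norm_apply_le (s • ξ) k
      rw [norm_smul, Real.norm_of_nonneg hs.le, Real.norm_eq_abs] at h3
      linarith
    rw [Set.indicator_of_mem hmem]
    refine (hnear s ξ hs hsΛ hsξ).trans ?_
    refine mul_le_mul (mul_le_mul_of_nonneg_right ?_ (by positivity))
      (mul_le_mul (pow_le_pow_right₀ h1 (le_max_left _ _)) (hexpc _ (min_le_right _ _))
        (Real.exp_pos _).le (by positivity)) (by positivity) (by positivity)
    have : 0 ≤ (1 + C₂) / ρ ^ K := by positivity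
    linarith
  · have hfar : ρ ^ K ≤ s ^ K * (1 + ‖ξ‖) ^ K := by
      rw [← mul_pow]
      refine pow_le_pow_left₀ hρ.le ?_ K
      nlinarith [not_le.1 hsξ]
    have hb : ‖(cube d Real.pi).indicator (discreteExp a ℓ s) (s • ξ) -
        ∑ k ∈ Finset.range K, (s : ℂ) ^ k *
          (evalAt (corrPoly a ℓ k) ξ * Complex.exp (-evalAt p ξ))‖ ≤
        (1 + C₂) * ((1 + ‖ξ‖) ^ N₂ * Real.exp (-c * ‖ξ‖ ^ ℓ)) := by
      have h4 := (norm_indicator_discreteExp_le hA hs ξ).trans (hexpc _ (min_le_left _ _))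
      have h5 : ‖∑ k ∈ Finset.range K, (s : ℂ) ^ k *
          (evalAt (corrPoly a ℓ k) ξ * Complex.exp (-evalAt p ξ))‖ ≤
          C₂ * ((1 + ‖ξ‖) ^ N₂ * Real.exp (-c * ‖ξ‖ ^ ℓ)) := by
        simp only [← mul_assoc, ← Finset.sum_mul]
        rw [norm_mul, norm_exp_neg_evalAt]
        have h6 := hsum s ξ hs hsΛ trivial
        rw [pow_zero, mul_one] at h6
        refine mul_le_mul h6 ((Real.exp_le_exp.2 ?_).trans (hexpc cp ?_)) (Real.exp_pos _).le
          (by positivity)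
        · linarith [hpc ξ]
        · exact (min_le_right _ _).trans (by linarith)
      have h7 : Real.exp (-c * ‖ξ‖ ^ ℓ) ≤ (1 + ‖ξ‖) ^ N₂ * Real.exp (-c * ‖ξ‖ ^ ℓ) :=
        le_mul_of_one_le_left (Real.exp_pos _).le (one_le_pow₀ h1)
      refine (norm_sub_le _ _).trans ?_
      linarith
    calc _ ≤ (1 + C₂) * ((1 + ‖ξ‖) ^ N₂ * Real.exp (-c * ‖ξ‖ ^ ℓ)) := hb
      _ = (1 + C₂) / ρ ^ K * ρ ^ K * ((1 + ‖ξ‖) ^ N₂ * Real.exp (-c * ‖ξ‖ ^ ℓ)) := by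
          field_simp
      _ ≤ (1 + C₂) / ρ ^ K * (s ^ K * (1 + ‖ξ‖) ^ K) *
          ((1 + ‖ξ‖) ^ N₂ * Real.exp (-c * ‖ξ‖ ^ ℓ)) :=
          mul_le_mul_of_nonneg_right (mul_le_mul_of_nonneg_left hfar (by positivity))
            (by positivity)
      _ = (1 + C₂) / ρ ^ K * s ^ K * ((1 + ‖ξ‖) ^ (N₂ + K) * Real.exp (-c * ‖ξ‖ ^ ℓ)) := by
          ring
      _ ≤ _ := by
          refine mul_le_mul (mul_le_mul_of_nonneg_right (by linarith) (by positivity))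
            (mul_le_mul_of_nonneg_right (pow_le_pow_right₀ h1 (le_max_right _ _))
              (Real.exp_pos _).le) (by positivity) (by positivity)

lemma integrable_indicator_discreteExp (a : MvPolynomial (Fin d ⊕ Fin d) ℂ) (ℓ : ℕ) (s : ℝ) :
    Integrable ((cube d Real.pi).indicator (discreteExp a ℓ s)) := by
  rw [integrable_indicator_iff (isCompact_cube d Real.pi).measurableSet]
  exact (continuous_discreteExp a ℓ s).continuousOn.integrableOn_compact (isCompact_cube d _)

lemma fourierInt_cube_eq {s : ℝ} (hs : 0 < s) (φ : Space d → ℂ) (y : Space d) :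
    fourierInt (volume.restrict (cube d Real.pi)) φ y =
      (s : ℂ) ^ d * fourierInt volume
        (fun ξ => (cube d Real.pi).indicator φ (s • ξ)) (s • y) := by
  have h1 := Measure.integral_comp_smul (volume : Measure (Space d))
    (fun θ => (cube d Real.pi).indicator φ θ * wave y θ) s
  rw [finrank_euclideanSpace_fin, abs_of_nonneg (by positivity)] at h1
  simp only [fourierInt, wave_smul]
  rw [h1, Complex.real_smul, ← integral_indicator (isCompact_cube d Real.pi).measurableSet]
  have h2 : (fun θ => (cube d Real.pi).indicator φ θ * wave y θ) =
      (cube d Real.pi).indicator (fun θ => φ θ * wave y θ) := by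
    funext θ
    by_cases hθ : θ ∈ cube d Real.pi <;> simp [hθ]
  have hs0 : (s : ℂ) ≠ 0 := by exact_mod_cast hs.ne'
  rw [h2]
  push_cast
  rw [mul_inv_cancel_left₀ (pow_ne_zero _ hs0)]

/-- Expansion of the first discrete Green function at the time `s^{-ℓ}`. -/
lemma discreteExp_expansion (hℓ : 0 < ℓ) (hM : 1 ≤ M) (hp : p.IsHomogeneous ℓ)
    (hpell : StronglyElliptic p ℓ)
    (ha : ∀ ν ∈ a.support, ℓ ≤ ν.degree) (happ : IsApproximation a ℓ M p)
    (haell : DiscretelyElliptic a) (Λ : ℝ) (K : ℕ) :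
    ∃ C : ℝ, 0 ≤ C ∧ ∀ (s : ℝ) (y : Space d), 0 < s → s ≤ Λ →
      ‖normConst d * fourierInt (volume.restrict (cube d Real.pi)) (discreteExp a ℓ s) y -
        ∑ k ∈ Finset.range K, (s : ℂ) ^ (d + k) * profileHk p a ℓ k (s • y)‖ ≤
      C * s ^ (d + K) := by
  obtain ⟨C, c, N, hC, hc, h⟩ := comparison hℓ hM hp hpell ha happ haell Λ K
  refine ⟨‖normConst d‖ * (C * ∫ ξ : Space d, (1 + ‖ξ‖) ^ N * Real.exp (-c * ‖ξ‖ ^ ℓ)), ?_, ?_⟩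
  · refine mul_nonneg (norm_nonneg _) (mul_nonneg hC (integral_nonneg fun ξ => ?_))
    positivity
  intro s y hs hsΛ
  have hint : ∀ k ∈ Finset.range K, Integrable (fun ξ : Space d => (s : ℂ) ^ k *
      (evalAt (corrPoly a ℓ k) ξ * Complex.exp (-evalAt p ξ))) := fun k _ =>
    (allMoments_evalAt_mul_exp hℓ hpell _).integrable.const_mul _
  have h1 : normConst d * fourierInt (volume.restrict (cube d Real.pi)) (discreteExp a ℓ s) y -
        ∑ k ∈ Finset.range K, (s : ℂ) ^ (d + k) * profileHk p a ℓ k (s • y) =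
      normConst d * ((s : ℂ) ^ d * fourierInt volume (fun ξ =>
        (cube d Real.pi).indicator (discreteExp a ℓ s) (s • ξ) -
        ∑ k ∈ Finset.range K, (s : ℂ) ^ k *
          (evalAt (corrPoly a ℓ k) ξ * Complex.exp (-evalAt p ξ))) (s • y)) := by
    rw [fourierInt_sub ((integrable_indicator_discreteExp a ℓ s).comp_smul hs.ne')
      (integrable_finsetSum _ hint), fourierInt_finset_sum _ hint, fourierInt_cube_eq hs]
    simp only [profileHk_eq hℓ hpell, fourierInt_const_mul, mul_sub, Finset.mul_sum]
    congr 1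
    refine Finset.sum_congr rfl fun k _ => ?_
    rw [pow_add]
    ring
  rw [h1, norm_mul, norm_mul, norm_pow, Complex.norm_real, Real.norm_of_nonneg hs.le]
  -- The Fourier integral is bounded by the `L¹` norm of its density, which makes the estimate
  -- uniform in `y`.
  have h2 : ‖fourierInt volume (fun ξ =>
        (cube d Real.pi).indicator (discreteExp a ℓ s) (s • ξ) -
        ∑ k ∈ Finset.range K, (s : ℂ) ^ k *
          (evalAt (corrPoly a ℓ k) ξ * Complex.exp (-evalAt p ξ))) (s • y)‖ ≤
      C * s ^ K * ∫ ξ : Space d, (1 + ‖ξ‖) ^ N * Real.exp (-c * ‖ξ‖ ^ ℓ) := by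
    rw [← integral_const_mul]
    refine norm_integral_le_of_norm_le ((integrable_pow_mul_exp hc N hℓ).const_mul _)
      (Filter.Eventually.of_forall fun ξ => ?_)
    rw [norm_mul, norm_wave, mul_one]
    exact h s ξ hs hsΛ
  calc _ ≤ ‖normConst d‖ * (s ^ d *
        (C * s ^ K * ∫ ξ : Space d, (1 + ‖ξ‖) ^ N * Real.exp (-c * ‖ξ‖ ^ ℓ))) :=
        mul_le_mul_of_nonneg_left (mul_le_mul_of_nonneg_left h2 (by positivity)) (norm_nonneg _)
    _ = _ := by ring

end Comparison

/-! ### Integrability near the origin -/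

lemma measurableSet_cube (d : ℕ) (lam : ℝ) : MeasurableSet (cube d lam) :=
  (isCompact_cube d lam).measurableSet

lemma integrableOn_norm_rpow_neg (hd : 0 < d) {β : ℝ} (hβ : β < d) :
    IntegrableOn (fun θ : Space d => ‖θ‖ ^ (-β)) (cube d Real.pi) := by
  have : Nonempty (Fin d) := ⟨⟨0, hd⟩⟩
  obtain ⟨R, hR⟩ := (isCompact_cube d Real.pi).isBounded.subset_ball (0 : Space d)
  refine IntegrableOn.mono_set ?_ (hR.trans (Metric.ball_subset_ball (le_max_left R 1)))
  rw [integrableOn_fun_norm_addHaar volume (f := fun y : ℝ => y ^ (-β)),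
    finrank_euclideanSpace_fin]
  have h1 : IntegrableOn (fun y : ℝ => y ^ ((d : ℝ) - 1 - β)) (Set.Ioo 0 (max R 1)) :=
    (intervalIntegral.integrableOn_Ioo_rpow_iff (lt_max_of_lt_right one_pos)).2 (by linarith)
  refine h1.congr_fun (fun y hy => ?_) measurableSet_Ioo
  have hc : (d : ℝ) - 1 = ((d - 1 : ℕ) : ℝ) := by
    rw [Nat.cast_sub hd]
    simp
  beta_reduce
  rw [smul_eq_mul, sub_eq_add_neg _ β, Real.rpow_add hy.1, hc, Real.rpow_natCast]

section Time

variable {a : MvPolynomial (Fin d ⊕ Fin d) ℂ} {ℓ M : ℕ} {p : MvPolynomial (Fin d) ℂ}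

/-- `|1/A|` is at most a multiple of `|θ|^{-ℓ}`, which is integrable near the origin because `ℓ <
d`. -/
lemma integrableOn_inv_symbol (hd : ℓ < d) {c : ℝ} (hc : 0 < c)
    (hA : ∀ θ ∈ cube d Real.pi, c * ‖θ‖ ^ ℓ ≤ (symbol a θ).re) (h0 : symbol a 0 = 0) :
    IntegrableOn (fun θ : Space d => (symbol a θ)⁻¹) (cube d Real.pi) := by
  have h1 := (integrableOn_norm_rpow_neg (d := d) (β := ℓ) (by omega)
    (by exact_mod_cast hd)).const_mul c⁻¹
  refine h1.mono' (continuous_symbol a).measurable.inv.aestronglyMeasurable ?_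
  rw [ae_restrict_iff' (measurableSet_cube d _)]
  refine Filter.Eventually.of_forall fun θ hθ => ?_
  by_cases hθ0 : θ = 0
  · subst hθ0
    rw [h0, inv_zero, norm_zero]
    positivity
  · have hpos : 0 < ‖θ‖ := norm_pos_iff.2 hθ0
    rw [norm_inv, Real.rpow_neg hpos.le, Real.rpow_natCast, ← mul_inv]
    exact inv_anti₀ (by positivity) ((hA θ hθ).trans (Complex.re_le_norm _))

/-- The kernel `ℓ s^{-ℓ-1} e^{-s^{-ℓ} A(θ)}`, whose integral over `0 < s ≤ Λ` is
`e^{-Λ^{-ℓ} A(θ)} / A(θ)`. -/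
def timeKernel (a : MvPolynomial (Fin d ⊕ Fin d) ℂ) (ℓ : ℕ) (s : ℝ) (θ : Space d) : ℂ :=
  (ℓ : ℂ) * ((s : ℂ) ^ (ℓ + 1))⁻¹ * discreteExp a ℓ s θ

/-- With `z = |θ|/s` one has `e^{-cz^ℓ} ≤ C₀ z^{-(ℓ+1/2)}`. The exponent is chosen so that the
kernel is dominated by a product of integrable factors: `s^{-1/2}` near `s = 0`, and
`|θ|^{-(ℓ+1/2)}` on the cube, where `ℓ + 1/2 < d` because `ℓ < d` are integers. This justifies
Fubini's theorem. -/
lemma norm_timeKernel_le (hℓ : 0 < ℓ) {c : ℝ} (hc : 0 < c)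
    (hA : ∀ θ ∈ cube d Real.pi, c * ‖θ‖ ^ ℓ ≤ (symbol a θ).re) :
    ∃ C : ℝ, ∀ s : ℝ, 0 < s → ∀ θ ∈ cube d Real.pi, θ ≠ 0 →
      ‖timeKernel a ℓ s θ‖ ≤ C * s ^ (-(1 / 2) : ℝ) * ‖θ‖ ^ (-(ℓ + 1 / 2) : ℝ) := by
  set C₀ : ℝ := (ℓ + 1).factorial / c ^ (ℓ + 1) * Real.exp (2 * c) with hC₀
  refine ⟨ℓ * C₀, fun s hs θ hθ hθ0 => ?_⟩
  have hpos : 0 < ‖θ‖ := norm_pos_iff.2 hθ0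
  set z : ℝ := ‖θ‖ / s with hz
  have hz0 : 0 < z := div_pos hpos hs
  have h1 : ‖discreteExp a ℓ s θ‖ ≤ Real.exp (-c * z ^ ℓ) := by
    rw [norm_discreteExp, Real.exp_le_exp, neg_mul, neg_le_neg_iff, hz, div_pow,
      inv_mul_eq_div, ← mul_div_assoc]
    exact div_le_div_of_nonneg_right (hA θ hθ) (by positivity)
  have h2 : z ^ ((ℓ : ℝ) + 1 / 2) * Real.exp (-c * z ^ ℓ) ≤ C₀ := by
    refine le_trans (mul_le_mul_of_nonneg_right ?_ (Real.exp_pos _).le)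
      (pow_mul_exp_le hc (ℓ + 1) hℓ hz0.le)
    calc z ^ ((ℓ : ℝ) + 1 / 2) ≤ (1 + z) ^ ((ℓ : ℝ) + 1 / 2) :=
          Real.rpow_le_rpow hz0.le (by linarith) (by positivity)
      _ ≤ (1 + z) ^ (((ℓ + 1 : ℕ) : ℝ)) :=
          Real.rpow_le_rpow_of_exponent_le (by linarith) (by push_cast; linarith)
      _ = (1 + z) ^ (ℓ + 1) := Real.rpow_natCast _ _
  have h3 : Real.exp (-c * z ^ ℓ) ≤ C₀ * (s ^ ((ℓ : ℝ) + 1 / 2) * ‖θ‖ ^ (-(ℓ + 1 / 2) : ℝ)) := by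
    have h4 : s ^ ((ℓ : ℝ) + 1 / 2) * ‖θ‖ ^ (-(ℓ + 1 / 2) : ℝ) = (z ^ ((ℓ : ℝ) + 1 / 2))⁻¹ := by
      rw [hz, Real.div_rpow hpos.le hs.le, inv_div, Real.rpow_neg hpos.le]
      exact (div_eq_mul_inv _ _).symm
    rw [h4, ← div_eq_mul_inv, le_div_iff₀ (by positivity), mul_comm]
    exact h2
  have h5 : (s ^ (ℓ + 1))⁻¹ * s ^ ((ℓ : ℝ) + 1 / 2) = s ^ (-(1 / 2) : ℝ) := by
    rw [← Real.rpow_natCast, ← Real.rpow_neg hs.le, ← Real.rpow_add hs]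
    congr 1
    push_cast
    ring
  rw [timeKernel, norm_mul, norm_mul, norm_inv, norm_pow, Complex.norm_real,
    Real.norm_of_nonneg hs.le, Complex.norm_natCast]
  calc _ ≤ ℓ * (s ^ (ℓ + 1))⁻¹ *
        (C₀ * (s ^ ((ℓ : ℝ) + 1 / 2) * ‖θ‖ ^ (-(ℓ + 1 / 2) : ℝ))) :=
        mul_le_mul_of_nonneg_left (h1.trans h3) (by positivity)
    _ = ℓ * C₀ * ((s ^ (ℓ + 1))⁻¹ * s ^ ((ℓ : ℝ) + 1 / 2)) * ‖θ‖ ^ (-(ℓ + 1 / 2) : ℝ) := by ring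
    _ = _ := by rw [h5]

lemma ae_cube_ne_zero (hd : 0 < d) :
    ∀ᵐ θ ∂(volume.restrict (cube d Real.pi)), θ ∈ cube d Real.pi ∧ θ ≠ 0 := by
  have : Nonempty (Fin d) := ⟨⟨0, hd⟩⟩
  have h1 : ∀ᵐ θ ∂(volume.restrict (cube d Real.pi)), θ ∈ cube d Real.pi :=
    ae_restrict_mem (measurableSet_cube d _)
  have h2 : ∀ᵐ θ ∂(volume.restrict (cube d Real.pi)), θ ≠ (0 : Space d) :=
    ae_restrict_of_ae (Measure.ae_ne volume (0 : Space d))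
  filter_upwards [h1, h2] with θ h h' using ⟨h, h'⟩

lemma measurable_timeKernel (a : MvPolynomial (Fin d ⊕ Fin d) ℂ) (ℓ : ℕ) :
    Measurable (Function.uncurry (timeKernel a ℓ)) := by
  have h1 := (continuous_symbol a).measurable
  have h2 : Measurable fun z : ℝ × Space d => symbol a z.2 := h1.comp measurable_snd
  unfold timeKernel discreteExp Function.uncurry
  fun_prop

lemma integrable_timeKernel (hℓ : 0 < ℓ) (hd : ℓ < d) {c : ℝ} (hc : 0 < c)
    (hA : ∀ θ ∈ cube d Real.pi, c * ‖θ‖ ^ ℓ ≤ (symbol a θ).re) (Λ : ℝ) :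
    Integrable (Function.uncurry (timeKernel a ℓ))
      ((volume.restrict (Set.Ioc 0 Λ)).prod (volume.restrict (cube d Real.pi))) := by
  obtain ⟨C, hC⟩ := norm_timeKernel_le hℓ hc hA
  have h1 : Integrable (fun s : ℝ => C * s ^ (-(1 / 2) : ℝ)) (volume.restrict (Set.Ioc 0 Λ)) := by
    have := (intervalIntegral.intervalIntegrable_rpow' (a := 0) (b := Λ)
      (r := -(1 / 2)) (by norm_num)).1
    exact this.const_mul C
  have hdl : (ℓ : ℝ) + 1 ≤ d := by exact_mod_cast hd
  have h2 : Integrable (fun θ : Space d => ‖θ‖ ^ (-(ℓ + 1 / 2) : ℝ))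
      (volume.restrict (cube d Real.pi)) :=
    integrableOn_norm_rpow_neg (by omega) (by linarith)
  refine (h1.mul_prod h2).mono' (measurable_timeKernel a ℓ).aestronglyMeasurable ?_
  have h3 := Measure.quasiMeasurePreserving_fst
    (μ := volume.restrict (Set.Ioc 0 Λ)) (ν := volume.restrict (cube d Real.pi)) |>.ae
    (ae_restrict_mem measurableSet_Ioc)
  have h4 := Measure.quasiMeasurePreserving_snd
    (μ := volume.restrict (Set.Ioc 0 Λ)) (ν := volume.restrict (cube d Real.pi)) |>.ae
    (ae_cube_ne_zero (d := d) (by omega))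
  filter_upwards [h3, h4] with z hz hz'
  exact hC z.1 hz.1 z.2 hz'.1 hz'.2

/-- `e^{-s^{-ℓ}A}/A` is a primitive in `s`, and it tends to 0 as `s → 0` because `Re A > 0`. -/
lemma integral_timeKernel (hℓ : 0 < ℓ) {Λ : ℝ} (hΛ : 0 < Λ) {θ : Space d}
    (hre : 0 < (symbol a θ).re)
    (hint : IntegrableOn (fun s => timeKernel a ℓ s θ) (Set.Ioc 0 Λ)) :
    ∫ s in Set.Ioc 0 Λ, timeKernel a ℓ s θ = discreteExp a ℓ Λ θ / symbol a θ := by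
  set A := symbol a θ with hAdef
  have hA0 : A ≠ 0 := by
    intro h
    rw [h] at hre
    simp at hre
  have hderiv : ∀ s : ℝ, 0 < s →
      HasDerivAt (fun s : ℝ => discreteExp a ℓ s θ / A) (timeKernel a ℓ s θ) s := by
    intro s hs
    have hs0 : (s : ℂ) ≠ 0 := by exact_mod_cast hs.ne'
    obtain ⟨m, rfl⟩ : ∃ m, ℓ = m + 1 := ⟨ℓ - 1, by omega⟩
    have h1 : HasDerivAt (fun s : ℝ => (s : ℂ) ^ (m + 1)) (((m + 1 : ℕ) : ℂ) * (s : ℂ) ^ m * 1) s :=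
      (Complex.ofRealCLM.hasDerivAt (x := s)).pow (m + 1)
    have h2 := (((h1.inv (pow_ne_zero _ hs0)).mul_const A).neg.cexp).div_const A
    refine h2.congr_deriv ?_
    rw [timeKernel, discreteExp]
    simp only [Pi.inv_apply, Pi.neg_apply, ← hAdef]
    field_simp
    ring
  have hlim0 : Filter.Tendsto (fun s : ℝ => discreteExp a ℓ s θ / A)
      (nhdsWithin 0 (Set.Ioi 0)) (nhds 0) := by
    have hb : Filter.Tendsto (fun s : ℝ => s ^ ℓ / A.re / ‖A‖) (nhdsWithin 0 (Set.Ioi 0))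
        (nhds 0) := by
      have hcont : Continuous fun s : ℝ => s ^ ℓ / A.re / ‖A‖ := by fun_prop
      have := (hcont.tendsto 0).mono_left (nhdsWithin_le_nhds (s := Set.Ioi 0))
      simpa [hℓ.ne'] using this
    refine squeeze_zero_norm' ?_ hb
    filter_upwards [self_mem_nhdsWithin] with s hs
    have hs' : 0 < s := hs
    rw [norm_div, norm_discreteExp]
    refine div_le_div_of_nonneg_right ?_ (norm_nonneg _)
    rw [Real.exp_neg, ← inv_div]
    refine inv_anti₀ (by positivity) ?_
    rw [← hAdef, inv_mul_eq_div]
    linarith [Real.add_one_le_exp (A.re / s ^ ℓ)]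
  have hlimΛ : Filter.Tendsto (fun s : ℝ => discreteExp a ℓ s θ / A)
      (nhdsWithin Λ (Set.Iio Λ)) (nhds (discreteExp a ℓ Λ θ / A)) :=
    (hderiv Λ hΛ).continuousAt.tendsto.mono_left nhdsWithin_le_nhds
  rw [← intervalIntegral.integral_of_le hΛ.le,
    intervalIntegral.integral_eq_sub_of_hasDerivAt_of_tendsto hΛ (fun s hs => hderiv s hs.1)
      ((intervalIntegrable_iff_integrableOn_Ioc_of_le hΛ.le).2 hint) hlim0 hlimΛ, sub_zero]

/-- Integration in time of the first discrete Green function. -/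
lemma integral_discreteExp (hℓ : 0 < ℓ) (hd : ℓ < d) {c : ℝ} (hc : 0 < c)
    (hA : ∀ θ ∈ cube d Real.pi, c * ‖θ‖ ^ ℓ ≤ (symbol a θ).re) {Λ : ℝ} (hΛ : 0 < Λ)
    (y : Space d) :
    IntegrableOn (fun s : ℝ => (ℓ : ℂ) * ((s : ℂ) ^ (ℓ + 1))⁻¹ *
      fourierInt (volume.restrict (cube d Real.pi)) (discreteExp a ℓ s) y) (Set.Ioc 0 Λ) ∧
    ∫ s in Set.Ioc 0 Λ, (ℓ : ℂ) * ((s : ℂ) ^ (ℓ + 1))⁻¹ *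
      fourierInt (volume.restrict (cube d Real.pi)) (discreteExp a ℓ s) y =
      fourierInt (volume.restrict (cube d Real.pi))
        (fun θ => discreteExp a ℓ Λ θ / symbol a θ) y := by
  have hint := integrable_timeKernel hℓ hd hc hA Λ
  have hintw : Integrable (Function.uncurry fun s θ => timeKernel a ℓ s θ * wave y θ)
      ((volume.restrict (Set.Ioc 0 Λ)).prod (volume.restrict (cube d Real.pi))) := by
    refine hint.mono ?_ (Filter.Eventually.of_forall fun z => ?_)
    · refine Measurable.aestronglyMeasurable ?_
      exact (measurable_timeKernel a ℓ).mul ((continuous_wave y).measurable.comp measurable_snd)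
    · simp [Function.uncurry, norm_wave]
  have hker : ∀ s : ℝ, (ℓ : ℂ) * ((s : ℂ) ^ (ℓ + 1))⁻¹ *
      fourierInt (volume.restrict (cube d Real.pi)) (discreteExp a ℓ s) y =
      ∫ θ in cube d Real.pi, timeKernel a ℓ s θ * wave y θ := by
    intro s
    rw [← fourierInt_const_mul]
    rfl
  simp only [hker]
  refine ⟨hintw.integral_prod_left, ?_⟩
  rw [integral_integral_swap hintw, fourierInt]
  refine integral_congr_ae ?_
  filter_upwards [ae_cube_ne_zero (d := d) (by omega), hint.prod_left_ae] with θ hθ hθint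
  rw [integral_mul_const, integral_timeKernel hℓ hΛ ?_ hθint]
  have : 0 < ‖θ‖ := norm_pos_iff.2 hθ.2
  exact lt_of_lt_of_le (by positivity) (hA θ hθ.1)

/-! ### The functions `F_k` -/

/-- This identity is the origin of `F_k`: for `y ≠ 0` it is the substitution `ρ = |y|s`, and for `y
= 0` the integral is elementary and gives the special value `F_k(0)`. -/
lemma integral_profileHk (p : MvPolynomial (Fin d) ℂ) (a : MvPolynomial (Fin d ⊕ Fin d) ℂ)
    {k : ℕ} (hk : ℓ < d + k) {Λ : ℝ} (hΛ : 0 < Λ) (y : Space d) :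
    ∫ s in (0 : ℝ)..Λ, (ℓ : ℂ) * ((s : ℂ) ^ (d + k - ℓ - 1) * profileHk p a ℓ k (s • y)) =
      -((Λ : ℂ) ^ (d + k - ℓ) * profileFk p a ℓ k (Λ • y)) := by
  obtain ⟨n, hn⟩ : ∃ n, d + k - ℓ = n + 1 := ⟨d + k - ℓ - 1, by omega⟩
  have hΛ0 : (Λ : ℂ) ≠ 0 := by exact_mod_cast hΛ.ne'
  rw [intervalIntegral.integral_const_mul, profileFk, hn, Nat.add_sub_cancel]
  by_cases hy : y = 0
  · subst hy
    simp only [smul_zero, if_true]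
    rw [intervalIntegral.integral_mul_const]
    have h1 : ∫ s in (0 : ℝ)..Λ, (s : ℂ) ^ n = (Λ : ℂ) ^ (n + 1) / ((n + 1 : ℕ) : ℂ) := by
      have h2 : ∫ s in (0 : ℝ)..Λ, (s : ℂ) ^ n = ∫ s in (0 : ℝ)..Λ, ((s ^ n : ℝ) : ℂ) := by
        simp
      rw [h2, intervalIntegral.integral_ofReal, integral_pow]
      simp
    rw [h1]
    ring
  · have hpos : 0 < ‖y‖ := norm_pos_iff.2 hy
    have hy0 : ((‖y‖ : ℝ) : ℂ) ≠ 0 := by exact_mod_cast hpos.ne'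
    have hΛy : Λ • y ≠ 0 := smul_ne_zero hΛ.ne' hy
    rw [if_neg hΛy]
    have hnorm : ‖Λ • y‖ = ‖y‖ * Λ := by
      rw [norm_smul, Real.norm_of_nonneg hΛ.le, mul_comm]
    have hsub := intervalIntegral.integral_comp_mul_left (a := 0) (b := Λ)
      (fun ρ : ℝ => (ρ : ℂ) ^ n * profileHk p a ℓ k ((ρ / ‖Λ • y‖) • Λ • y)) hpos.ne'
    rw [mul_zero, ← hnorm] at hsub
    have hcomp : ∀ s : ℝ, ((‖y‖ * s : ℝ) : ℂ) ^ n *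
        profileHk p a ℓ k (((‖y‖ * s) / ‖Λ • y‖) • Λ • y) =
        (‖y‖ : ℂ) ^ n * ((s : ℂ) ^ n * profileHk p a ℓ k (s • y)) := by
      intro s
      have : ((‖y‖ * s) / ‖Λ • y‖) • Λ • y = s • y := by
        rw [smul_smul, hnorm]
        congr 1
        field_simp
      rw [this]
      push_cast
      ring
    simp only [hcomp] at hsub
    rw [intervalIntegral.integral_const_mul, Complex.real_smul, Complex.ofReal_inv,
      eq_inv_mul_iff_mul_eq₀ hy0] at hsub
    rw [← hsub, hnorm]
    push_cast
    field_simp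
    ring

/-- Expansion of the integrated first discrete Green function. -/
lemma discreteExp_div_symbol_expansion (hℓ : 0 < ℓ) (hd : ℓ < d) (hM : 1 ≤ M)
    (hp : p.IsHomogeneous ℓ)
    (hpell : StronglyElliptic p ℓ)
    (ha : ∀ ν ∈ a.support, ℓ ≤ ν.degree) (happ : IsApproximation a ℓ M p)
    (haell : DiscretelyElliptic a) (Λ₀ : ℝ) (K : ℕ) :
    ∃ C : ℝ, 0 ≤ C ∧ ∀ (Λ : ℝ) (y : Space d), 0 < Λ → Λ ≤ Λ₀ →
      ‖normConst d * fourierInt (volume.restrict (cube d Real.pi))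
          (fun θ => discreteExp a ℓ Λ θ / symbol a θ) y +
        ∑ k ∈ Finset.range K, (Λ : ℂ) ^ (d + k - ℓ) * profileFk p a ℓ k (Λ • y)‖ ≤
      C * Λ ^ (d + K - ℓ) := by
  obtain ⟨c, hc, hA⟩ := symbol_re_lower_bound hℓ hM hp hpell ha happ haell
  obtain ⟨C, hC, hexp⟩ := discreteExp_expansion hℓ hM hp hpell ha happ haell Λ₀ K
  refine ⟨ℓ * C, by positivity, fun Λ y hΛ hΛ₀ => ?_⟩
  obtain ⟨hint, heq⟩ := integral_discreteExp hℓ hd hc hA hΛ y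
  have hHint : ∀ k ∈ Finset.range K, IntegrableOn (fun s : ℝ => (ℓ : ℂ) *
      ((s : ℂ) ^ (d + k - ℓ - 1) * profileHk p a ℓ k (s • y))) (Set.Ioc 0 Λ) := by
    intro k _
    have hcont : Continuous fun s : ℝ => (ℓ : ℂ) *
        ((s : ℂ) ^ (d + k - ℓ - 1) * profileHk p a ℓ k (s • y)) :=
      continuous_const.mul ((Complex.continuous_ofReal.pow _).mul
        ((continuous_profileHk hℓ hpell a k).comp (by fun_prop)))
    exact hcont.integrableOn_Ioc
  have hF : ∀ k, (Λ : ℂ) ^ (d + k - ℓ) * profileFk p a ℓ k (Λ • y) =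
      -∫ s in Set.Ioc 0 Λ, (ℓ : ℂ) *
        ((s : ℂ) ^ (d + k - ℓ - 1) * profileHk p a ℓ k (s • y)) := by
    intro k
    rw [← intervalIntegral.integral_of_le hΛ.le, integral_profileHk p a (by omega) hΛ, neg_neg]
  have hkey : normConst d * fourierInt (volume.restrict (cube d Real.pi))
          (fun θ => discreteExp a ℓ Λ θ / symbol a θ) y +
        ∑ k ∈ Finset.range K, (Λ : ℂ) ^ (d + k - ℓ) * profileFk p a ℓ k (Λ • y) =
      ∫ s in Set.Ioc 0 Λ, (ℓ : ℂ) * ((s : ℂ) ^ (ℓ + 1))⁻¹ *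
        (normConst d * fourierInt (volume.restrict (cube d Real.pi)) (discreteExp a ℓ s) y -
        ∑ k ∈ Finset.range K, (s : ℂ) ^ (d + k) * profileHk p a ℓ k (s • y)) := by
    simp only [hF]
    rw [Finset.sum_neg_distrib, ← integral_finsetSum _ hHint, ← heq, ← integral_const_mul,
      ← sub_eq_add_neg, ← integral_sub (hint.const_mul _) (integrable_finsetSum _ hHint)]
    refine setIntegral_congr_fun measurableSet_Ioc fun s hs => ?_
    have hs0 : (s : ℂ) ≠ 0 := by exact_mod_cast hs.1.ne'
    beta_reduce
    rw [mul_sub, Finset.mul_sum]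
    congr 1
    · ring
    · refine Finset.sum_congr rfl fun k _ => ?_
      have h1 : (s : ℂ) ^ (d + k) = (s : ℂ) ^ (ℓ + 1) * (s : ℂ) ^ (d + k - ℓ - 1) := by
        rw [← pow_add]
        congr 1
        omega
      rw [h1]
      field_simp
  rw [hkey, ← intervalIntegral.integral_of_le hΛ.le]
  -- The bound on the integrand is increasing in `s`, so its value at `Λ` times the length `Λ` gives
  -- the required order.
  have hbound : ∀ s ∈ Set.uIoc 0 Λ, ‖(ℓ : ℂ) * ((s : ℂ) ^ (ℓ + 1))⁻¹ *
        (normConst d * fourierInt (volume.restrict (cube d Real.pi)) (discreteExp a ℓ s) y -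
        ∑ k ∈ Finset.range K, (s : ℂ) ^ (d + k) * profileHk p a ℓ k (s • y))‖ ≤
      ℓ * C * Λ ^ (d + K - ℓ - 1) := by
    intro s hs
    rw [Set.uIoc_of_le hΛ.le] at hs
    rw [norm_mul, norm_mul, norm_inv, norm_pow, Complex.norm_real, Real.norm_of_nonneg hs.1.le,
      Complex.norm_natCast]
    have hs1 := hs.1
    calc _ ≤ ℓ * (s ^ (ℓ + 1))⁻¹ * (C * s ^ (d + K)) :=
          mul_le_mul_of_nonneg_left (hexp s y hs.1 (hs.2.trans hΛ₀)) (by positivity)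
      _ = ℓ * C * s ^ (d + K - ℓ - 1) := by
          have h1 : s ^ (d + K) = s ^ (ℓ + 1) * s ^ (d + K - ℓ - 1) := by
            rw [← pow_add]
            congr 1
            omega
          rw [h1]
          field_simp
      _ ≤ _ := mul_le_mul_of_nonneg_left (pow_le_pow_left₀ hs.1.le hs.2 _) (by positivity)
  refine (intervalIntegral.norm_integral_le_of_norm_le_const hbound).trans (le_of_eq ?_)
  rw [sub_zero, abs_of_pos hΛ, mul_assoc, ← pow_succ]
  congr 2
  omega

end Time

/-! ### Orthogonality of the characters on the cube -/

lemma integral_exp_int (n : ℤ) :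
    ∫ s in Set.Icc (-Real.pi) Real.pi, Complex.exp (Complex.I * (((n : ℝ) * s : ℝ) : ℂ)) =
      if n = 0 then 2 * (Real.pi : ℂ) else 0 := by
  have hpi : -Real.pi ≤ Real.pi := by linarith [Real.pi_pos]
  rw [integral_Icc_eq_integral_Ioc, ← intervalIntegral.integral_of_le hpi]
  split_ifs with h
  · subst h
    simp
    ring
  · have hn : Complex.I * (n : ℂ) ≠ 0 := mul_ne_zero Complex.I_ne_zero (by exact_mod_cast h)
    have h1 : ∀ s : ℝ, Complex.exp (Complex.I * (((n : ℝ) * s : ℝ) : ℂ)) =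
        Complex.exp (Complex.I * (n : ℂ) * s) := by
      intro s
      push_cast
      ring_nf
    simp only [h1]
    rw [integral_exp_mul_complex hn]
    have h2 : Complex.exp (Complex.I * n * (Real.pi : ℝ)) =
        Complex.exp (Complex.I * n * ((-Real.pi : ℝ) : ℂ)) := by
      rw [Complex.exp_eq_exp_iff_exists_int]
      refine ⟨n, ?_⟩
      push_cast
      ring
    rw [h2, sub_self, zero_div]

/-- The wave is a product over the coordinates, so the integral factors into one-dimensional ones.
-/
lemma fourierInt_cube_one (y : Space d) (n : Fin d → ℤ) (hn : ∀ k, y k = n k) :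
    fourierInt (volume.restrict (cube d Real.pi)) (fun _ => 1) y =
      if n = 0 then (2 * (Real.pi : ℂ)) ^ d else 0 := by
  have hmp := EuclideanSpace.volume_preserving_symm_measurableEquiv_toLp (Fin d)
  have hcube : cube d Real.pi = (MeasurableEquiv.toLp 2 (Fin d → ℝ)).symm ⁻¹'
      (Set.univ.pi fun _ => Set.Icc (-Real.pi) Real.pi) := by
    ext θ
    simp only [cube, Set.mem_ofPred_eq, Set.mem_preimage, Set.mem_pi, Set.mem_univ, true_imp_iff,
      Set.mem_Icc, abs_le]
    rfl
  have hwave : ∀ θ : Space d, (1 : ℂ) * wave y θ = (fun x : Fin d → ℝ =>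
      ∏ k, Complex.exp (Complex.I * (((n k : ℝ) * x k : ℝ) : ℂ)))
        ((MeasurableEquiv.toLp 2 (Fin d → ℝ)).symm θ) := by
    intro θ
    beta_reduce
    rw [one_mul, wave, PiLp.inner_apply, ← Complex.exp_sum]
    congr 1
    rw [← Finset.mul_sum]
    congr 1
    push_cast
    refine Finset.sum_congr rfl fun k _ => ?_
    have : (MeasurableEquiv.toLp 2 (Fin d → ℝ)).symm θ k = θ k := rfl
    rw [this, hn k]
    simp [mul_comm]
  rw [fourierInt, funext hwave, hcube]
  refine (hmp.setIntegral_preimage_emb (MeasurableEquiv.measurableEmbedding _)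
    (fun x : Fin d → ℝ => ∏ k, Complex.exp (Complex.I * (((n k : ℝ) * x k : ℝ) : ℂ))) _).trans ?_
  rw [volume_pi, Measure.restrict_pi_pi, integral_fintype_prod_eq_prod
      (f := fun (k : Fin d) (s : ℝ) => Complex.exp (Complex.I * (((n k : ℝ) * s : ℝ) : ℂ)))]
  simp only [integral_exp_int]
  split_ifs with h
  · subst h
    simp
  · obtain ⟨k, hk⟩ := Function.ne_iff.1 h
    exact Finset.prod_eq_zero (Finset.mem_univ k) (if_neg hk)

/-- For a grid point `x` the vector `x/ε` is integral, so orthogonality of the characters represents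
the grid delta-function as the Fourier integral of the constant 1. -/
lemma normConst_mul_fourierInt_one {ε : ℝ} (hε : 0 < ε) (x : grid d ε) :
    ((ε : ℂ) ^ d)⁻¹ * (normConst d * fourierInt (volume.restrict (cube d Real.pi)) (fun _ => 1)
      (ε⁻¹ • (x : Space d))) = gridDelta d ε x := by
  choose n hn using x.2
  have hn' : ∀ k, (ε⁻¹ • (x : Space d)) k = n k := by
    intro k
    rw [PiLp.smul_apply, smul_eq_mul, hn k]
    field_simp
  have hiff : n = 0 ↔ x = 0 := by
    constructor
    · intro h
      ext k
      rw [hn k, h]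
      simp
    · rintro rfl
      funext k
      have := hn k
      simpa [hε.ne'] using this.symm
  rw [fourierInt_cube_one _ n hn', gridDelta, normConst]
  simp only [hiff]
  have : (Real.pi : ℂ) ≠ 0 := by exact_mod_cast Real.pi_ne_zero
  split_ifs
  · field_simp
  · simp

/-! ### The Fourier formula for the second discrete Green function -/

section Solution

variable {a : MvPolynomial (Fin d ⊕ Fin d) ℂ} {ℓ M : ℕ} {p : MvPolynomial (Fin d) ℂ}

/-- The function `(1 - e^{-τ A(θ)}) / A(θ)`. -/
def greenMultiplier (a : MvPolynomial (Fin d ⊕ Fin d) ℂ) (τ : ℝ) (θ : Space d) : ℂ :=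
  (symbol a θ)⁻¹ * (1 - Complex.exp (-(τ * symbol a θ)))

lemma symbol_mul_greenMultiplier (τ : ℝ) (θ : Space d) :
    symbol a θ * greenMultiplier a τ θ = 1 - Complex.exp (-(τ * symbol a θ)) := by
  by_cases h : symbol a θ = 0
  · simp [h, greenMultiplier]
  · rw [greenMultiplier, mul_inv_cancel_left₀ h]

lemma continuous_exp_symbol (a : MvPolynomial (Fin d ⊕ Fin d) ℂ) :
    Continuous (fun z : ℝ × Space d => Complex.exp (-(z.1 * symbol a z.2))) := by
  have := continuous_symbol a
  fun_prop

lemma integrable_exp_symbol (a : MvPolynomial (Fin d ⊕ Fin d) ℂ) (τ : ℝ) :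
    Integrable (fun θ : Space d => Complex.exp (-(τ * symbol a θ)))
      (volume.restrict (cube d Real.pi)) := by
  have h1 : Continuous fun θ : Space d => Complex.exp (-(τ * symbol a θ)) :=
    (continuous_exp_symbol a).comp (by fun_prop : Continuous fun θ : Space d => (τ, θ))
  exact h1.continuousOn.integrableOn_compact (isCompact_cube d _)

lemma integrable_one_cube : Integrable (fun _ : Space d => (1 : ℂ))
    (volume.restrict (cube d Real.pi)) :=
  continuous_const.continuousOn.integrableOn_compact (isCompact_cube d _)

lemma integrable_greenMultiplier
    (hint : IntegrableOn (fun θ : Space d => (symbol a θ)⁻¹) (cube d Real.pi)) (τ : ℝ) :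
    Integrable (greenMultiplier a τ) (volume.restrict (cube d Real.pi)) := by
  have h1 : Continuous fun θ : Space d => 1 - Complex.exp (-(τ * symbol a θ)) :=
    continuous_const.sub
      ((continuous_exp_symbol a).comp (by fun_prop : Continuous fun θ : Space d => (τ, θ)))
  exact IntegrableOn.mul_continuousOn hint h1.continuousOn (isCompact_cube d _)

/-- Differentiation in `τ` cancels the singular factor `1/A`; since `A` is bounded on the cube, a
constant dominates the derivative for `τ` in a bounded interval. -/
lemma hasDerivAt_fourierInt_greenMultiplier
    (hne : ∀ᵐ θ ∂(volume.restrict (cube d Real.pi)), θ ∈ cube d Real.pi ∧ symbol a θ ≠ 0)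
    (hint : IntegrableOn (fun θ : Space d => (symbol a θ)⁻¹) (cube d Real.pi)) (y : Space d)
    (τ : ℝ) :
    HasDerivAt (fun τ => fourierInt (volume.restrict (cube d Real.pi)) (greenMultiplier a τ) y)
      (fourierInt (volume.restrict (cube d Real.pi))
        (fun θ => Complex.exp (-(τ * symbol a θ))) y) τ := by
  obtain ⟨S, hS⟩ := (isCompact_cube d Real.pi).exists_bound_of_continuousOn
    (continuous_symbol a).continuousOn
  refine (hasDerivAt_integral_of_dominated_loc_of_deriv_le (𝕜 := ℝ)
    (μ := volume.restrict (cube d Real.pi)) (x₀ := τ) (s := Metric.ball τ 1)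
    (F := fun τ θ => greenMultiplier a τ θ * wave y θ)
    (F' := fun τ θ => Complex.exp (-(τ * symbol a θ)) * wave y θ)
    (bound := fun _ => Real.exp ((|τ| + 1) * |S|)) (Metric.ball_mem_nhds τ one_pos)
    (Filter.Eventually.of_forall fun σ =>
      (integrable_mul_wave (integrable_greenMultiplier hint σ) y).1)
    (integrable_mul_wave (integrable_greenMultiplier hint τ) y)
    (integrable_mul_wave (integrable_exp_symbol a τ) y).1 ?_ ?_ ?_).2
  · filter_upwards [hne] with θ hθ σ hσ
    rw [norm_mul, norm_wave, mul_one]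
    refine (Complex.norm_exp_le_exp_norm _).trans (Real.exp_le_exp.2 ?_)
    rw [norm_neg, norm_mul, Complex.norm_real, Real.norm_eq_abs]
    have h1 : |σ| ≤ |τ| + 1 := by
      have h2 : |σ - τ| < 1 := by simpa [Real.dist_eq] using hσ
      have h3 : |σ| ≤ |τ| + |σ - τ| := by simpa using abs_add_le τ (σ - τ)
      linarith
    exact mul_le_mul h1 ((hS θ hθ.1).trans (le_abs_self S)) (norm_nonneg _) (by positivity)
  · exact continuous_const.continuousOn.integrableOn_compact (isCompact_cube d _)
  · filter_upwards [hne] with θ hθ σ _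
    have h1 : HasDerivAt (fun σ : ℝ => -((σ : ℂ) * symbol a θ)) (-(1 * symbol a θ)) σ :=
      ((Complex.ofRealCLM.hasDerivAt (x := σ)).mul_const _).neg
    have h2 := ((h1.cexp.const_sub 1).const_mul ((symbol a θ)⁻¹)).mul_const (wave y θ)
    refine h2.congr_deriv ?_
    have := hθ.2
    field_simp

lemma continuous_fourierInt_exp_symbol (a : MvPolynomial (Fin d ⊕ Fin d) ℂ) (y : Space d) :
    Continuous (fun τ : ℝ => fourierInt (volume.restrict (cube d Real.pi))
      (fun θ => Complex.exp (-(τ * symbol a θ))) y) := by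
  refine continuous_parametric_integral_of_continuous ?_ (isCompact_cube d _)
  exact (continuous_exp_symbol a).mul ((continuous_wave y).comp continuous_snd)

/-- The second discrete Green function given by the Fourier formula. -/
def fourierGreen (a : MvPolynomial (Fin d ⊕ Fin d) ℂ) (ℓ : ℕ) (ε : ℝ) (x : grid d ε) (t : ℝ) : ℂ :=
  (ε : ℂ) ^ ℓ * ((ε : ℂ) ^ d)⁻¹ * (normConst d *
    fourierInt (volume.restrict (cube d Real.pi)) (greenMultiplier a (t / ε ^ ℓ))
      (ε⁻¹ • (x : Space d)))

/-- Under the Fourier integral the equation reads `e^{-τA} + A·(1 - e^{-τA})/A = 1`. Rapid decay is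
not derived from regularity of the multiplier: the integral is bounded in `x`, and
`rapidlyDecreasing_of_bounded` does the rest. -/
lemma isSecondGreen_fourierGreen
    (hne : ∀ᵐ θ ∂(volume.restrict (cube d Real.pi)), θ ∈ cube d Real.pi ∧ symbol a θ ≠ 0)
    (hint : IntegrableOn (fun θ : Space d => (symbol a θ)⁻¹) (cube d Real.pi))
    {ε : ℝ} (hε : 0 < ε) : IsSecondGreen a ℓ ε (fourierGreen a ℓ ε) := by
  have hε0 : (ε : ℂ) ≠ 0 := by exact_mod_cast hε.ne'
  have hderiv : ∀ (x : grid d ε) (t : ℝ), HasDerivAt (fourierGreen a ℓ ε x)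
      (((ε : ℂ) ^ d)⁻¹ * (normConst d * fourierInt (volume.restrict (cube d Real.pi))
        (fun θ => Complex.exp (-(((t / ε ^ ℓ : ℝ) : ℂ) * symbol a θ))) (ε⁻¹ • (x : Space d)))) t := by
    intro x t
    have h1 := hasDerivAt_fourierInt_greenMultiplier hne hint (ε⁻¹ • (x : Space d)) (t / ε ^ ℓ)
    have h2 : HasDerivAt (fun t : ℝ => t / ε ^ ℓ) (1 / ε ^ ℓ) t := (hasDerivAt_id t).div_const _
    have h3 := ((h1.scomp t h2).const_mul (normConst d)).const_mul
      ((ε : ℂ) ^ ℓ * ((ε : ℂ) ^ d)⁻¹)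
    refine h3.congr_deriv ?_
    rw [Complex.real_smul]
    push_cast
    field_simp
  have hC1 : ∀ x, ContDiffOn ℝ 1 (fourierGreen a ℓ ε x) (Set.Ici 0) := by
    intro x
    refine ContDiff.contDiffOn (contDiff_one_iff_deriv.2
      ⟨fun t => (hderiv x t).differentiableAt, ?_⟩)
    rw [show deriv (fourierGreen a ℓ ε x) = _ from funext fun t => (hderiv x t).deriv]
    exact continuous_const.mul (continuous_const.mul
      ((continuous_fourierInt_exp_symbol a (ε⁻¹ • (x : Space d))).comp
        (by fun_prop : Continuous fun t : ℝ => t / ε ^ ℓ)))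
  let ι : grid d ε →+ Space d :=
    (DistribSMul.toAddMonoidHom (Space d) ε⁻¹).comp (grid d ε).subtype
  have hι : ∀ x : grid d ε, ι x = ε⁻¹ • (x : Space d) := fun x => rfl
  have hιstep : ∀ k, ι (gridStep d ε k) = EuclideanSpace.single k 1 := by
    intro k
    rw [hι]
    ext j
    by_cases hj : j = k <;> simp [gridStep, hj, hε.ne']
  have hform : ∀ t, (fun x => fourierGreen a ℓ ε x t) = fun x =>
      fourierInt (volume.restrict (cube d Real.pi)) (fun θ => (ε : ℂ) ^ ℓ * ((ε : ℂ) ^ d)⁻¹ *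
        normConst d * greenMultiplier a (t / ε ^ ℓ) θ) (ι x) := by
    intro t
    funext x
    rw [fourierInt_const_mul, hι, fourierGreen]
    ring
  have heqn : ∀ x, ∀ t : ℝ, 0 < t → deriv (fourierGreen a ℓ ε x) t +
      diffOp a ℓ ε (gridStep d ε) (fun z => fourierGreen a ℓ ε z t) x = gridDelta d ε x := by
    intro x t _
    rw [(hderiv x t).deriv, hform, diffOp_fourierInt ι
      ((integrable_greenMultiplier hint _).const_mul _) _ hιstep]
    have h1 : (fun θ => symbol a θ * ((ε : ℂ) ^ ℓ * ((ε : ℂ) ^ d)⁻¹ * normConst d *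
        greenMultiplier a (t / ε ^ ℓ) θ)) = fun θ => (ε : ℂ) ^ ℓ * ((ε : ℂ) ^ d)⁻¹ * normConst d *
        (1 - Complex.exp (-(((t / ε ^ ℓ : ℝ) : ℂ) * symbol a θ))) := by
      funext θ
      rw [← symbol_mul_greenMultiplier]
      ring
    rw [h1, fourierInt_const_mul, fourierInt_sub integrable_one_cube (integrable_exp_symbol a _),
      hι, ← normConst_mul_fourierInt_one hε x]
    field_simp
    ring
  have hinit : ∀ x, fourierGreen a ℓ ε x 0 = 0 := by
    intro x
    have h1 : greenMultiplier a (0 / ε ^ ℓ) = fun _ => 0 := by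
      funext θ
      simp [greenMultiplier]
    rw [fourierGreen, h1, fourierInt_zero, mul_zero, mul_zero]
  refine ⟨fun t ht => rapidlyDecreasing_of_bounded hε hC1 heqn hinit (fun s _ => ?_) ht,
    hC1, heqn, hinit⟩
  exact ⟨∫ θ in cube d Real.pi, ‖(ε : ℂ) ^ ℓ * ((ε : ℂ) ^ d)⁻¹ * normConst d *
    greenMultiplier a (s / ε ^ ℓ) θ‖, fun x =>
    (congrArg norm (congrFun (hform s) x)).le.trans (norm_fourierInt_le _ _ _)⟩

lemma profileFk_eq_zero (ha : ∀ ν ∈ a.support, ℓ ≤ ν.degree)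
    (happ : IsApproximation a ℓ M p) {k : ℕ} (hk : 0 < k) (hkM : k < M) (y : Space d) :
    profileFk p a ℓ k y = 0 := by
  have h1 : ∀ z, profileHk p a ℓ k z = 0 := by
    intro z
    rw [profileHk, corrPoly_eq_zero ha happ hk hkM]
    simp [polyD]
  simp [profileFk, h1]

/-- The two parts of the multiplier `(1 - e^{-τA})/A` are separately integrable because `1/A` is;
the first gives the limit profile `Ω`. -/
lemma fourierGreen_eq (hint : IntegrableOn (fun θ : Space d => (symbol a θ)⁻¹) (cube d Real.pi))
    {ε t Λ : ℝ} (hΛ : (Λ ^ ℓ)⁻¹ = t / ε ^ ℓ) (x : grid d ε) :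
    fourierGreen a ℓ ε x t = (ε : ℂ) ^ ℓ * ((ε : ℂ) ^ d)⁻¹ * (Omega a (ε⁻¹ • (x : Space d)) -
      normConst d * fourierInt (volume.restrict (cube d Real.pi))
        (fun θ => discreteExp a ℓ Λ θ / symbol a θ) (ε⁻¹ • (x : Space d))) := by
  have hexp : ∀ θ : Space d, Complex.exp (-(((t / ε ^ ℓ : ℝ) : ℂ) * symbol a θ)) =
      discreteExp a ℓ Λ θ := by
    intro θ
    rw [discreteExp, ← hΛ]
    push_cast
    rfl
  have hOmega : Omega a (ε⁻¹ • (x : Space d)) = normConst d *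
      fourierInt (volume.restrict (cube d Real.pi)) (fun θ => (symbol a θ)⁻¹)
        (ε⁻¹ • (x : Space d)) := by
    rw [Omega, fourierInt, normConst]
    simp only [div_eq_inv_mul]
    rfl
  have hint2 : IntegrableOn (fun θ : Space d => discreteExp a ℓ Λ θ / symbol a θ)
      (cube d Real.pi) := by
    simp only [div_eq_inv_mul]
    exact IntegrableOn.mul_continuousOn hint (continuous_discreteExp a ℓ Λ).continuousOn
      (isCompact_cube d _)
  rw [hOmega, ← mul_sub, ← fourierInt_sub hint hint2, fourierGreen]
  congr 3
  funext θ
  rw [greenMultiplier, hexp]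
  ring

end Solution

/-! ### Rescaling in `ε` and `t`, and assembly of the expansion. -/

lemma scaling_identity {d ℓ k n : ℕ} (hℓ : 0 < ℓ) (hn : d + k = ℓ + n) {ε t : ℝ} (hε : 0 < ε)
    (ht : 0 < t) :
    ε ^ k * t ^ (1 - ((k : ℝ) + (d : ℝ)) / (ℓ : ℝ)) =
      ε ^ ℓ * (ε ^ d)⁻¹ * (ε * (t ^ (1 / (ℓ : ℝ)))⁻¹) ^ n := by
  have hℓ0 : (ℓ : ℝ) ≠ 0 := by positivity
  have hcast : (d : ℝ) + k = ℓ + n := by exact_mod_cast hn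
  have h1 : 1 - ((k : ℝ) + (d : ℝ)) / (ℓ : ℝ) = (1 / (ℓ : ℝ)) * (-(n : ℝ)) := by
    field_simp
    linarith
  have hε2 : ε ^ ℓ * ε ^ n = ε ^ d * ε ^ k := by rw [← pow_add, ← pow_add, hn]
  rw [h1, Real.rpow_mul ht.le, Real.rpow_neg (by positivity), Real.rpow_natCast, mul_pow, inv_pow]
  field_simp
  linarith

end

end LatticeGreen

theorem theorem2 (d ℓ M : ℕ) (hℓ : 0 < ℓ) (hℓeven : Even ℓ) (hM : 1 ≤ M)
    (hℓd : (ℓ : ℤ) - (d : ℤ) ≤ -1)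
    -- the strongly elliptic homogeneous operator of order `ℓ`
    (p : MvPolynomial (Fin d) ℂ) (hp : p.IsHomogeneous ℓ) (hpell : StronglyElliptic p ℓ)
    -- the elliptic difference operator, of order `M` of approximation
    (a : MvPolynomial (Fin d ⊕ Fin d) ℂ) (ha : ∀ ν ∈ a.support, ℓ ≤ ν.degree)
    (happ : IsApproximation a ℓ M p) (haell : DiscretelyElliptic a) :
    -- the objects in the expansion are well defined
    (∀ y : Space d, IntegrableOn
      (fun θ : Space d => Complex.exp (Complex.I * (inner ℝ y θ : ℂ)) / symbol a θ)
      (cube d Real.pi)) ∧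
    Integrable (fun ξ : Space d => Complex.exp (-evalAt p ξ)) ∧
    ContDiff ℝ (⊤ : ℕ∞) (profileH p) ∧
    (∀ ε : ℝ, 0 < ε → ∃ v : grid d ε → ℝ → ℂ, IsSecondGreen a ℓ ε v) ∧
    -- the expansion, with a remainder bound uniform in `ε`, `x` and `t ≥ t₀ ε^ℓ`
    ∀ t₀ : ℝ, 0 < t₀ → ∀ K : ℕ, M ≤ K → ∃ R : ℝ, 0 ≤ R ∧
      ∀ ε : ℝ, 0 < ε → ∀ v : grid d ε → ℝ → ℂ, IsSecondGreen a ℓ ε v →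
        ∀ (x : grid d ε) (t : ℝ), t₀ * ε ^ ℓ ≤ t →
          ‖v x t -
            (((ε ^ ((ℓ : ℤ) - (d : ℤ)) : ℝ) : ℂ) * Omega a (ε⁻¹ • (x : Space d))
              + ((t ^ (1 - (d : ℝ) / (ℓ : ℝ)) : ℝ) : ℂ) *
                  profileFk p a ℓ 0 ((t ^ (1 / (ℓ : ℝ)))⁻¹ • (x : Space d))
              + ∑ k ∈ Finset.Icc M K,
                  ((ε ^ k * t ^ (1 - ((k : ℝ) + (d : ℝ)) / (ℓ : ℝ)) : ℝ) : ℂ) *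
                    profileFk p a ℓ k ((t ^ (1 / (ℓ : ℝ)))⁻¹ • (x : Space d)))‖
          ≤ ε ^ (K + 1) * R * t ^ (1 - ((K : ℝ) + (d : ℝ) + 1) / (ℓ : ℝ)) := by
  have hd : ℓ < d := by omega
  obtain ⟨c, hc, hA⟩ := symbol_re_lower_bound hℓ hM hp hpell ha happ haell
  have hint : IntegrableOn (fun θ : Space d => (symbol a θ)⁻¹) (cube d Real.pi) :=
    integrableOn_inv_symbol hd hc hA (symbol_zero hℓ ha)
  have hne : ∀ᵐ θ ∂(volume.restrict (cube d Real.pi)), θ ∈ cube d Real.pi ∧ symbol a θ ≠ 0 := by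
    filter_upwards [ae_cube_ne_zero (d := d) (by omega)] with θ hθ
    refine ⟨hθ.1, fun h => ?_⟩
    have := haell θ hθ.1 hθ.2
    simp [h] at this
  refine ⟨fun y => ?_, (allMoments_exp hℓ hpell).integrable, contDiff_profileH hℓ hpell,
    fun ε hε => ⟨_, isSecondGreen_fourierGreen hne hint hε⟩, fun t₀ ht₀ K hMK => ?_⟩
  · simp only [div_eq_inv_mul]
    exact integrable_mul_wave hint y
  -- `K + 1` terms, with indices `0, …, K`, leave a remainder of order `Λ^{d+K+1-ℓ}`. The constant
  -- `R` depends on `ε` and `t` only through the upper limit for `Λ`, which is `t₀^{-1/ℓ}`.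
  obtain ⟨R, hR, hexp⟩ := discreteExp_div_symbol_expansion hℓ hd hM hp hpell ha happ haell
    (t₀ ^ (1 / (ℓ : ℝ)))⁻¹ (K + 1)
  refine ⟨R, hR, fun ε hε v hv x t ht => ?_⟩
  have ht0 : 0 < t := lt_of_lt_of_le (by positivity) ht
  have hℓ0 : (ℓ : ℝ) ≠ 0 := by positivity
  set T : ℝ := t ^ (1 / (ℓ : ℝ)) with hT
  have hT0 : 0 < T := by positivity
  have hTℓ : T ^ ℓ = t := by
    rw [hT, ← Real.rpow_natCast, ← Real.rpow_mul ht0.le, one_div_mul_cancel hℓ0, Real.rpow_one]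
  set Λ : ℝ := ε * T⁻¹ with hΛ
  have hΛ0 : 0 < Λ := by positivity
  -- This is the condition `t ≥ t₀ ε^ℓ` after taking `ℓ`th roots.
  have hΛle : Λ ≤ (t₀ ^ (1 / (ℓ : ℝ)))⁻¹ := by
    have h1 : t₀ ^ (1 / (ℓ : ℝ)) * ε ≤ T := by
      have h2 : (t₀ * ε ^ ℓ) ^ (1 / (ℓ : ℝ)) = t₀ ^ (1 / (ℓ : ℝ)) * ε := by
        rw [Real.mul_rpow ht₀.le (by positivity), ← Real.rpow_natCast ε, ← Real.rpow_mul hε.le,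
          mul_one_div_cancel hℓ0, Real.rpow_one]
      rw [← h2]
      exact Real.rpow_le_rpow (by positivity) ht (by positivity)
    rw [hΛ, ← div_eq_mul_inv, div_le_iff₀ hT0, inv_mul_eq_div, le_div_iff₀ (by positivity)]
    linarith
  have hΛinv : (Λ ^ ℓ)⁻¹ = t / ε ^ ℓ := by
    rw [hΛ, mul_pow, inv_pow, hTℓ, mul_inv, inv_inv]
    field_simp
  have hΛx : Λ • (ε⁻¹ • (x : Space d)) = T⁻¹ • (x : Space d) := by
    rw [smul_smul, hΛ]
    congr 1
    field_simp
  have hscale : ∀ k : ℕ, ε ^ k * t ^ (1 - ((k : ℝ) + (d : ℝ)) / (ℓ : ℝ)) =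
      ε ^ ℓ * (ε ^ d)⁻¹ * Λ ^ (d + k - ℓ) := fun k =>
    scaling_identity hℓ (by omega) hε ht0
  have hzpow : ε ^ ((ℓ : ℤ) - (d : ℤ)) = ε ^ ℓ * (ε ^ d)⁻¹ := by
    rw [zpow_sub₀ hε.ne', zpow_natCast, zpow_natCast, div_eq_mul_inv]
  have hsum : ((t ^ (1 - (d : ℝ) / (ℓ : ℝ)) : ℝ) : ℂ) *
        profileFk p a ℓ 0 (T⁻¹ • (x : Space d)) +
      ∑ k ∈ Finset.Icc M K, ((ε ^ k * t ^ (1 - ((k : ℝ) + (d : ℝ)) / (ℓ : ℝ)) : ℝ) : ℂ) *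
        profileFk p a ℓ k (T⁻¹ • (x : Space d)) =
      ((ε ^ ℓ * (ε ^ d)⁻¹ : ℝ) : ℂ) * ∑ k ∈ Finset.range (K + 1), (Λ : ℂ) ^ (d + k - ℓ) *
        profileFk p a ℓ k (Λ • (ε⁻¹ • (x : Space d))) := by
    have h0 : t ^ (1 - (d : ℝ) / (ℓ : ℝ)) = ε ^ ℓ * (ε ^ d)⁻¹ * Λ ^ (d + 0 - ℓ) := by
      have := hscale 0
      simpa using this
    -- The sum over `0 ≤ k ≤ K` reduces to `k = 0` and `M ≤ k ≤ K`, since `F_k = 0` for `0 < k < M`.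
    have hsub : Finset.Icc M K ⊆ Finset.Icc 1 K := Finset.Icc_subset_Icc hM le_rfl
    have hrange : Finset.range (K + 1) = insert 0 (Finset.Icc 1 K) := by
      ext k
      simp only [Finset.mem_range, Finset.mem_insert, Finset.mem_Icc]
      omega
    rw [hΛx, hrange, Finset.sum_insert (by simp), mul_add, h0, Finset.mul_sum]
    congr 1
    · push_cast
      ring
    · rw [← Finset.sum_subset hsub]
      · refine Finset.sum_congr rfl fun k _ => ?_
        rw [hscale k]
        push_cast
        ring
      · intro k hk hk'
        rw [Finset.mem_Icc] at hk hk'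
        rw [profileFk_eq_zero ha happ (by omega) (by omega), mul_zero, mul_zero]
  have hB : 0 ≤ ε ^ ℓ * (ε ^ d)⁻¹ := by positivity
  rw [hv.unique (isSecondGreen_fourierGreen hne hint hε) x ht0.le, fourierGreen_eq hint hΛinv,
    add_assoc, hsum, hzpow]
  have hfinal : ε ^ (K + 1) * R * t ^ (1 - ((K : ℝ) + (d : ℝ) + 1) / (ℓ : ℝ)) =
      ε ^ ℓ * (ε ^ d)⁻¹ * (R * Λ ^ (d + (K + 1) - ℓ)) := by
    have h1 := hscale (K + 1)
    push_cast at h1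
    have h2 : (K : ℝ) + (d : ℝ) + 1 = (K : ℝ) + 1 + (d : ℝ) := by ring
    rw [h2]
    linear_combination R * h1
  rw [hfinal]
  -- Up to sign, the remainder is `ε^{ℓ-d}` times the quantity estimated in `hexp`, because the
  -- Fourier integral of `e^{-τA}/A` enters the solution with a minus sign.
  refine le_trans (le_of_eq ?_) (mul_le_mul_of_nonneg_left
    (hexp Λ (ε⁻¹ • (x : Space d)) hΛ0 hΛle) hB)
  have hnB : ε ^ ℓ * (ε ^ d)⁻¹ = ‖((ε ^ ℓ * (ε ^ d)⁻¹ : ℝ) : ℂ)‖ := by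
    rw [Complex.norm_real, Real.norm_of_nonneg hB]
  conv_rhs => rw [hnB, ← norm_mul, ← norm_neg]
  congr 1
  push_cast
  ring
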